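/- Let $\mathbb G=(\mathbb R^n,\circ,\{\delta_R\}_{R>0})$ be a (homogeneous) Carnot group: a smooth group law on $\mathbb R^n$ with identity $0$ for which the dilations $\delta_R(x)=(R^{w_i}x_i)_{i}$, with positive integer weights $w_i$, are automorphisms and such that, writing $X_i$ for the left-invariant vector field with $X_i(0)=\partial_i$ and $V_k$ for the span of those $X_i$ with $w_i=k$, one has $[V_1,V_k]=V_{k+1}$ for all $k\ge 1$. Let $Q=\sum_i w_i\ge 1$ be the homogeneous dimension, let $\nabla_0 u=(X_j u)_{w_j=1}$ be the horizontal gradient (understood weakly when $u$ is only locally Lipschitz), with the metric making these $X_j$ orthonormal, and let $dx$ be Lebesgue measure. Let $r$ be a symmetric homogeneous norm on $\mathbb G$ (continuous, smooth off $0$, $r(x)>0$ iff $x\ne0$, $r(\delta_R x)=R\,r(x)$, $r(x^{-1})=r(x)$), normalized so that $|\nabla_0 r|\le 1$ off the origin. Lipschitz functions are those with $u(x)-u(y)\le C\,r(x^{-1}\circ y)$. Let $p>1$ and let $\varphi\in C^0([0,\infty))$ satisfy $\varphi(0)=0$, $\varphi>0$ on $(0,\infty)$ and $\varphi(t)\le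 Ct^{p-1}$ on $(0,\infty)$ for some $C>0$. Let $\mu,\sigma,\chi\in\mathbb R$ satisfy $$0\le\chi<p-1,\qquad \mu\le p-\chi,\qquad 0\le\sigma\le\sigma^*:=\frac{p-\chi-\mu}{p-\chi-1},$$ and let $u\in \mathrm{Lip}_{\rm loc}(\mathbb G)$ be such that $$\hat u:=\limsup_{r(x)\to+\infty}\frac{u_+(x)}{r(x)^\sigma}<+\infty .$$ Suppose that $u$ is non-constant and that, for some $\gamma\in\mathbb R$ and $K\in\mathbb R$, the set $\Omega_\gamma=\{u>\gamma\}$ is non-empty and $u$ is a weak solution on $\Omega_\gamma$ of $$\Delta^\varphi_{\mathbb G}u\ \ge\ K(1+r)^{-\mu}\,l(|\nabla_0u|),\qquad l(t)=\frac{\varphi(t)}{t^{p-1-\chi}}\ \text{ for } t>0,\quad l(0)\ge 0 \text{ arbitrary},$$ that is, for every $0\le\psi\in \mathrm{Lip}_c(\Omega_\gamma)$, $$\int_{\Omega_\gamma}\frac{\varphi(|\nabla_0u|)}{|\nabla_0u|}\langle\nabla_0u,\nabla_0\psi\rangle\,dx\ \le\ -\int_{\Omega_\gamma}K(1+r)^{-\mu}\,l(|\nabla_0u|)\,\psi\,dx$$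 (the integrand on the left being $0$ where $\nabla_0u=0$). Then $$K\le H\,\hat u^{\,p-\chi-1},$$ where $H=0$ if $\sigma<\sigma^*$, or $\sigma=\sigma^*=0$, or $\sigma=\sigma^*>0$ and $(p-1)(\sigma-1)\le 1-Q$; and $H=\sigma^{p-\chi-1}\big[(p-1)(\sigma-1)+Q-1\big]$ if $\sigma=\sigma^*>0$ and $(p-1)(\sigma-1)>1-Q$. -/

import Mathlib

open MeasureTheory Filter Topology
open scoped ContDiff NNReal

noncomputable section

/-- The anisotropic dilation of `ℝⁿ` whose `i`-th coordinate has weight `w i`. -/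
def dilation {n : ℕ} (w : Fin n → ℕ) (R : ℝ) (x : Fin n → ℝ) : Fin n → ℝ :=
  fun i => R ^ w i * x i

/-- A smooth group structure on `ℝⁿ` with identity `0`, for which the dilations attached to a
system of positive integer weights are group automorphisms. -/
structure HomogeneousGroup (n : ℕ) where
  mul : (Fin n → ℝ) → (Fin n → ℝ) → (Fin n → ℝ)
  inv : (Fin n → ℝ) → (Fin n → ℝ)
  mul_assoc : ∀ x y z, mul (mul x y) z = mul x (mul y z)
  zero_mul : ∀ x, mul 0 x = x
  mul_zero : ∀ x, mul x 0 = x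
  inv_mul : ∀ x, mul (inv x) x = 0
  contDiff_mul : ContDiff ℝ ∞ fun z : (Fin n → ℝ) × (Fin n → ℝ) => mul z.1 z.2
  contDiff_inv : ContDiff ℝ ∞ inv
  weight : Fin n → ℕ
  weight_pos : ∀ i, 1 ≤ weight i
  dilation_mul : ∀ R : ℝ, 0 < R → ∀ x y,
    dilation weight R (mul x y) = mul (dilation weight R x) (dilation weight R y)

namespace HomogeneousGroup

variable {n : ℕ} (G : HomogeneousGroup n)

/-- The left-invariant vector field which equals `∂_i` at the identity. -/
def leftInvField (i : Fin n) (x : Fin n → ℝ) : Fin n → ℝ :=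
  fderiv ℝ (fun y => G.mul x y) 0 (Pi.single i 1)

/-- The layer `V_k`: the span of the left-invariant fields `X_i` with `i` of weight `k`. -/
def layer (k : ℕ) : Submodule ℝ ((Fin n → ℝ) → (Fin n → ℝ)) :=
  Submodule.span ℝ {X | ∃ i, G.weight i = k ∧ X = G.leftInvField i}

/-- The homogeneous dimension `Q = ∑_k k · dim V_k`, the sum of all weights. -/
def homDim : ℕ := ∑ i, G.weight i

/-- The indices `j` of the horizontal fields `X_j`, i.e. those spanning the first layer. -/
abbrev HorizontalIndex : Type := {i : Fin n // G.weight i = 1}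

/-- The classical horizontal gradient `∇₀ f = (X_j f)_j`, in the orthonormal frame `(X_j)`. -/
def horizontalGradient (f : (Fin n → ℝ) → ℝ) (x : Fin n → ℝ) :
    EuclideanSpace ℝ G.HorizontalIndex :=
  WithLp.toLp 2 fun j => fderiv ℝ f x (G.leftInvField j.1 x)

/-- `g` is a weak horizontal gradient of `u` on the whole group. The fields `X_j` are
divergence-free, so that the formal adjoint of `X_j` is `-X_j`. -/
def IsWeakGradient (u : (Fin n → ℝ) → ℝ)
    (g : (Fin n → ℝ) → EuclideanSpace ℝ G.HorizontalIndex) : Prop :=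
  LocallyIntegrable u volume ∧ LocallyIntegrable g volume ∧
    ∀ (j : G.HorizontalIndex) (ψ : (Fin n → ℝ) → ℝ), ContDiff ℝ ∞ ψ → HasCompactSupport ψ →
      ∫ x, u x * G.horizontalGradient ψ x j = -∫ x, g x j * ψ x

/-- Symmetric homogeneous norms: continuous, smooth away from the origin. -/
structure HomogeneousNorm where
  toFun : (Fin n → ℝ) → ℝ
  continuous_toFun : Continuous toFun
  contDiffOn_toFun : ContDiffOn ℝ ∞ toFun {0}ᶜ
  pos_iff : ∀ x, 0 < toFun x ↔ x ≠ 0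
  map_dilation : ∀ R : ℝ, 0 < R → ∀ x, toFun (dilation G.weight R x) = R * toFun x
  map_inv : ∀ x, toFun (G.inv x) = toFun x

instance : CoeFun G.HomogeneousNorm (fun _ => (Fin n → ℝ) → ℝ) := ⟨HomogeneousNorm.toFun⟩

variable {G}

/-- `u` is Lipschitz on `U` with respect to the homogeneous norm `r`. -/
def HomogeneousNorm.LipOn (r : G.HomogeneousNorm) (u : (Fin n → ℝ) → ℝ)
    (U : Set (Fin n → ℝ)) : Prop :=
  ∃ C : ℝ, 0 < C ∧ ∀ x ∈ U, ∀ y ∈ U, u x - u y ≤ C * r (G.mul (G.inv x) y)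

/-- `u ∈ Lip_loc`. -/
def HomogeneousNorm.LipLoc (r : G.HomogeneousNorm) (u : (Fin n → ℝ) → ℝ) : Prop :=
  ∀ x, ∃ U ∈ 𝓝 x, r.LipOn u U

/-- `ψ ∈ Lip_c(Ω)`: Lipschitz, with compact support contained in `Ω`. -/
def HomogeneousNorm.LipCompact (r : G.HomogeneousNorm) (ψ : (Fin n → ℝ) → ℝ)
    (Ω : Set (Fin n → ℝ)) : Prop :=
  r.LipOn ψ Set.univ ∧ HasCompactSupport ψ ∧ tsupport ψ ⊆ Ω

/-- The locally Lipschitz function `u` is a weak solution of `Δ^φ u ≥ b(x) l(|∇₀u|)` on `Ω`.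
Where `∇₀u = 0`, the vector field `φ(|∇₀u|) / |∇₀u| ∇₀u` is zero. -/
def HomogeneousNorm.IsWeakSolutionOn (r : G.HomogeneousNorm) (φ : ℝ → ℝ)
    (b : (Fin n → ℝ) → ℝ) (l : ℝ → ℝ) (u : (Fin n → ℝ) → ℝ) (Ω : Set (Fin n → ℝ)) : Prop :=
  r.LipLoc u ∧ ∃ g, G.IsWeakGradient u g ∧
    ∀ ψ : (Fin n → ℝ) → ℝ, r.LipCompact ψ Ω → (∀ x, 0 ≤ ψ x) →
      ∀ h, G.IsWeakGradient ψ h →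
        ∫ x in Ω, φ ‖g x‖ / ‖g x‖ * inner ℝ (g x) (h x) ≤ -∫ x in Ω, b x * l ‖g x‖ * ψ x

end HomogeneousGroup

/-- A (homogeneous) Carnot group on `ℝⁿ`: the Lie algebra of left-invariant fields, which is
graded by the layers `V_k`, is stratified, `[V_1, V_k] = V_{k+1}` for all `k ≥ 1`
(where `V_k = 0` beyond the largest weight). -/
structure CarnotGroup (n : ℕ) extends HomogeneousGroup n where
  stratified : ∀ k : ℕ, 1 ≤ k →
    Submodule.span ℝ {Z | ∃ X ∈ toHomogeneousGroup.layer 1, ∃ Y ∈ toHomogeneousGroup.layer k,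
      Z = VectorField.lieBracket ℝ X Y} = toHomogeneousGroup.layer (k + 1)

/-- Weak `p`-coercivity of `φ`. -/
structure WeaklyCoercive (φ : ℝ → ℝ) (p : ℝ) : Prop where
  continuousOn : ContinuousOn φ (Set.Ici 0)
  map_zero : φ 0 = 0
  pos : ∀ t : ℝ, 0 < t → 0 < φ t
  bound : ∃ C : ℝ, 0 < C ∧ ∀ t : ℝ, 0 < t → φ t ≤ C * t ^ (p - 1)

/-- The critical growth exponent `σ* = (p - χ - μ) / (p - χ - 1)`. -/
def criticalExponent (p χ μ : ℝ) : ℝ := (p - χ - μ) / (p - χ - 1)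

open scoped Classical in
/-- The constant `H`. -/
def constantH (Q : ℕ) (p χ μ σ : ℝ) : ℝ :=
  if σ < criticalExponent p χ μ ∨
      (σ = criticalExponent p χ μ ∧ criticalExponent p χ μ = 0) ∨
      (σ = criticalExponent p χ μ ∧ 0 < criticalExponent p χ μ ∧ (p - 1) * (σ - 1) ≤ 1 - Q)
  then 0
  else σ ^ (p - χ - 1) * ((p - 1) * (σ - 1) + Q - 1)

end

/-! Write `q = p - χ - 1`, `s = σ*`, `t = |∇₀u|`, `v = u - γ`, and suppose `K > H û^q`. The
inequality is tested with `ψ = v^k r^(-b) η^N` on `{v > 0}`, where `η` is a logarithmic cutoff of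
length `L`. Up to smoothing of `ψ`, flux plus reaction is bounded below by `φ(t) v^k r^(-b-1) η^N`
times the bracket `k r t / v - b - N/(L η) + K₂ r^(1-μ) t^(-q)`, with `K₂` slightly below `K`.

If `v ≤ α r^s` at infinity, the variable `τ = t r^(1-s)` bounds this bracket below by `(k/α) τ + K₂
τ^(-q) - b - N/(L η)`; the relation `1 - μ = q (s - 1)` is what makes `s` critical. Take `b = d + s
k`. The tangent to `τ ↦ K₂ τ^(-q)` at `τ = α s` shows that, as soon as `K₂ > (α s)^q d`, some `k`
makes the bracket at least `c₁ τ - N/(L η)` with `c₁ > 0`. Where this is negative, `η τ` is bounded,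
and `φ(t) ≤ C t^(p-1)` bounds the loss by a multiple of `L⁻¹ r^(-(d + 1 - (s-1)(p-1)))`, integrable
at infinity when `d > m₀ = (p-1)(s-1) + Q - 1`. As `L → ∞` the unused share of `K` forces `∇₀u = 0`
a.e. on `{u > γ}` (`integrand_ge`, `ae_gradient_eq_zero`).

Then `(u - γ)₊²` has zero weak horizontal gradient. Stratification passes this to every
left-invariant field, so the function is invariant under right translations and hence constant
(`eq_of_derivVanishes`), which contradicts non-constancy of `u`.

Taking `α` just above `û` and `d` just above `max m₀ 0` yields `H = s^q max(m₀, 0)` at critical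
growth. Below critical growth `α` can be arbitrarily small, and for `s = 0` the condition on `α` and
`d` is void.

No almost everywhere differentiability of Lipschitz functions is used: a weak gradient is handled as
the weak limit of difference quotients along right translations, which preserve Lebesgue measure. -/

noncomputable section

/-! ### Dilations -/

/-- The anisotropic dilation as a continuous linear map. -/
def dilationCLM {n : ℕ} (w : Fin n → ℕ) (R : ℝ) : (Fin n → ℝ) →L[ℝ] (Fin n → ℝ) :=
  ContinuousLinearMap.pi fun i => (R ^ w i) • ContinuousLinearMap.proj i

theorem dilationCLM_apply {n : ℕ} (w : Fin n → ℕ) (R : ℝ) (x : Fin n → ℝ) :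
    dilationCLM w R x = dilation w R x := by
  ext i; simp [dilationCLM, dilation]

theorem det_dilationCLM {n : ℕ} (w : Fin n → ℕ) (R : ℝ) :
    (dilationCLM w R).det = R ^ ∑ i, w i := by
  have : ((dilationCLM w R : (Fin n → ℝ) →L[ℝ] (Fin n → ℝ)) : (Fin n → ℝ) →ₗ[ℝ] (Fin n → ℝ)) =
      Matrix.toLin' (Matrix.diagonal fun i => R ^ w i) := by
    apply LinearMap.ext
    intro x
    ext i
    simp [dilationCLM, Matrix.mulVec_diagonal]
  rw [ContinuousLinearMap.det, this, LinearMap.det_toLin', Matrix.det_diagonal,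
    Finset.prod_pow_eq_pow_sum]

theorem dilation_dilation {n : ℕ} (w : Fin n → ℕ) (R S : ℝ) (x : Fin n → ℝ) :
    dilation w R (dilation w S x) = dilation w (R * S) x := by
  ext i; simp [dilation, mul_pow, mul_assoc]

theorem dilation_one {n : ℕ} (w : Fin n → ℕ) (x : Fin n → ℝ) : dilation w 1 x = x := by
  ext i; simp [dilation]

theorem dilation_apply_zero {n : ℕ} (w : Fin n → ℕ) (R : ℝ) :
    dilation w R (0 : Fin n → ℝ) = 0 := by
  ext i; simp [dilation]

theorem continuous_dilation_left {n : ℕ} (w : Fin n → ℕ) (x : Fin n → ℝ) :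
    Continuous fun R => dilation w R x := by
  unfold dilation; fun_prop

/-! ### Group translations and the invariance of Lebesgue measure -/

namespace HomogeneousGroup

variable {n : ℕ} (G : HomogeneousGroup n)

theorem inv_zero : G.inv 0 = 0 := by
  have := G.inv_mul 0
  rwa [G.mul_zero] at this

theorem inv_mul_cancel_left (x y : Fin n → ℝ) : G.mul (G.inv x) (G.mul x y) = y := by
  rw [← G.mul_assoc, G.inv_mul, G.zero_mul]

theorem mul_inv (x : Fin n → ℝ) : G.mul x (G.inv x) = 0 := by
  have h := G.inv_mul_cancel_left (G.inv x) (G.mul x (G.inv x))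
  rw [G.inv_mul_cancel_left x (G.inv x), G.inv_mul] at h
  exact h.symm

theorem mul_inv_cancel_left (x y : Fin n → ℝ) : G.mul x (G.mul (G.inv x) y) = y := by
  rw [← G.mul_assoc, G.mul_inv, G.zero_mul]

theorem mul_inv_cancel_right (x a : Fin n → ℝ) : G.mul (G.mul x a) (G.inv a) = x := by
  rw [G.mul_assoc, G.mul_inv, G.mul_zero]

theorem inv_mul_cancel_right (x a : Fin n → ℝ) : G.mul (G.mul x (G.inv a)) a = x := by
  rw [G.mul_assoc, G.inv_mul, G.mul_zero]

theorem continuous_mul : Continuous fun z : (Fin n → ℝ) × (Fin n → ℝ) => G.mul z.1 z.2 :=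
  G.contDiff_mul.continuous

theorem contDiff_mul_left (x : Fin n → ℝ) : ContDiff ℝ ∞ (G.mul x) :=
  G.contDiff_mul.comp (contDiff_const.prodMk contDiff_id)

theorem contDiff_mul_right (a : Fin n → ℝ) : ContDiff ℝ ∞ fun x => G.mul x a :=
  G.contDiff_mul.comp (contDiff_id.prodMk contDiff_const)

theorem dilation_zero_left (x : Fin n → ℝ) : dilation G.weight 0 x = 0 := by
  ext i
  have := G.weight_pos i
  simp [dilation, zero_pow (by omega : G.weight i ≠ 0)]

theorem tendsto_dilation_zero (x : Fin n → ℝ) :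
    Tendsto (fun R => dilation G.weight R x) (𝓝[>] 0) (𝓝 0) := by
  have := (continuous_dilation_left G.weight x).tendsto 0
  rw [G.dilation_zero_left] at this
  exact this.mono_left nhdsWithin_le_nhds

/-- Conjugation by dilations shows that the Jacobian takes the same value at `(x, a)` and at `(δ_R
x, δ_R a)`. As `R → 0` continuity gives its value at the origin, where the translation is the
identity. Neither nilpotency nor polynomial form of the law is needed. -/
theorem det_fderiv_mul_right (x a : Fin n → ℝ) :
    (fderiv ℝ (fun y => G.mul y a) x).det = 1 := by
  let J : (Fin n → ℝ) × (Fin n → ℝ) → ℝ := fun z => (fderiv ℝ (fun y => G.mul y z.2) z.1).det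
  have hJ : Continuous J := by
    have h1 : ContDiff ℝ 0 (fun z : (Fin n → ℝ) × (Fin n → ℝ) =>
        fderiv ℝ (fun y => G.mul y z.2) z.1) := by
      refine ContDiff.fderiv (m := 1) (n := 0) (f := fun (z : (Fin n → ℝ) × (Fin n → ℝ)) y => G.mul y z.2)
        (g := Prod.fst) ?_ contDiff_fst (zero_add _).le
      have : ContDiff ℝ 1 (fun p : (Fin n → ℝ) × (Fin n → ℝ) => G.mul p.1 p.2) :=
        G.contDiff_mul.of_le (by exact_mod_cast le_top)
      exact this.comp (contDiff_snd.prodMk (contDiff_snd.comp contDiff_fst))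
    exact ContinuousLinearMap.continuous_det.comp h1.continuous
  have hdil : ∀ R : ℝ, 0 < R →
      J (dilation G.weight R x, dilation G.weight R a) = J (x, a) := by
    intro R hR
    have hd : ∀ b y, DifferentiableAt ℝ (fun y => G.mul y b) y := fun b y =>
      ((G.contDiff_mul_right b).differentiable (by simp)).differentiableAt
    have hc : (fun y => G.mul y (dilation G.weight R a)) ∘ dilationCLM G.weight R =
        dilationCLM G.weight R ∘ fun y => G.mul y a := by
      funext y
      simp [dilationCLM_apply, G.dilation_mul R hR]
    have h2 := congrArg (fun f => fderiv ℝ f x) hc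
    beta_reduce at h2
    rw [fderiv_comp _ (hd _ _) (dilationCLM G.weight R).differentiableAt,
      fderiv_comp _ (dilationCLM G.weight R).differentiableAt (hd _ _),
      ContinuousLinearMap.fderiv, ContinuousLinearMap.fderiv] at h2
    have h3 := congrArg ContinuousLinearMap.det h2
    have hmul : ∀ A B : (Fin n → ℝ) →L[ℝ] (Fin n → ℝ), (A.comp B).det = A.det * B.det :=
      fun A B => by
        simp only [ContinuousLinearMap.det, ContinuousLinearMap.toLinearMap_comp]
        exact LinearMap.det_comp _ _
    rw [hmul, hmul, mul_comm] at h3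
    have hne : (dilationCLM G.weight R).det ≠ 0 := by
      rw [det_dilationCLM]; positivity
    have := mul_left_cancel₀ hne h3
    rw [dilationCLM_apply] at this
    exact this
  have hlim : Tendsto (fun R => J (dilation G.weight R x, dilation G.weight R a)) (𝓝[>] 0)
      (𝓝 (J (0, 0))) :=
    (hJ.tendsto _).comp ((G.tendsto_dilation_zero x).prodMk_nhds (G.tendsto_dilation_zero a))
  have hconst : Tendsto (fun R => J (dilation G.weight R x, dilation G.weight R a)) (𝓝[>] 0)
      (𝓝 (J (x, a))) :=
    tendsto_const_nhds.congr' (by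
      filter_upwards [self_mem_nhdsWithin] with R hR using (hdil R hR).symm)
  have h0 : J (0, 0) = 1 := by
    have : (fun y : Fin n → ℝ => G.mul y 0) = fun y => y := funext G.mul_zero
    simp [J, this, ContinuousLinearMap.det]
  rw [← h0]
  exact tendsto_nhds_unique hconst hlim

theorem measurePreserving_mul_right (a : Fin n → ℝ) :
    MeasurePreserving (fun x => G.mul x a) volume volume := by
  refine ⟨(G.contDiff_mul_right a).continuous.measurable, ?_⟩
  have hinj : Set.InjOn (fun x => G.mul x a) Set.univ := fun x _ y _ h => by
    have := congrArg (fun z => G.mul z (G.inv a)) h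
    simpa [G.mul_inv_cancel_right] using this
  have himg : (fun x => G.mul x a) '' Set.univ = Set.univ :=
    Set.eq_univ_of_forall fun y => ⟨G.mul y (G.inv a), trivial, G.inv_mul_cancel_right y a⟩
  have := map_withDensity_abs_det_fderiv_eq_addHaar (μ := (volume : Measure (Fin n → ℝ)))
    (s := Set.univ) (f := fun x => G.mul x a) (f' := fun x => fderiv ℝ (fun y => G.mul y a) x)
    MeasurableSet.univ
    (fun x _ => (((G.contDiff_mul_right a).differentiable
      (by simp)).differentiableAt).hasFDerivAt.hasFDerivWithinAt) hinj
  simpa only [himg, G.det_fderiv_mul_right, abs_one, ENNReal.ofReal_one, Measure.restrict_univ,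
    show (fun _ : Fin n → ℝ => (1 : ENNReal)) = 1 from rfl, withDensity_one] using this

/-- Right translation as a homeomorphism. -/
def mulRightHomeomorph (a : Fin n → ℝ) : (Fin n → ℝ) ≃ₜ (Fin n → ℝ) where
  toFun x := G.mul x a
  invFun x := G.mul x (G.inv a)
  left_inv x := G.mul_inv_cancel_right x a
  right_inv x := G.inv_mul_cancel_right x a
  continuous_toFun := (G.contDiff_mul_right a).continuous
  continuous_invFun := (G.contDiff_mul_right (G.inv a)).continuous

theorem integral_comp_mul_right (a : Fin n → ℝ) (f : (Fin n → ℝ) → ℝ) :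
    ∫ x, f (G.mul x a) = ∫ x, f x :=
  (G.measurePreserving_mul_right a).integral_comp
    (G.mulRightHomeomorph a).measurableEmbedding f

theorem contDiff_leftInvField (i : Fin n) : ContDiff ℝ ∞ (G.leftInvField i) := by
  have h1 : ContDiff ℝ ∞ (fun x : Fin n → ℝ => fderiv ℝ (fun y => G.mul x y) 0) := by
    refine ContDiff.fderiv (m := ∞) (n := ∞) (f := fun (x : Fin n → ℝ) y => G.mul x y)
      (g := fun _ => 0) ?_ contDiff_const (by simp)
    exact G.contDiff_mul
  exact h1.clm_apply contDiff_const

theorem dilation_single {i : Fin n} (hi : G.weight i = 1) (R t : ℝ) :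
    dilation G.weight R (Pi.single i t) = Pi.single i (R * t) := by
  ext k
  by_cases h : k = i
  · subst h; simp [dilation, hi]
  · simp [dilation, h]

/-! ### Comparison of homogeneous and Euclidean norms -/

namespace HomogeneousNorm

variable {G} (r : G.HomogeneousNorm)

theorem map_zero : r 0 = 0 := by
  have h := r.map_dilation 2 (by norm_num) 0
  rw [dilation_apply_zero] at h
  linarith

theorem nonneg (x : Fin n → ℝ) : 0 ≤ r x := by
  by_cases h : x = 0
  · rw [h, r.map_zero]
  · exact ((r.pos_iff x).2 h).le

theorem map_single {i : Fin n} (hi : G.weight i = 1) {t : ℝ} (ht : 0 < t) :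
    r (Pi.single i t) = t * r (Pi.single i 1) := by
  rw [← r.map_dilation t ht, G.dilation_single hi, mul_one]

/-- If `‖z‖ ≥ 1`, the dilation path from `0` to `z` crosses the unit sphere at some `t ≤ 1`, and
there `c ≤ r (δ_t z) = t r z ≤ r z`. -/
theorem exists_norm_lt_one : ∃ c : ℝ, 0 < c ∧ ∀ z, r z < c → ‖z‖ < 1 := by
  have hne : ∀ z ∈ Metric.sphere (0 : Fin n → ℝ) 1, 0 < r z := fun z hz =>
    (r.pos_iff z).2 (by rintro rfl; simp at hz)
  obtain ⟨c, hc, hcle⟩ : ∃ c : ℝ, 0 < c ∧ ∀ z ∈ Metric.sphere (0 : Fin n → ℝ) 1, c ≤ r z :=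
    (isCompact_sphere _ _).exists_forall_le' r.continuous_toFun.continuousOn hne
  refine ⟨c, hc, fun z hz => ?_⟩
  by_contra! hcon
  have hcont : ContinuousOn (fun t => ‖dilation G.weight t z‖) (Set.Icc 0 1) :=
    (continuous_dilation_left G.weight z).norm.continuousOn
  have := intermediate_value_Icc (zero_le_one' ℝ) hcont
  simp only [G.dilation_zero_left, norm_zero, dilation_one] at this
  obtain ⟨t, ⟨ht0, ht1⟩, ht⟩ := this ⟨zero_le_one, hcon⟩
  have htpos : 0 < t := by
    rcases ht0.lt_or_eq with h | h
    · exact h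
    · subst h; simp [G.dilation_zero_left] at ht
  have h1 := hcle (dilation G.weight t z) (by simpa using ht)
  rw [r.map_dilation t htpos] at h1
  nlinarith [r.nonneg z]

theorem exists_abs_apply_le :
    ∃ C : ℝ, 0 < C ∧ ∀ z i, |z i| ≤ (C * r z) ^ G.weight i := by
  obtain ⟨c, hc, h⟩ := r.exists_norm_lt_one
  refine ⟨2 / c, by positivity, fun z i => ?_⟩
  rcases eq_or_ne z 0 with rfl | hz
  · simp only [Pi.zero_apply, abs_zero]
    have := r.nonneg (0 : Fin n → ℝ)
    positivity
  have hrz := (r.pos_iff z).2 hz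
  -- This dilation brings `z` to homogeneous radius `c / 2`, where all coordinates are below `1`.
  have hR : 0 < c / (2 * r z) := by positivity
  have h1 := h (dilation G.weight (c / (2 * r z)) z) (by
    rw [r.map_dilation _ hR]; field_simp; linarith)
  have h2 := (norm_le_pi_norm (dilation G.weight (c / (2 * r z)) z) i).trans h1.le
  simp only [dilation, Real.norm_eq_abs, abs_mul, abs_pow, abs_of_pos hR] at h2
  have h3 : (2 / c * r z) ^ G.weight i * (c / (2 * r z)) ^ G.weight i = 1 := by
    rw [← mul_pow]; field_simp; simp
  have h4 : 0 ≤ (2 / c * r z) ^ G.weight i := by positivity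
  calc |z i| = (2 / c * r z) ^ G.weight i * ((c / (2 * r z)) ^ G.weight i * |z i|) := by
        rw [← _root_.mul_assoc, h3, one_mul]
    _ ≤ _ := by nlinarith

theorem isCompact_le (R : ℝ) : IsCompact {x | r x ≤ R} := by
  refine Metric.isCompact_of_isClosed_isBounded
    (isClosed_le r.continuous_toFun continuous_const) ?_
  obtain ⟨C, hC, h⟩ := r.exists_abs_apply_le
  refine (Metric.isBounded_closedBall (x := (0 : Fin n → ℝ))
    (r := ∑ i, (C * |R|) ^ G.weight i)).subset fun x hx => ?_
  rw [mem_closedBall_zero_iff]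
  refine (pi_norm_le_iff_of_nonneg (by positivity)).2 fun i => ?_
  have h0 := r.nonneg x
  have h1 : (C * r x) ^ G.weight i ≤ (C * |R|) ^ G.weight i := by
    have : r x ≤ |R| := le_trans hx (le_abs_self R)
    gcongr
  exact (h x i).trans (h1.trans (Finset.single_le_sum
    (f := fun i => (C * |R|) ^ G.weight i) (fun i _ => by positivity) (Finset.mem_univ i)))

theorem exists_lt_subset {W : Set (Fin n → ℝ)} (hW : W ∈ 𝓝 0) :
    ∃ ε : ℝ, 0 < ε ∧ ∀ z, r z < ε → z ∈ W := by
  obtain ⟨V, hVW, hV, h0⟩ := mem_nhds_iff.1 hW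
  have hK : IsCompact ({x | r x ≤ 1} \ V) := (r.isCompact_le 1).diff hV
  obtain ⟨c, hc, hcle⟩ := hK.exists_forall_le' (a := 0) r.continuous_toFun.continuousOn
    (fun z hz => (r.pos_iff z).2 (by rintro rfl; exact hz.2 h0))
  refine ⟨min c 1, by positivity, fun z hz => hVW ?_⟩
  by_contra hzV
  have := hcle z ⟨(hz.trans_le (min_le_right _ _)).le, hzV⟩
  exact absurd (hz.trans_le (min_le_left _ _)) this.not_gt

/-- Weights are at least `1`, so near the origin every power `(C r)^w` is at most `C r`. -/
theorem eventually_norm_le : ∃ C : ℝ, 0 < C ∧ ∀ᶠ z in 𝓝 (0 : Fin n → ℝ), ‖z‖ ≤ C * r z := by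
  obtain ⟨C, hC, h⟩ := r.exists_abs_apply_le
  refine ⟨C, hC, ?_⟩
  have hlim : Tendsto (fun z => C * r z) (𝓝 0) (𝓝 0) := by
    have := (r.continuous_toFun.const_mul C).tendsto 0
    simpa [r.map_zero] using this
  filter_upwards [hlim.eventually (gt_mem_nhds one_pos)] with z hz
  have h0 : 0 ≤ C * r z := mul_nonneg hC.le (r.nonneg z)
  refine (pi_norm_le_iff_of_nonneg h0).2 fun i => (h z i).trans ?_
  calc (C * r z) ^ G.weight i ≤ (C * r z) ^ 1 :=
        pow_le_pow_of_le_one h0 hz.le (G.weight_pos i)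
    _ = _ := pow_one _

end HomogeneousNorm

end HomogeneousGroup

/-! ### Locally Lipschitz functions -/

namespace HomogeneousGroup

variable {n : ℕ} (G : HomogeneousGroup n)

theorem inv_inv_mul (x y : Fin n → ℝ) : G.inv (G.mul (G.inv x) y) = G.mul (G.inv y) x := by
  have h : G.mul (G.mul (G.inv y) x) (G.mul (G.inv x) y) = 0 := by
    rw [G.mul_assoc, G.mul_inv_cancel_left, G.inv_mul]
  have h2 := G.mul_inv_cancel_right (G.mul (G.inv y) x) (G.mul (G.inv x) y)
  rwa [h, G.zero_mul] at h2

theorem continuous_inv : Continuous G.inv := G.contDiff_inv.continuous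

theorem continuous_inv_mul :
    Continuous fun z : (Fin n → ℝ) × (Fin n → ℝ) => G.mul (G.inv z.1) z.2 :=
  G.continuous_mul.comp ((G.continuous_inv.comp continuous_fst).prodMk continuous_snd)

namespace HomogeneousNorm

variable {G} {r : G.HomogeneousNorm} {f g : (Fin n → ℝ) → ℝ}

/-- The increment form, uniform in the base point, is the one that composes well with products and
chain rules. Symmetry of `r` turns the one-sided definition into an absolute value. -/
theorem lipLoc_iff : r.LipLoc f ↔
    ∀ x, ∃ C : ℝ, 0 < C ∧ ∀ᶠ p in 𝓝 x ×ˢ 𝓝 0, |f (G.mul p.1 p.2) - f p.1| ≤ C * r p.2 := by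
  constructor
  · intro h x
    obtain ⟨U, hU, C, hC, hf⟩ := h x
    refine ⟨C, hC, ?_⟩
    have h1 : ∀ᶠ p in 𝓝 x ×ˢ 𝓝 (0 : Fin n → ℝ), p.1 ∈ U :=
      tendsto_fst.eventually hU
    have h2 : ∀ᶠ p in 𝓝 x ×ˢ 𝓝 (0 : Fin n → ℝ), G.mul p.1 p.2 ∈ U := by
      have := G.continuous_mul.tendsto (x, 0)
      rw [G.mul_zero, nhds_prod_eq] at this
      exact this.eventually hU
    filter_upwards [h1, h2] with p hp1 hp2
    have ha := hf _ hp1 _ hp2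
    have hb := hf _ hp2 _ hp1
    rw [← G.inv_inv_mul, G.inv_mul_cancel_left, r.map_inv] at hb
    rw [G.inv_mul_cancel_left] at ha
    exact abs_le.2 ⟨by linarith, hb⟩
  · intro h x
    obtain ⟨C, hC, hf⟩ := h x
    have hlim : Tendsto (fun z : (Fin n → ℝ) × (Fin n → ℝ) => (z.1, G.mul (G.inv z.1) z.2))
        (𝓝 x ×ˢ 𝓝 x) (𝓝 x ×ˢ 𝓝 0) := by
      have := G.continuous_inv_mul.tendsto (x, x)
      rw [G.inv_mul, nhds_prod_eq] at this
      exact tendsto_fst.prodMk this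
    obtain ⟨U, hU, hUf⟩ := mem_prod_same_iff.1 (hlim.eventually hf)
    refine ⟨U, hU, C, hC, fun a ha b hb => ?_⟩
    have := hUf (Set.mk_mem_prod ha hb)
    simp only [Set.mem_ofPred_eq, G.mul_inv_cancel_left] at this
    have := (abs_le.1 this).1
    linarith

theorem LipLoc.continuous (hf : r.LipLoc f) : Continuous f := by
  refine continuous_iff_continuousAt.2 fun x => ?_
  obtain ⟨C, hC, h⟩ := lipLoc_iff.1 hf x
  have h0 : ∀ᶠ y in 𝓝 x, |f y - f x| ≤ C * r (G.mul (G.inv x) y) := by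
    have hlim : Tendsto (fun y => (x, G.mul (G.inv x) y)) (𝓝 x) (𝓝 x ×ˢ 𝓝 0) := by
      have := (G.contDiff_mul_left (G.inv x)).continuous.tendsto x
      rw [G.inv_mul] at this
      exact tendsto_const_nhds.prodMk this
    filter_upwards [hlim.eventually h] with y hy
    simpa [G.mul_inv_cancel_left] using hy
  have h1 : Tendsto (fun y => C * r (G.mul (G.inv x) y)) (𝓝 x) (𝓝 0) := by
    have := ((r.continuous_toFun.comp
      (G.contDiff_mul_left (G.inv x)).continuous).const_mul C).tendsto x
    simpa [G.inv_mul, r.map_zero] using this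
  exact tendsto_iff_norm_sub_tendsto_zero.2
    (squeeze_zero' (Eventually.of_forall fun _ => norm_nonneg _) h0 h1)

theorem lipLoc_of_contDiff (hf : ContDiff ℝ 1 f) : r.LipLoc f := by
  refine lipLoc_iff.2 fun x => ?_
  have hF : ContDiff ℝ 1 (fun p : (Fin n → ℝ) × (Fin n → ℝ) => f (G.mul p.1 p.2)) :=
    hf.comp (G.contDiff_mul.of_le (by exact_mod_cast le_top))
  obtain ⟨K, t, ht, hL⟩ := (hF.contDiffAt (x := (x, 0))).exists_lipschitzOnWith
  obtain ⟨C, hC, hr⟩ := r.eventually_norm_le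
  refine ⟨(K + 1) * C, by positivity, ?_⟩
  rw [nhds_prod_eq] at ht
  have h0 : Tendsto (fun p : (Fin n → ℝ) × (Fin n → ℝ) => (p.1, (0 : Fin n → ℝ)))
      (𝓝 x ×ˢ 𝓝 0) (𝓝 x ×ˢ 𝓝 0) :=
    tendsto_fst.prodMk tendsto_const_nhds
  filter_upwards [ht, h0.eventually ht, tendsto_snd.eventually hr] with p hp hp0 hpr
  have := hL.dist_le_mul _ hp _ hp0
  simp only [G.mul_zero, Real.dist_eq] at this
  have hd : dist p (p.1, 0) = ‖p.2‖ := by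
    rw [Prod.dist_eq]; simp
  rw [hd] at this
  calc _ ≤ K * ‖p.2‖ := this
    _ ≤ (K + 1) * (C * r p.2) := by
      gcongr
      linarith
    _ = _ := by ring

theorem LipLoc.comp (hf : r.LipLoc f) {Λ : ℝ → ℝ} (hΛ : ContDiff ℝ 1 Λ) :
    r.LipLoc fun x => Λ (f x) := by
  refine lipLoc_iff.2 fun x => ?_
  obtain ⟨C, hC, h⟩ := lipLoc_iff.1 hf x
  obtain ⟨K, t, ht, hL⟩ := (hΛ.contDiffAt (x := f x)).exists_lipschitzOnWith
  have h1 : ∀ᶠ p in 𝓝 x ×ˢ 𝓝 (0 : Fin n → ℝ), f p.1 ∈ t :=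
    tendsto_fst.eventually ((hf.continuous.tendsto x).eventually ht)
  have h2 : ∀ᶠ p in 𝓝 x ×ˢ 𝓝 (0 : Fin n → ℝ), f (G.mul p.1 p.2) ∈ t := by
    have := (hf.continuous.comp G.continuous_mul).tendsto (x, 0)
    simp only [Function.comp_apply, G.mul_zero, nhds_prod_eq] at this
    exact this.eventually ht
  refine ⟨(K + 1) * C, by positivity, ?_⟩
  filter_upwards [h, h1, h2] with p hp hp1 hp2
  have := hL.dist_le_mul _ hp2 _ hp1
  rw [Real.dist_eq, Real.dist_eq] at this
  calc _ ≤ K * |f (G.mul p.1 p.2) - f p.1| := this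
    _ ≤ (K + 1) * (C * r p.2) := by
      gcongr
      linarith
    _ = _ := by ring

theorem LipLoc.mul (hf : r.LipLoc f) (hg : r.LipLoc g) : r.LipLoc fun x => f x * g x := by
  refine lipLoc_iff.2 fun x => ?_
  obtain ⟨C, hC, h⟩ := lipLoc_iff.1 hf x
  obtain ⟨D, hD, h'⟩ := lipLoc_iff.1 hg x
  have h1 : ∀ᶠ p in 𝓝 x ×ˢ 𝓝 (0 : Fin n → ℝ), |g p.1| < |g x| + 1 :=
    tendsto_fst.eventually ((hg.continuous.abs.tendsto x).eventually (gt_mem_nhds (by linarith)))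
  have h2 : ∀ᶠ p in 𝓝 x ×ˢ 𝓝 (0 : Fin n → ℝ), |f (G.mul p.1 p.2)| < |f x| + 1 := by
    have := (hf.continuous.abs.comp G.continuous_mul).tendsto (x, 0)
    simp only [Function.comp_apply, G.mul_zero, nhds_prod_eq] at this
    exact this.eventually (gt_mem_nhds (by linarith))
  refine ⟨(|f x| + 1) * D + (|g x| + 1) * C, by positivity, ?_⟩
  filter_upwards [h, h', h1, h2] with p hp hp' hp1 hp2
  have e : f (G.mul p.1 p.2) * g (G.mul p.1 p.2) - f p.1 * g p.1 =
      f (G.mul p.1 p.2) * (g (G.mul p.1 p.2) - g p.1) + g p.1 * (f (G.mul p.1 p.2) - f p.1) := by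
    ring
  rw [e]
  calc _ ≤ |f (G.mul p.1 p.2)| * |g (G.mul p.1 p.2) - g p.1| +
        |g p.1| * |f (G.mul p.1 p.2) - f p.1| := by
          rw [← abs_mul, ← abs_mul]; exact abs_add_le _ _
    _ ≤ (|f x| + 1) * (D * r p.2) + (|g x| + 1) * (C * r p.2) := by gcongr
    _ = _ := by ring

theorem LipLoc.exists_bound (hf : r.LipLoc f) {K : Set (Fin n → ℝ)} (hK : IsCompact K) :
    ∃ C : ℝ, 0 < C ∧ ∀ᶠ z in 𝓝 0, ∀ x ∈ K, |f (G.mul x z) - f x| ≤ C * r z := by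
  refine hK.induction_on (p := fun K => ∃ C : ℝ, 0 < C ∧ ∀ᶠ z in 𝓝 0, ∀ x ∈ K,
    |f (G.mul x z) - f x| ≤ C * r z) ⟨1, one_pos, by simp⟩ ?_ ?_ ?_
  · rintro s t hst ⟨C, hC, h⟩
    exact ⟨C, hC, h.mono fun z hz x hx => hz x (hst hx)⟩
  · rintro s t ⟨C, hC, h⟩ ⟨D, hD, h'⟩
    refine ⟨C + D, by positivity, ?_⟩
    filter_upwards [h, h'] with z hz hz' x hx
    have hr := r.nonneg z
    rcases hx with hx | hx
    · exact (hz x hx).trans (by nlinarith)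
    · exact (hz' x hx).trans (by nlinarith)
  · intro x _
    obtain ⟨C, hC, h⟩ := lipLoc_iff.1 hf x
    obtain ⟨s, hs, t, ht, hst⟩ := mem_prod_iff.1 h
    refine ⟨s, mem_nhdsWithin_of_mem_nhds hs, C, hC, ?_⟩
    filter_upwards [ht] with z hz y hy
    exact hst (Set.mk_mem_prod hy hz)

/-- Short increments are controlled uniformly on the compact support; for increments of size at
least `ε` the sup bound `2 M` suffices, at the price of the constant `2 M / ε`. -/
theorem LipLoc.lipOn_univ (hf : r.LipLoc f) (hc : HasCompactSupport f) :
    r.LipOn f Set.univ := by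
  obtain ⟨C, hC, h⟩ := hf.exists_bound hc
  obtain ⟨ε, hε, hεW⟩ := r.exists_lt_subset h
  obtain ⟨M, hM⟩ := hf.continuous.bounded_above_of_compact_support hc
  have hM0 : 0 ≤ M := (norm_nonneg _).trans (hM 0)
  have key : ∀ x ∈ tsupport f, ∀ y, |f y - f x| ≤ (C + 2 * M / ε) * r (G.mul (G.inv x) y) := by
    intro x hx y
    have hr := r.nonneg (G.mul (G.inv x) y)
    have hMε : 0 ≤ 2 * M / ε := by positivity
    rcases lt_or_ge (r (G.mul (G.inv x) y)) ε with hlt | hge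
    · have := hεW _ hlt x hx
      rw [G.mul_inv_cancel_left] at this
      nlinarith
    · have h1 : |f y - f x| ≤ 2 * M := by
        have := abs_sub (f y) (f x)
        have h2 := hM x
        have h3 := hM y
        rw [Real.norm_eq_abs] at h2 h3
        linarith
      have h2 : 2 * M ≤ 2 * M / ε * r (G.mul (G.inv x) y) := by
        rw [div_mul_eq_mul_div, le_div_iff₀ hε]
        gcongr
      nlinarith
  refine ⟨C + 2 * M / ε, by positivity, fun x _ y _ => ?_⟩
  by_cases hx : x ∈ tsupport f
  · have := (abs_le.1 (key x hx y)).1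
    linarith
  · by_cases hy : y ∈ tsupport f
    · have := (abs_le.1 (key y hy x)).2
      rwa [← G.inv_inv_mul, r.map_inv] at this
    · rw [image_eq_zero_of_notMem_tsupport hx, image_eq_zero_of_notMem_tsupport hy, sub_zero]
      have := r.nonneg (G.mul (G.inv x) y)
      positivity

theorem tendsto_single (j : Fin n) :
    Tendsto (fun t : ℝ => (Pi.single j t : Fin n → ℝ)) (𝓝[>] 0) (𝓝 0) := by
  have : Continuous fun t : ℝ => (Pi.single j t : Fin n → ℝ) := by
    exact (ContinuousLinearMap.single ℝ (fun _ : Fin n => ℝ) j).continuous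
  have := this.tendsto 0
  rw [Pi.single_zero] at this
  exact this.mono_left nhdsWithin_le_nhds

/-- Horizontal directions have weight one, so `r (t e_j)` is linear in `t` and the difference
quotients stay bounded. This is the domination used in all the limits `t → 0⁺`. -/
theorem LipLoc.exists_bound_single (hf : r.LipLoc f) (j : G.HorizontalIndex)
    {K : Set (Fin n → ℝ)} (hK : IsCompact K) :
    ∃ C : ℝ, 0 < C ∧ ∀ᶠ t in 𝓝[>] (0 : ℝ), ∀ x ∈ K,
      |(f (G.mul x (Pi.single j.1 t)) - f x) / t| ≤ C ∧
      |(f (G.mul x (G.inv (Pi.single j.1 t))) - f x) / t| ≤ C := by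
  obtain ⟨C, hC, h⟩ := hf.exists_bound hK
  have hr1 : 0 < r (Pi.single j.1 1) := (r.pos_iff _).2 (by simp)
  refine ⟨C * r (Pi.single j.1 1), by positivity, ?_⟩
  have h2 : Tendsto (fun t : ℝ => G.inv (Pi.single j.1 t)) (𝓝[>] 0) (𝓝 0) := by
    have := G.continuous_inv.tendsto 0
    rw [G.inv_zero] at this
    exact this.comp (tendsto_single j.1)
  filter_upwards [(tendsto_single j.1).eventually h, h2.eventually h, self_mem_nhdsWithin]
    with t ht ht' htpos x hx
  have hp : (0 : ℝ) < t := htpos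
  have h3 := ht x hx
  have h4 := ht' x hx
  rw [r.map_inv] at h4
  rw [r.map_single j.2 hp] at h3 h4
  constructor
  · rw [abs_div, abs_of_pos hp, div_le_iff₀ hp]
    exact h3.trans (by linarith)
  · rw [abs_div, abs_of_pos hp, div_le_iff₀ hp]
    exact h4.trans (by linarith)

end HomogeneousNorm

end HomogeneousGroup

/-! ### Two facts from integration theory -/

theorem MeasureTheory.tendsto_integral_of_bounded_of_isCompact {E : Type*} [TopologicalSpace E]
    [MeasurableSpace E] [BorelSpace E] [T2Space E] {ν : Measure E} [IsFiniteMeasureOnCompacts ν]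
    [SecondCountableTopology E]
    {l : Filter ℝ} [l.IsCountablyGenerated] {F : ℝ → E → ℝ} {f : E → ℝ} {K : Set E}
    (hK : IsCompact K) {M : ℝ} (hF : ∀ᶠ t in l, AEStronglyMeasurable (F t) ν)
    (hsupp : ∀ᶠ t in l, ∀ x, x ∉ K → F t x = 0) (hb : ∀ᶠ t in l, ∀ x ∈ K, |F t x| ≤ M)
    (hlim : ∀ x, Tendsto (fun t => F t x) l (𝓝 (f x))) :
    Tendsto (fun t => ∫ x, F t x ∂ν) l (𝓝 (∫ x, f x ∂ν)) := by
  refine tendsto_integral_filter_of_dominated_convergence (K.indicator fun _ => M) hF ?_ ?_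
    (Eventually.of_forall hlim)
  · filter_upwards [hsupp, hb] with t ht ht'
    refine Eventually.of_forall fun x => ?_
    by_cases hx : x ∈ K
    · rw [Set.indicator_of_mem hx]; exact ht' x hx
    · rw [Set.indicator_of_notMem hx, ht x hx, norm_zero]
  · exact (integrable_indicator_iff hK.measurableSet).2
      (integrableOn_const hK.measure_lt_top.ne)

/-- A function with nonnegative integral against every nonnegative continuous function vanishing
off a compact set is almost everywhere nonnegative in the interior of that set. -/
theorem MeasureTheory.ae_nonneg_of_integral_mul_nonneg {E : Type*} [NormedAddCommGroup E]
    [NormedSpace ℝ E] [FiniteDimensional ℝ E]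
    [MeasurableSpace E] [BorelSpace E] {ν : Measure E} [IsFiniteMeasureOnCompacts ν]
    {h : E → ℝ} {K : Set E} (hK : IsCompact K)
    (hh : IntegrableOn h K ν)
    (hpos : ∀ θ : E → ℝ, Continuous θ → (∀ x, 0 ≤ θ x) → (∀ x, x ∉ K → θ x = 0) →
      0 ≤ ∫ x, h x * θ x ∂ν) :
    ∀ᵐ x ∂ν, x ∈ interior K → 0 ≤ h x := by
  have : ProperSpace E := FiniteDimensional.proper_real E
  have hcomp : ∀ S ⊆ interior K, IsCompact S → 0 ≤ ∫ x in S, h x ∂ν := by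
    intro S hS hSc
    -- Since `S` is a Gδ, `f` can equal `1` exactly on `S`, so its powers are admissible tests that
    -- decrease to the indicator of `S`.
    obtain ⟨f, hfS, hf0, -, hf01⟩ := exists_continuous_one_zero_of_isCompact_of_isGδ hSc
      hSc.isClosed.isGδ (isOpen_interior (s := K)).isClosed_compl
      (Set.disjoint_compl_right_iff_subset.2 hS)
    have hf0' : ∀ x, x ∉ K → f x = 0 := fun x hx => hf0 fun hx' => hx (interior_subset hx')
    have hlim : Tendsto (fun m : ℕ => ∫ x, h x * f x ^ (m + 1) ∂ν) atTop
        (𝓝 (∫ x, S.indicator h x ∂ν)) := by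
      have e : ∀ m : ℕ, ∫ x, h x * f x ^ (m + 1) ∂ν = ∫ x in K, h x * f x ^ (m + 1) ∂ν := by
        intro m
        refine (setIntegral_eq_integral_of_forall_compl_eq_zero fun x hx => ?_).symm
        rw [hf0' x hx]; simp
      have e2 : ∫ x, S.indicator h x ∂ν = ∫ x in K, S.indicator h x ∂ν := by
        refine (setIntegral_eq_integral_of_forall_compl_eq_zero fun x hx => ?_).symm
        exact Set.indicator_of_notMem (fun h' => hx (interior_subset (hS h'))) _
      simp_rw [e, e2]
      refine tendsto_integral_of_dominated_convergence (fun x => |h x|) ?_ hh.norm ?_ ?_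
      · exact fun m => hh.aestronglyMeasurable.mul
          ((f.continuous.pow _).aestronglyMeasurable)
      · refine fun m => Eventually.of_forall fun x => ?_
        rw [Real.norm_eq_abs, abs_mul, abs_of_nonneg (pow_nonneg (hf01 x).1 _)]
        exact mul_le_of_le_one_right (abs_nonneg _) (pow_le_one₀ (hf01 x).1 (hf01 x).2)
      · refine Eventually.of_forall fun x => ?_
        by_cases hx : x ∈ S
        · have : f x = 1 := by rw [hfS] at hx; exact hx
          simp [this, Set.indicator_of_mem hx]
        · have hne : f x ≠ 1 := fun h' => hx (by rw [hfS]; exact h')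
          rw [Set.indicator_of_notMem hx]
          have := (tendsto_pow_atTop_nhds_zero_of_lt_one (hf01 x).1
            ((hf01 x).2.lt_of_ne hne)).comp (tendsto_add_atTop_nat 1)
          simpa using this.const_mul (h x)
    rw [← integral_indicator hSc.measurableSet]
    exact ge_of_tendsto' hlim fun m => hpos _ (f.continuous.pow _)
      (fun x => pow_nonneg (hf01 x).1 _) fun x hx => by rw [hf0' x hx]; simp
  have hm := hh.aestronglyMeasurable
  have heq := (ae_restrict_iff' hK.measurableSet).1 hm.ae_eq_mk
  set A := {x | x ∈ interior K ∧ hm.mk h x < 0} with hA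
  have hAm : MeasurableSet A :=
    isOpen_interior.measurableSet.inter (measurableSet_lt hm.stronglyMeasurable_mk.measurable
      measurable_const)
  have hA0 : ν A = 0 := by
    by_contra hne
    have hfin : ν A ≠ ⊤ := ((measure_mono (fun x hx => interior_subset hx.1)).trans_lt
      hK.measure_lt_top).ne
    obtain ⟨S, hSA, hSc, hSpos⟩ := hAm.exists_lt_isCompact_of_ne_top hfin
      (pos_iff_ne_zero.2 hne)
    have hSK : S ⊆ K := fun x hx => interior_subset (hSA hx).1
    have h1 := hcomp S (fun x hx => (hSA hx).1) hSc
    have hae : h =ᵐ[ν.restrict S] hm.mk h := by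
      refine (ae_restrict_iff' hSc.measurableSet).2 ?_
      filter_upwards [heq] with x hx hxS using hx (hSK hxS)
    have hneg : 0 ≤ᵐ[ν.restrict S] fun x => - h x := by
      filter_upwards [hae, ae_restrict_mem hSc.measurableSet] with x hx hxS
      have := (hSA hxS).2
      simp only [Pi.zero_apply]; linarith
    have h2 : ∫ x in S, - h x ∂ν = 0 := by
      refine le_antisymm ?_ (integral_nonneg_of_ae hneg)
      rw [integral_neg]; linarith
    have h3 := (integral_eq_zero_iff_of_nonneg_ae hneg (hh.mono_set hSK).neg).1 h2
    have h4 : ∀ᵐ x ∂ν.restrict S, False := by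
      filter_upwards [h3, hae, ae_restrict_mem hSc.measurableSet] with x hx hx' hxS
      have := (hSA hxS).2
      simp only [Pi.zero_apply] at hx
      linarith
    rw [ae_iff] at h4
    simp only [not_false_eq_true, Set.ofPred_true, Measure.restrict_apply_univ] at h4
    exact hSpos.ne' h4
  have hA0' : ∀ᵐ x ∂ν, x ∉ A := measure_eq_zero_iff_ae_notMem.1 hA0
  filter_upwards [heq, hA0'] with x hx hxA hxK
  rw [hx (interior_subset hxK)]
  by_contra! hlt
  exact hxA ⟨hxK, hlt⟩

/-! ### Difference quotients along horizontal directions -/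

namespace HomogeneousGroup

variable {n : ℕ} (G : HomogeneousGroup n)

/-- The difference quotient of `f` along the right translations by `t e_j`. -/
def diffQuot (j : Fin n) (t : ℝ) (f : (Fin n → ℝ) → ℝ) (x : Fin n → ℝ) : ℝ :=
  (f (G.mul x (Pi.single j t)) - f x) / t

variable {G}

theorem continuous_diffQuot (j : Fin n) (t : ℝ) {f : (Fin n → ℝ) → ℝ} (hf : Continuous f) :
    Continuous (G.diffQuot j t f) :=
  ((hf.comp (G.contDiff_mul_right _).continuous).sub hf).div_const t

/-- Both partial derivatives of the product at the origin are the identity; differentiating `x⁻¹ ∘ x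
= 0` there gives the claim. -/
theorem hasFDerivAt_inv_zero :
    HasFDerivAt G.inv (-ContinuousLinearMap.id ℝ (Fin n → ℝ)) 0 := by
  have hi : HasFDerivAt G.inv (fderiv ℝ G.inv 0) 0 :=
    ((G.contDiff_inv.differentiable (by simp)).differentiableAt).hasFDerivAt
  have hm : HasFDerivAt (fun z : (Fin n → ℝ) × (Fin n → ℝ) => G.mul z.1 z.2)
      (fderiv ℝ (fun z : (Fin n → ℝ) × (Fin n → ℝ) => G.mul z.1 z.2) (0, 0)) (0, 0) :=
    ((G.contDiff_mul.differentiable (by simp)).differentiableAt).hasFDerivAt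
  set D := fderiv ℝ (fun z : (Fin n → ℝ) × (Fin n → ℝ) => G.mul z.1 z.2) (0, 0)
  have hl : ∀ v, D (v, 0) = v := by
    intro v
    have h1 : HasFDerivAt (fun x : Fin n → ℝ => G.mul x 0)
        (D.comp ((ContinuousLinearMap.id ℝ (Fin n → ℝ)).prod 0)) 0 :=
      hm.comp (f := fun x : Fin n → ℝ => (x, (0 : Fin n → ℝ))) 0
        ((hasFDerivAt_id _).prodMk (hasFDerivAt_const _ _))
    simp_rw [G.mul_zero] at h1
    have := h1.unique (hasFDerivAt_id _)
    simpa using congrArg (fun A => A v) this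
  have hr : ∀ v, D (0, v) = v := by
    intro v
    have h1 : HasFDerivAt (fun x : Fin n → ℝ => G.mul 0 x)
        (D.comp ((0 : (Fin n → ℝ) →L[ℝ] (Fin n → ℝ)).prod
          (ContinuousLinearMap.id ℝ (Fin n → ℝ)))) 0 :=
      hm.comp (f := fun x : Fin n → ℝ => ((0 : Fin n → ℝ), x)) 0
        ((hasFDerivAt_const _ _).prodMk (hasFDerivAt_id _))
    simp_rw [G.zero_mul] at h1
    have := h1.unique (hasFDerivAt_id _)
    simpa using congrArg (fun A => A v) this
  have h0 : HasFDerivAt (fun x : Fin n → ℝ => G.mul (G.inv x) x)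
      (D.comp ((fderiv ℝ G.inv 0).prod (ContinuousLinearMap.id ℝ (Fin n → ℝ)))) 0 := by
    refine HasFDerivAt.comp (g := fun z : (Fin n → ℝ) × (Fin n → ℝ) => G.mul z.1 z.2)
      (f := fun x : Fin n → ℝ => (G.inv x, x)) 0 ?_ (hi.prodMk (hasFDerivAt_id _))
    simpa only [G.inv_zero] using hm
  simp_rw [G.inv_mul] at h0
  have h2 := h0.unique (hasFDerivAt_const _ _)
  have h3 : fderiv ℝ G.inv 0 = -ContinuousLinearMap.id ℝ (Fin n → ℝ) := by
    ext1 v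
    have := congrArg (fun A => A v) h2
    simp only [ContinuousLinearMap.comp_apply, ContinuousLinearMap.prod_apply,
      ContinuousLinearMap.id_apply, zero_apply] at this
    rw [show ((fderiv ℝ G.inv 0) v, v) = ((fderiv ℝ G.inv 0) v, (0 : Fin n → ℝ)) + (0, v) by simp,
      map_add, hl, hr] at this
    simpa using eq_neg_of_add_eq_zero_left this
  rwa [h3] at hi

theorem hasDerivAt_single (j : Fin n) (t : ℝ) :
    HasDerivAt (fun t : ℝ => (Pi.single j t : Fin n → ℝ)) (Pi.single j 1) t :=
  (ContinuousLinearMap.single ℝ (fun _ : Fin n => ℝ) j).hasDerivAt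

theorem hasDerivAt_comp_mul {f : (Fin n → ℝ) → ℝ} {x : Fin n → ℝ} (hf : DifferentiableAt ℝ f x)
    {c : ℝ → Fin n → ℝ} {v : Fin n → ℝ} (hc : HasDerivAt c v 0) (hc0 : c 0 = 0) :
    HasDerivAt (fun t => f (G.mul x (c t))) (fderiv ℝ f x (fderiv ℝ (G.mul x) 0 v)) 0 := by
  have hm : HasFDerivAt (G.mul x) (fderiv ℝ (G.mul x) 0) (c 0) := by
    rw [hc0]
    exact (((G.contDiff_mul_left x).differentiable (by simp)).differentiableAt).hasFDerivAt
  have h1 := hm.comp_hasDerivAt 0 hc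
  have hf' : HasFDerivAt f (fderiv ℝ f x) ((G.mul x ∘ c) 0) := by
    simp only [Function.comp_apply, hc0, G.mul_zero]
    exact hf.hasFDerivAt
  exact hf'.comp_hasDerivAt 0 h1

theorem tendsto_div_of_hasDerivAt {F : ℝ → ℝ} {F' : ℝ} (hF : HasDerivAt F F' 0) :
    Tendsto (fun t => (F t - F 0) / t) (𝓝[>] 0) (𝓝 F') := by
  have := hasDerivAt_iff_tendsto_slope.1 hF
  have h2 := this.mono_left (nhdsWithin_mono 0 (fun t (ht : 0 < t) => ht.ne'))
  refine h2.congr fun t => ?_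
  rw [slope_def_field, sub_zero]

theorem tendsto_diffQuot (j : Fin n) {f : (Fin n → ℝ) → ℝ} {x : Fin n → ℝ}
    (hf : DifferentiableAt ℝ f x) :
    Tendsto (fun t => G.diffQuot j t f x) (𝓝[>] 0) (𝓝 (fderiv ℝ f x (G.leftInvField j x))) := by
  have := tendsto_div_of_hasDerivAt (hasDerivAt_comp_mul (G := G) hf (hasDerivAt_single j 0)
    (Pi.single_zero j))
  simpa [Pi.single_zero, G.mul_zero, diffQuot, leftInvField] using this

theorem tendsto_diffQuot_inv (j : Fin n) {f : (Fin n → ℝ) → ℝ} {x : Fin n → ℝ}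
    (hf : DifferentiableAt ℝ f x) :
    Tendsto (fun t => (f (G.mul x (G.inv (Pi.single j t))) - f x) / t) (𝓝[>] 0)
      (𝓝 (-fderiv ℝ f x (G.leftInvField j x))) := by
  have hc : HasDerivAt (fun t : ℝ => G.inv (Pi.single j t : Fin n → ℝ)) (-Pi.single j 1) 0 := by
    have h1 : HasFDerivAt G.inv (-ContinuousLinearMap.id ℝ (Fin n → ℝ))
        ((fun t : ℝ => (Pi.single j t : Fin n → ℝ)) 0) := by
      simp only [Pi.single_zero]; exact hasFDerivAt_inv_zero
    have := h1.comp_hasDerivAt 0 (hasDerivAt_single j 0)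
    rw [neg_apply, ContinuousLinearMap.id_apply] at this
    exact this
  have := tendsto_div_of_hasDerivAt (hasDerivAt_comp_mul (G := G) hf hc
    (by simp [G.inv_zero]))
  simpa [Pi.single_zero, G.mul_zero, G.inv_zero, leftInvField] using this

end HomogeneousGroup

/-! ### Weak gradients as weak limits of difference quotients -/

namespace HomogeneousGroup

variable {n : ℕ} {G : HomogeneousGroup n}

theorem locallyIntegrable_coord {g : (Fin n → ℝ) → EuclideanSpace ℝ G.HorizontalIndex}
    (hg : LocallyIntegrable g volume) (j : G.HorizontalIndex) :
    LocallyIntegrable (fun x => g x j) volume :=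
  hg.mono ((EuclideanSpace.proj (𝕜 := ℝ) j).continuous.comp_aestronglyMeasurable
    hg.aestronglyMeasurable) (Eventually.of_forall fun x => PiLp.norm_apply_le (g x) j)

theorem integrable_mul_of_hasCompactSupport {f θ : (Fin n → ℝ) → ℝ}
    (hf : LocallyIntegrable f volume) (hθ : Continuous θ) (hc : HasCompactSupport θ) :
    Integrable (fun x => f x * θ x) volume := by
  simpa only [smul_eq_mul, mul_comm] using
    hf.integrable_smul_left_of_hasCompactSupport hθ hc

variable (G) in
/-- Points reached from a compact set by short right translations stay in a compact set. -/
theorem exists_isCompact_translates (j : Fin n) {K : Set (Fin n → ℝ)} (hK : IsCompact K) :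
    ∃ K', IsCompact K' ∧ K ⊆ K' ∧ ∀ t ∈ Set.Icc (0 : ℝ) 1, ∀ x,
      G.mul x (G.inv (Pi.single j t)) ∈ K → x ∈ K' := by
  refine ⟨(fun p : (Fin n → ℝ) × ℝ => G.mul p.1 (Pi.single j p.2)) '' (K ×ˢ Set.Icc 0 1),
    (hK.prod isCompact_Icc).image ?_, ?_, ?_⟩
  · exact G.continuous_mul.comp (continuous_fst.prodMk
      ((ContinuousLinearMap.single ℝ (fun _ : Fin n => ℝ) j).continuous.comp continuous_snd))
  · intro x hx
    exact ⟨(x, 0), ⟨hx, by simp⟩, by simp [G.mul_zero]⟩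
  · intro t ht x hx
    exact ⟨(_, t), ⟨hx, ht⟩, G.inv_mul_cancel_right x _⟩

/-- Discrete integration by parts: invariance of the measure moves the quotient from `u` onto `θ`,
as a quotient along the inverse translation. It converges boundedly to `-X_j θ`, so `u` need only be
continuous. -/
theorem tendsto_integral_diffQuot_mul_contDiff (r : G.HomogeneousNorm)
    {u θ : (Fin n → ℝ) → ℝ} (hu : Continuous u) (hθ : ContDiff ℝ 1 θ)
    (hc : HasCompactSupport θ) (j : G.HorizontalIndex) :
    Tendsto (fun t => ∫ x, G.diffQuot j.1 t u x * θ x) (𝓝[>] 0)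
      (𝓝 (-∫ x, u x * G.horizontalGradient θ x j)) := by
  obtain ⟨K, hK, hsK, hKt⟩ := G.exists_isCompact_translates j.1 hc
  obtain ⟨C, hC, hb⟩ := (r.lipLoc_of_contDiff hθ).exists_bound_single j hK
  obtain ⟨M, hM⟩ := hK.exists_bound_of_continuousOn hu.continuousOn
  have hcont : ∀ t : ℝ, Continuous fun x => θ (G.mul x (G.inv (Pi.single j.1 t))) := fun t =>
    hθ.continuous.comp (G.contDiff_mul_right _).continuous
  have hcs : ∀ t : ℝ, HasCompactSupport fun x => θ (G.mul x (G.inv (Pi.single j.1 t))) :=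
    fun t => hc.comp_homeomorph (G.mulRightHomeomorph _)
  have key : Tendsto (fun t => ∫ x, u x *
      ((θ (G.mul x (G.inv (Pi.single j.1 t))) - θ x) / t)) (𝓝[>] 0)
      (𝓝 (∫ x, u x * -G.horizontalGradient θ x j)) := by
    refine tendsto_integral_of_bounded_of_isCompact hK (M := M * C)
      (Eventually.of_forall fun t => (hu.mul (((hcont t).sub hθ.continuous).div_const
        t)).aestronglyMeasurable) ?_ ?_ ?_
    · filter_upwards [Ioc_mem_nhdsGT (zero_lt_one' ℝ)] with t ht x hx
      have h1 : θ (G.mul x (G.inv (Pi.single j.1 t))) = 0 :=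
        image_eq_zero_of_notMem_tsupport fun h => hx (hKt t ⟨ht.1.le, ht.2⟩ x h)
      have h2 : θ x = 0 := image_eq_zero_of_notMem_tsupport fun h => hx (hsK h)
      simp [h1, h2]
    · filter_upwards [hb] with t ht x hx
      rw [abs_mul]
      have h1 := hM x hx
      have h0 : 0 ≤ M := (norm_nonneg _).trans h1
      exact mul_le_mul h1 (ht x hx).2 (abs_nonneg _) h0
    · intro x
      exact (tendsto_diffQuot_inv j.1
        (hθ.differentiable (by simp)).differentiableAt).const_mul (u x)
  simp only [mul_neg, integral_neg] at key
  refine key.congr' ?_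
  filter_upwards [self_mem_nhdsWithin] with t ht
  have hi1 : Integrable fun x => u x * θ (G.mul x (G.inv (Pi.single j.1 t))) :=
    (hu.mul (hcont t)).integrable_of_hasCompactSupport (hcs t).mul_left
  have hi2 : Integrable fun x => u x * θ x :=
    (hu.mul hθ.continuous).integrable_of_hasCompactSupport hc.mul_left
  have hi3 : Integrable fun x => u (G.mul x (Pi.single j.1 t)) * θ x :=
    ((hu.comp (G.contDiff_mul_right _).continuous).mul
      hθ.continuous).integrable_of_hasCompactSupport hc.mul_left
  have e1 : ∫ x, u (G.mul x (Pi.single j.1 t)) * θ x =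
      ∫ x, u x * θ (G.mul x (G.inv (Pi.single j.1 t))) := by
    rw [← G.integral_comp_mul_right (Pi.single j.1 t)
      (fun x => u x * θ (G.mul x (G.inv (Pi.single j.1 t))))]
    simp only [G.mul_inv_cancel_right]
  calc ∫ x, u x * ((θ (G.mul x (G.inv (Pi.single j.1 t))) - θ x) / t)
      = ∫ x, (u x * θ (G.mul x (G.inv (Pi.single j.1 t))) - u x * θ x) / t := by
        congr 1; ext x; ring
    _ = ((∫ x, u x * θ (G.mul x (G.inv (Pi.single j.1 t)))) - ∫ x, u x * θ x) / t := by
        rw [integral_div, integral_sub hi1 hi2]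
    _ = ∫ x, (u (G.mul x (Pi.single j.1 t)) * θ x - u x * θ x) / t := by
        rw [← e1, integral_div, integral_sub hi3 hi2]
    _ = _ := by
        congr 1; ext x; unfold diffQuot; ring

theorem abs_integral_sub_le {f θ θ' : (Fin n → ℝ) → ℝ} (hf : LocallyIntegrable f volume)
    (hθ : Continuous θ) (hc : HasCompactSupport θ) (hθ' : Continuous θ')
    (hs : Function.support θ' ⊆ Function.support θ) {δ : ℝ} (hd : ∀ x, |θ' x - θ x| ≤ δ) :
    |(∫ x, f x * θ' x) - ∫ x, f x * θ x| ≤ δ * ∫ x in tsupport θ, |f x| := by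
  have hc' : HasCompactSupport θ' := hc.mono hs
  rw [← integral_sub (integrable_mul_of_hasCompactSupport hf hθ' hc')
    (integrable_mul_of_hasCompactSupport hf hθ hc), ← integral_const_mul]
  have hK : MeasurableSet (tsupport θ) := (isClosed_tsupport θ).measurableSet
  have e : ∫ x, (f x * θ' x - f x * θ x) = ∫ x in tsupport θ, (f x * θ' x - f x * θ x) := by
    refine (setIntegral_eq_integral_of_forall_compl_eq_zero fun x hx => ?_).symm
    have h1 : θ x = 0 := image_eq_zero_of_notMem_tsupport hx
    have h2 : θ' x = 0 := by
      by_contra h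
      exact hs h h1
    simp [h1, h2]
  rw [e]
  have hi : IntegrableOn (fun x => δ * |f x|) (tsupport θ) :=
    (hf.integrableOn_isCompact hc).norm.const_mul δ
  rw [← Real.norm_eq_abs]
  refine norm_integral_le_of_norm_le hi (Eventually.of_forall fun x => ?_)
  rw [← mul_sub, Real.norm_eq_abs, abs_mul, mul_comm]
  exact mul_le_mul_of_nonneg_right (hd x) (abs_nonneg _)

/-- For smooth `θ` this is integration by parts. Continuous `θ` are reached by uniform
approximation, because the quotients of a Lipschitz `u` are bounded on the support uniformly in `t`.
Continuous tests are needed since products such as `Λ'(u) θ` are no smoother. -/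
theorem IsWeakGradient.tendsto_integral_diffQuot {r : G.HomogeneousNorm}
    {u : (Fin n → ℝ) → ℝ} {g : (Fin n → ℝ) → EuclideanSpace ℝ G.HorizontalIndex}
    (hg : G.IsWeakGradient u g) (hu : r.LipLoc u) {θ : (Fin n → ℝ) → ℝ} (hθ : Continuous θ)
    (hc : HasCompactSupport θ) (j : G.HorizontalIndex) :
    Tendsto (fun t => ∫ x, G.diffQuot j.1 t u x * θ x) (𝓝[>] 0) (𝓝 (∫ x, g x j * θ x)) := by
  obtain ⟨C, hC, hb⟩ := hu.exists_bound_single j hc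
  have hgj := locallyIntegrable_coord hg.2.1 j
  set I := ∫ x in tsupport θ, |g x j| with hI
  have hI0 : 0 ≤ I := integral_nonneg fun x => abs_nonneg _
  set V := volume.real (tsupport θ) with hV
  have hV0 : 0 ≤ V := measureReal_nonneg
  refine Metric.tendsto_nhds.2 fun ε hε => ?_
  -- Replacing `θ` by `θ'` costs at most `δ C V` in the quotient integral and `δ I` in the gradient
  -- integral; this `δ` keeps each below `ε / 3`.
  set δ := ε / (3 * (C * V + I + 1)) with hδ
  have hδ0 : 0 < δ := by positivity
  have hδε : δ * (C * V + I + 1) = ε / 3 := by rw [hδ]; field_simp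
  obtain ⟨θ', hθ's, hθ'd, hθ'supp⟩ := hθ.exists_contDiff_approx ⊤ (ε := fun _ => δ)
    continuous_const (fun _ => hδ0)
  have hc' : HasCompactSupport θ' := hc.mono hθ'supp
  have hd : ∀ x, |θ' x - θ x| ≤ δ := fun x => by
    rw [← Real.dist_eq]; exact (hθ'd x).le
  have h1 := tendsto_integral_diffQuot_mul_contDiff r hu.continuous
    (hθ's.of_le (by exact_mod_cast le_top)) hc' j
  rw [hg.2.2 j θ' hθ's hc', neg_neg] at h1
  have h2 := Metric.tendsto_nhds.1 h1 (ε / 3) (by positivity)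
  have h3 := abs_integral_sub_le hgj hθ hc hθ's.continuous hθ'supp hd
  filter_upwards [h2, hb] with t ht htb
  have h4 := abs_integral_sub_le (continuous_diffQuot (G := G) j.1 t
    hu.continuous).locallyIntegrable hθ hc hθ's.continuous hθ'supp hd
  have h5 : ∫ x in tsupport θ, |G.diffQuot j.1 t u x| ≤ C * V := by
    have h7 : ‖∫ x in tsupport θ, |G.diffQuot j.1 t u x|‖ ≤ C * V := by
      refine norm_setIntegral_le_of_norm_le_const hc.measure_lt_top fun x hx => ?_
      rw [Real.norm_eq_abs, abs_abs]
      exact (htb x hx).1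
    exact (le_abs_self _).trans h7
  have h6 := mul_le_mul_of_nonneg_left h5 hδ0.le
  rw [Real.dist_eq] at ht ⊢
  rw [← hI] at h3
  rw [abs_lt] at ht ⊢
  rw [abs_le] at h3 h4
  constructor <;> nlinarith

theorem isWeakGradient_of_tendsto (r : G.HomogeneousNorm)
    {u : (Fin n → ℝ) → ℝ} {g : (Fin n → ℝ) → EuclideanSpace ℝ G.HorizontalIndex}
    (hu : Continuous u) (hg : LocallyIntegrable g volume)
    (h : ∀ (j : G.HorizontalIndex) (θ : (Fin n → ℝ) → ℝ), Continuous θ → HasCompactSupport θ →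
      Tendsto (fun t => ∫ x, G.diffQuot j.1 t u x * θ x) (𝓝[>] 0) (𝓝 (∫ x, g x j * θ x))) :
    G.IsWeakGradient u g := by
  refine ⟨hu.locallyIntegrable, hg, fun j θ hθ hc => ?_⟩
  have h1 := tendsto_integral_diffQuot_mul_contDiff r hu
    (hθ.of_le (by exact_mod_cast le_top)) hc j
  rw [← tendsto_nhds_unique h1 (h j θ hθ.continuous hc), neg_neg]

theorem HomogeneousNorm.LipLoc.isBigO_sub {r : G.HomogeneousNorm} {u : (Fin n → ℝ) → ℝ}
    (hu : r.LipLoc u) (j : G.HorizontalIndex) (x : Fin n → ℝ) :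
    (fun t => u (G.mul x (Pi.single j.1 t)) - u x) =O[𝓝[>] 0] fun t : ℝ => t := by
  obtain ⟨C, hC, hb⟩ := hu.exists_bound_single j (isCompact_singleton (x := x))
  refine Asymptotics.IsBigO.of_bound C ?_
  filter_upwards [hb, self_mem_nhdsWithin] with t ht htp
  have := (ht x rfl).1
  have htp' : (0 : ℝ) < t := htp
  rw [abs_div, div_le_iff₀ (abs_pos.2 htp'.ne')] at this
  exact this

theorem HomogeneousNorm.LipLoc.tendsto_mul_single {r : G.HomogeneousNorm}
    {u : (Fin n → ℝ) → ℝ} (hu : r.LipLoc u) (j : Fin n) (x : Fin n → ℝ) :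
    Tendsto (fun t => u (G.mul x (Pi.single j t))) (𝓝[>] 0) (𝓝 (u x)) := by
  have h1 := (hu.continuous.comp (G.contDiff_mul_left x).continuous).tendsto 0
  simp only [Function.comp_apply, G.mul_zero] at h1
  exact h1.comp (HomogeneousNorm.tendsto_single j)

theorem locallyIntegrable_continuous_smul {a : (Fin n → ℝ) → ℝ}
    {g : (Fin n → ℝ) → EuclideanSpace ℝ G.HorizontalIndex} (ha : Continuous a)
    (hg : LocallyIntegrable g volume) : LocallyIntegrable (fun x => a x • g x) volume := by
  rw [← locallyIntegrableOn_univ] at hg ⊢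
  exact hg.continuousOn_smul isOpen_univ.isLocallyClosed ha.continuousOn

/-- The quotient of `Λ(u)` differs from `Λ'(u)` times the quotient of `u` by a bounded term. That
term tends to zero at every point, by differentiability of `Λ` and the Lipschitz bound on `u`, even
where `u` has no derivative. -/
theorem IsWeakGradient.comp {r : G.HomogeneousNorm}
    {u : (Fin n → ℝ) → ℝ} {g : (Fin n → ℝ) → EuclideanSpace ℝ G.HorizontalIndex}
    (hg : G.IsWeakGradient u g) (hu : r.LipLoc u) {Λ : ℝ → ℝ} (hΛ : ContDiff ℝ 1 Λ) :
    G.IsWeakGradient (fun x => Λ (u x)) (fun x => deriv Λ (u x) • g x) := by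
  have hΛ' : Continuous (fun x => deriv Λ (u x)) :=
    (hΛ.continuous_deriv le_rfl).comp hu.continuous
  refine isWeakGradient_of_tendsto r (hΛ.continuous.comp hu.continuous)
    (locallyIntegrable_continuous_smul hΛ' hg.2.1) fun j θ hθ hc => ?_
  obtain ⟨C, hC, hb⟩ := hu.exists_bound_single j hc
  obtain ⟨D, hD, hb'⟩ := (hu.comp hΛ).exists_bound_single j hc
  have hθ2 : IsCompact (tsupport θ) := hc
  obtain ⟨M, hM⟩ := hθ2.exists_bound_of_continuousOn hΛ'.continuousOn
  obtain ⟨N, hN⟩ := hθ2.exists_bound_of_continuousOn hθ.continuousOn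
  have h1 := hg.tendsto_integral_diffQuot hu (hΛ'.mul hθ) hc.mul_left j
  have hc1 : ∀ t, Continuous (G.diffQuot j.1 t fun x => Λ (u x)) := fun t =>
    continuous_diffQuot _ _ (hΛ.continuous.comp hu.continuous)
  have hc2 : ∀ t, Continuous (G.diffQuot j.1 t u) := fun t => continuous_diffQuot _ _ hu.continuous
  have h2 : Tendsto (fun t => ∫ x, (G.diffQuot j.1 t (fun x => Λ (u x)) x -
      deriv Λ (u x) * G.diffQuot j.1 t u x) * θ x) (𝓝[>] 0) (𝓝 (∫ _ : Fin n → ℝ, (0 : ℝ))) := by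
    refine tendsto_integral_of_bounded_of_isCompact hθ2 (M := (D + M * C) * N)
      (Eventually.of_forall fun t =>
        (((hc1 t).sub (hΛ'.mul (hc2 t))).mul hθ).aestronglyMeasurable) ?_ ?_ ?_
    · exact Eventually.of_forall fun t x hx => by
        rw [image_eq_zero_of_notMem_tsupport hx, MulZeroClass.mul_zero]
    · filter_upwards [hb, hb'] with t ht ht' x hx
      have hM0 : 0 ≤ M := (norm_nonneg _).trans (hM x hx)
      rw [abs_mul]
      refine mul_le_mul ?_ (hN x hx) (abs_nonneg _) (by positivity)
      refine (abs_sub _ _).trans (add_le_add (ht' x hx).1 ?_)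
      rw [abs_mul]
      exact mul_le_mul (hM x hx) (ht x hx).1 (abs_nonneg _) hM0
    · intro x
      have hlo := hasDerivAt_iff_isLittleO.1
        ((hΛ.differentiable (by simp)).differentiableAt (x := u x)).hasDerivAt
      have h3 := (hlo.comp_tendsto (hu.tendsto_mul_single j.1 x)).trans_isBigO (hu.isBigO_sub j x)
      have h4 := h3.tendsto_div_nhds_zero
      have h5 := h4.mul_const (θ x)
      rw [MulZeroClass.zero_mul] at h5
      refine h5.congr fun t => ?_
      simp only [Function.comp_apply, smul_eq_mul, diffQuot]
      ring
  rw [integral_zero] at h2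
  have h3 := h1.add h2
  rw [add_zero] at h3
  have e : (fun x => (deriv Λ (u x) • g x) j * θ x) = fun x => g x j * (deriv Λ (u x) * θ x) := by
    ext x
    simp only [PiLp.smul_apply, smul_eq_mul]
    ring
  rw [e]
  refine h3.congr fun t => ?_
  rw [← integral_add]
  · congr 1; ext x
    simp only [Pi.mul_apply]; ring
  · exact ((hc2 t).mul (hΛ'.mul hθ)).integrable_of_hasCompactSupport hc.mul_left.mul_left
  · exact (((hc1 t).sub (hΛ'.mul (hc2 t))).mul hθ).integrable_of_hasCompactSupport hc.mul_left

/-- The discrete Leibniz rule is exact up to the cross term `t D_t u D_t v`, which is bounded and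
vanishes pointwise as `t → 0⁺`. -/
theorem IsWeakGradient.mul {r : G.HomogeneousNorm}
    {u v : (Fin n → ℝ) → ℝ} {g h : (Fin n → ℝ) → EuclideanSpace ℝ G.HorizontalIndex}
    (hg : G.IsWeakGradient u g) (hu : r.LipLoc u) (hh : G.IsWeakGradient v h)
    (hv : r.LipLoc v) :
    G.IsWeakGradient (fun x => u x * v x) (fun x => v x • g x + u x • h x) := by
  have huc := hu.continuous
  have hvc := hv.continuous
  refine isWeakGradient_of_tendsto r (huc.mul hvc)
    ((locallyIntegrable_continuous_smul hvc hg.2.1).add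
      (locallyIntegrable_continuous_smul huc hh.2.1)) fun j θ hθ hc => ?_
  obtain ⟨C, hC, hb⟩ := hu.exists_bound_single j hc
  obtain ⟨D, hD, hb'⟩ := hv.exists_bound_single j hc
  have hθ2 : IsCompact (tsupport θ) := hc
  obtain ⟨N, hN⟩ := hθ2.exists_bound_of_continuousOn hθ.continuousOn
  have h1 := hg.tendsto_integral_diffQuot hu (hvc.mul hθ) hc.mul_left j
  have h1' := hh.tendsto_integral_diffQuot hv (huc.mul hθ) hc.mul_left j
  have hc1 : ∀ t, Continuous (G.diffQuot j.1 t u) := fun t => continuous_diffQuot _ _ huc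
  have hc2 : ∀ t, Continuous (G.diffQuot j.1 t v) := fun t => continuous_diffQuot _ _ hvc
  have h2 : Tendsto (fun t => ∫ x, (G.diffQuot j.1 t u x * (t * G.diffQuot j.1 t v x)) * θ x)
      (𝓝[>] 0) (𝓝 (∫ _ : Fin n → ℝ, (0 : ℝ))) := by
    refine tendsto_integral_of_bounded_of_isCompact hθ2 (M := (C * (1 * D)) * N)
      (Eventually.of_forall fun t =>
        (((hc1 t).mul ((hc2 t).const_mul t)).mul hθ).aestronglyMeasurable) ?_ ?_ ?_
    · exact Eventually.of_forall fun t x hx => by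
        rw [image_eq_zero_of_notMem_tsupport hx, MulZeroClass.mul_zero]
    · filter_upwards [hb, hb', Ioc_mem_nhdsGT (zero_lt_one' ℝ)] with t ht ht' ht1 x hx
      rw [abs_mul, abs_mul, abs_mul, abs_of_pos ht1.1]
      have := ht1.2
      have := ht1.1
      have h5 : |G.diffQuot j.1 t u x| ≤ C := (ht x hx).1
      have h6 : |G.diffQuot j.1 t v x| ≤ D := (ht' x hx).1
      have h7 : |θ x| ≤ N := hN x hx
      gcongr
    · intro x
      have h0 : Tendsto (fun t : ℝ => C * |t * G.diffQuot j.1 t v x| * |θ x|) (𝓝[>] 0) (𝓝 0) := by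
        have h3 : Tendsto (fun t : ℝ => v (G.mul x (Pi.single j.1 t)) - v x) (𝓝[>] 0) (𝓝 0) := by
          simpa using (hv.tendsto_mul_single j.1 x).sub_const (v x)
        have h4 := (h3.abs.const_mul C).mul_const |θ x|
        rw [abs_zero, MulZeroClass.mul_zero, MulZeroClass.zero_mul] at h4
        refine h4.congr' ?_
        filter_upwards [self_mem_nhdsWithin] with t ht
        have : t ≠ 0 := ne_of_gt ht
        simp only [diffQuot]
        rw [mul_div_cancel₀ _ this]
      refine squeeze_zero_norm' ?_ h0
      by_cases hx : x ∈ tsupport θ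
      · filter_upwards [hb] with t ht
        rw [Real.norm_eq_abs, abs_mul, abs_mul]
        gcongr
        exact (ht x hx).1
      · refine Eventually.of_forall fun t => ?_
        rw [image_eq_zero_of_notMem_tsupport hx]; simp
  rw [integral_zero] at h2
  have h3 := (h1.add h1').add h2
  rw [add_zero] at h3
  have i1 : Integrable fun x => g x j * (v x * θ x) :=
    integrable_mul_of_hasCompactSupport (locallyIntegrable_coord hg.2.1 j) (hvc.mul hθ) hc.mul_left
  have i2 : Integrable fun x => h x j * (u x * θ x) :=
    integrable_mul_of_hasCompactSupport (locallyIntegrable_coord hh.2.1 j) (huc.mul hθ) hc.mul_left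
  simp only [Pi.mul_apply] at h3
  rw [← integral_add i1 i2] at h3
  have e : (fun x => (v x • g x + u x • h x) j * θ x) =
      fun x => g x j * (v x * θ x) + h x j * (u x * θ x) := by
    ext x
    simp only [PiLp.add_apply, PiLp.smul_apply, smul_eq_mul]
    ring
  rw [e]
  refine h3.congr' ?_
  filter_upwards [self_mem_nhdsWithin] with t ht
  have htne : t ≠ 0 := ne_of_gt ht
  have i3 : Integrable fun x => G.diffQuot j.1 t u x * (v x * θ x) :=
    ((hc1 t).mul (hvc.mul hθ)).integrable_of_hasCompactSupport hc.mul_left.mul_left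
  have i4 : Integrable fun x => G.diffQuot j.1 t v x * (u x * θ x) :=
    ((hc2 t).mul (huc.mul hθ)).integrable_of_hasCompactSupport hc.mul_left.mul_left
  have i5 : Integrable fun x => (G.diffQuot j.1 t u x * (t * G.diffQuot j.1 t v x)) * θ x :=
    (((hc1 t).mul ((hc2 t).const_mul t)).mul hθ).integrable_of_hasCompactSupport hc.mul_left
  have i34 : Integrable fun x => G.diffQuot j.1 t u x * (v x * θ x) +
      G.diffQuot j.1 t v x * (u x * θ x) := i3.add i4
  rw [← integral_add i3 i4, ← integral_add i34 i5]
  congr 1; ext x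
  simp only [diffQuot]
  field_simp
  ring

theorem isWeakGradient_of_contDiff (r : G.HomogeneousNorm) {f : (Fin n → ℝ) → ℝ}
    (hf : ContDiff ℝ 1 f) : G.IsWeakGradient f (G.horizontalGradient f) := by
  have hgc : Continuous (G.horizontalGradient f) := by
    refine (PiLp.continuous_toLp 2 _).comp (continuous_pi fun j => ?_)
    exact (hf.continuous_fderiv (by simp)).clm_apply (G.contDiff_leftInvField j.1).continuous
  refine isWeakGradient_of_tendsto r hf.continuous hgc.locallyIntegrable fun j θ hθ hc => ?_
  have hθ2 : IsCompact (tsupport θ) := hc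
  obtain ⟨C, hC, hb⟩ := (r.lipLoc_of_contDiff hf).exists_bound_single j hθ2
  obtain ⟨N, hN⟩ := hθ2.exists_bound_of_continuousOn hθ.continuousOn
  refine tendsto_integral_of_bounded_of_isCompact hθ2 (M := C * N)
    (Eventually.of_forall fun t =>
      ((continuous_diffQuot _ _ hf.continuous).mul hθ).aestronglyMeasurable) ?_ ?_ ?_
  · exact Eventually.of_forall fun t x hx => by
      rw [image_eq_zero_of_notMem_tsupport hx, MulZeroClass.mul_zero]
  · filter_upwards [hb] with t ht x hx
    rw [abs_mul]
    exact mul_le_mul (ht x hx).1 (hN x hx) (abs_nonneg _) hC.le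
  · intro x
    exact (tendsto_diffQuot j.1 (hf.differentiable (by simp)).differentiableAt).mul_const (θ x)

/-- A bound on difference quotients survives weak limits: each coordinate, tested against
nonnegative functions, stays between `-C` and `C`. -/
theorem IsWeakGradient.exists_ae_bound {r : G.HomogeneousNorm}
    {u : (Fin n → ℝ) → ℝ} {g : (Fin n → ℝ) → EuclideanSpace ℝ G.HorizontalIndex}
    (hg : G.IsWeakGradient u g) (hu : r.LipLoc u) {K : Set (Fin n → ℝ)} (hK : IsCompact K) :
    ∃ M : ℝ, ∀ᵐ x, x ∈ K → ‖g x‖ ≤ M := by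
  -- The duality argument gives a sign only in the interior of a compact set, hence a compact `L`
  -- with `K` in its interior.
  obtain ⟨L, hL, hKL⟩ := exists_compact_superset hK
  have hcoord : ∀ j : G.HorizontalIndex, ∃ C : ℝ, ∀ᵐ x, x ∈ K → |g x j| ≤ C := by
    intro j
    obtain ⟨C, hC, hb⟩ := hu.exists_bound_single j hL
    have hgj := locallyIntegrable_coord hg.2.1 j
    have hcLI : LocallyIntegrable (fun _ : Fin n → ℝ => C) volume :=
      continuous_const.locallyIntegrable
    have hbound : ∀ θ : (Fin n → ℝ) → ℝ, Continuous θ → (∀ x, 0 ≤ θ x) →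
        (∀ x, x ∉ L → θ x = 0) → HasCompactSupport θ ∧
        |∫ x, g x j * θ x| ≤ ∫ x, C * θ x := by
      intro θ hθ h0 hs
      have hc : HasCompactSupport θ := HasCompactSupport.intro hL hs
      refine ⟨hc, ?_⟩
      have h1 := (hg.tendsto_integral_diffQuot hu hθ hc j).abs
      refine le_of_tendsto h1 ?_
      filter_upwards [hb] with t ht
      have hi : Integrable (fun x => C * θ x) volume :=
        integrable_mul_of_hasCompactSupport hcLI hθ hc
      rw [← Real.norm_eq_abs]
      refine norm_integral_le_of_norm_le hi (Eventually.of_forall fun x => ?_)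
      rw [Real.norm_eq_abs, abs_mul, abs_of_nonneg (h0 x)]
      by_cases hx : x ∈ L
      · exact mul_le_mul_of_nonneg_right (ht x hx).1 (h0 x)
      · rw [hs x hx, MulZeroClass.mul_zero, MulZeroClass.mul_zero]
    have h1 := ae_nonneg_of_integral_mul_nonneg (h := fun x => C - g x j) hL
      ((hcLI.sub hgj).integrableOn_isCompact hL) (fun θ hθ h0 hs => by
        obtain ⟨hc, hle⟩ := hbound θ hθ h0 hs
        simp only [sub_mul]
        rw [integral_sub (integrable_mul_of_hasCompactSupport hcLI hθ hc)
          (integrable_mul_of_hasCompactSupport hgj hθ hc)]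
        linarith [(abs_le.1 hle).2])
    have h2 := ae_nonneg_of_integral_mul_nonneg (h := fun x => C + g x j) hL
      ((hcLI.add hgj).integrableOn_isCompact hL) (fun θ hθ h0 hs => by
        obtain ⟨hc, hle⟩ := hbound θ hθ h0 hs
        simp only [add_mul]
        rw [integral_add (integrable_mul_of_hasCompactSupport hcLI hθ hc)
          (integrable_mul_of_hasCompactSupport hgj hθ hc)]
        linarith [(abs_le.1 hle).1])
    refine ⟨C, ?_⟩
    filter_upwards [h1, h2] with x hx1 hx2 hx
    have h3 := hx1 (hKL hx)
    have h4 := hx2 (hKL hx)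
    exact abs_le.2 ⟨by linarith, by linarith⟩
  choose C hC using hcoord
  refine ⟨√(∑ j, C j ^ 2), ?_⟩
  filter_upwards [ae_all_iff.2 hC] with x hx hxK
  rw [EuclideanSpace.norm_eq]
  refine Real.sqrt_le_sqrt (Finset.sum_le_sum fun j _ => ?_)
  exact pow_le_pow_left₀ (norm_nonneg _) (hx j hxK) 2

end HomogeneousGroup

/-! ### Vanishing horizontal derivatives force constancy -/

namespace HomogeneousGroup

variable {n : ℕ} {G : HomogeneousGroup n}

/-- The distributional derivative of `w` along the (divergence-free) field `X` vanishes. -/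
def DerivVanishes (w : (Fin n → ℝ) → ℝ) (X : (Fin n → ℝ) → (Fin n → ℝ)) : Prop :=
  ∀ θ : (Fin n → ℝ) → ℝ, ContDiff ℝ ∞ θ → HasCompactSupport θ →
    ∫ x, w x * fderiv ℝ θ x (X x) = 0

theorem contDiff_fderiv_apply {θ : (Fin n → ℝ) → ℝ} {X : (Fin n → ℝ) → (Fin n → ℝ)}
    (hθ : ContDiff ℝ ∞ θ) (hX : ContDiff ℝ ∞ X) : ContDiff ℝ ∞ fun x => fderiv ℝ θ x (X x) :=
  (hθ.fderiv_right (by simp)).clm_apply hX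

theorem hasCompactSupport_fderiv_apply {θ : (Fin n → ℝ) → ℝ} (X : (Fin n → ℝ) → (Fin n → ℝ))
    (hc : HasCompactSupport θ) : HasCompactSupport fun x => fderiv ℝ θ x (X x) :=
  (hc.fderiv ℝ).mono fun x hx => by
    rw [Function.mem_support] at hx ⊢
    intro h
    rw [h] at hx
    simp at hx

theorem integrable_mul_fderiv_apply {w θ : (Fin n → ℝ) → ℝ} {X : (Fin n → ℝ) → (Fin n → ℝ)}
    (hw : Continuous w) (hθ : ContDiff ℝ ∞ θ) (hc : HasCompactSupport θ) (hX : ContDiff ℝ ∞ X) :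
    Integrable fun x => w x * fderiv ℝ θ x (X x) :=
  (hw.mul (contDiff_fderiv_apply hθ hX).continuous).integrable_of_hasCompactSupport
    (hasCompactSupport_fderiv_apply X hc).mul_left

theorem DerivVanishes.add {w : (Fin n → ℝ) → ℝ} {X Y : (Fin n → ℝ) → (Fin n → ℝ)}
    (hw : Continuous w) (hX : DerivVanishes w X) (hY : DerivVanishes w Y)
    (hXs : ContDiff ℝ ∞ X) (hYs : ContDiff ℝ ∞ Y) : DerivVanishes w (X + Y) := by
  intro θ hθ hc
  simp only [Pi.add_apply, map_add, mul_add]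
  rw [integral_add (integrable_mul_fderiv_apply hw hθ hc hXs)
    (integrable_mul_fderiv_apply hw hθ hc hYs), hX θ hθ hc, hY θ hθ hc, add_zero]

theorem DerivVanishes.smul {w : (Fin n → ℝ) → ℝ} {X : (Fin n → ℝ) → (Fin n → ℝ)}
    (hX : DerivVanishes w X) (c : ℝ) : DerivVanishes w (c • X) := by
  intro θ hθ hc
  simp only [Pi.smul_apply, map_smul, smul_eq_mul, mul_left_comm _ c]
  rw [integral_const_mul, hX θ hθ hc, MulZeroClass.mul_zero]

/-- `[X, Y] θ = X (Y θ) - Y (X θ)` by symmetry of second derivatives, and `X θ`, `Y θ` are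
themselves admissible test functions. -/
theorem DerivVanishes.lieBracket {w : (Fin n → ℝ) → ℝ} {X Y : (Fin n → ℝ) → (Fin n → ℝ)}
    (hw : Continuous w) (hX : DerivVanishes w X) (hY : DerivVanishes w Y)
    (hXs : ContDiff ℝ ∞ X) (hYs : ContDiff ℝ ∞ Y) :
    DerivVanishes w (VectorField.lieBracket ℝ X Y) := by
  intro θ hθ hc
  have hYθ := contDiff_fderiv_apply hθ hYs
  have hXθ := contDiff_fderiv_apply hθ hXs
  have h1 := hX _ hYθ (hasCompactSupport_fderiv_apply Y hc)
  have h2 := hY _ hXθ (hasCompactSupport_fderiv_apply X hc)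
  have i1 := integrable_mul_fderiv_apply hw hYθ (hasCompactSupport_fderiv_apply Y hc) hXs
  have i2 := integrable_mul_fderiv_apply hw hXθ (hasCompactSupport_fderiv_apply X hc) hYs
  have h3 := integral_sub i1 i2
  rw [h1, h2, sub_zero] at h3
  rw [← h3]
  congr 1
  ext x
  have hd : DifferentiableAt ℝ (fderiv ℝ θ) x :=
    ((hθ.fderiv_right (m := ∞) (by simp)).differentiable (by simp)).differentiableAt
  have hYd : DifferentiableAt ℝ Y x := (hYs.differentiable (by simp)).differentiableAt
  have hXd : DifferentiableAt ℝ X x := (hXs.differentiable (by simp)).differentiableAt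
  have hsymm : IsSymmSndFDerivAt ℝ θ x :=
    hθ.contDiffAt.isSymmSndFDerivAt (by
      rw [minSmoothness_of_isRCLikeNormedField]
      exact WithTop.coe_le_coe.2 (le_top : (2 : ℕ∞) ≤ ⊤))
  rw [fderiv_clm_apply hd hYd, fderiv_clm_apply hd hXd]
  have e : (fderiv ℝ (fderiv ℝ θ) x (X x)) (Y x) = (fderiv ℝ (fderiv ℝ θ) x (Y x)) (X x) :=
    hsymm.eq (X x) (Y x)
  simp only [VectorField.lieBracket, add_apply, ContinuousLinearMap.comp_apply,
    ContinuousLinearMap.flip_apply, map_sub, e]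
  ring

theorem contDiff_of_mem_layer {k : ℕ} {X : (Fin n → ℝ) → (Fin n → ℝ)} (hX : X ∈ G.layer k) :
    ContDiff ℝ ∞ X := by
  refine Submodule.span_induction ?_ contDiff_const (fun X Y _ _ => ContDiff.add)
    (fun c X _ => contDiff_const.smul) hX
  rintro X ⟨i, -, rfl⟩
  exact G.contDiff_leftInvField i

theorem derivVanishes_zero (w : (Fin n → ℝ) → ℝ) : DerivVanishes w 0 := by
  intro θ _ _; simp

theorem derivVanishes_of_mem_span {w : (Fin n → ℝ) → ℝ} (hw : Continuous w)
    {S : Set ((Fin n → ℝ) → (Fin n → ℝ))} (hS : ∀ X ∈ S, DerivVanishes w X ∧ ContDiff ℝ ∞ X)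
    {X : (Fin n → ℝ) → (Fin n → ℝ)} (hX : X ∈ Submodule.span ℝ S) : DerivVanishes w X :=
  (Submodule.span_induction (p := fun X _ => DerivVanishes w X ∧ ContDiff ℝ ∞ X)
    hS ⟨derivVanishes_zero w, contDiff_const⟩
    (fun _ _ _ _ hX hY => ⟨hX.1.add hw hY.1 hX.2 hY.2, hX.2.add hY.2⟩)
    (fun c _ _ hX => ⟨hX.1.smul c, contDiff_const.smul hX.2⟩) hX).1

/-- Induction on the layer: stratification presents each further layer as spanned by brackets with
the first. -/
theorem derivVanishes_of_mem_layer {G : CarnotGroup n} {w : (Fin n → ℝ) → ℝ} (hw : Continuous w)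
    (h : ∀ j : G.HorizontalIndex, DerivVanishes w (G.leftInvField j.1)) (k : ℕ) :
    ∀ X ∈ G.layer (k + 1), DerivVanishes w X := by
  have hone : ∀ X ∈ G.layer 1, DerivVanishes w X := fun X hX =>
    derivVanishes_of_mem_span hw (by
      rintro X ⟨i, hi, rfl⟩
      exact ⟨h ⟨i, hi⟩, G.contDiff_leftInvField i⟩) hX
  induction k with
  | zero => exact hone
  | succ k ih =>
    intro X hX
    rw [← G.stratified (k + 1) (by omega)] at hX
    refine derivVanishes_of_mem_span hw ?_ hX
    rintro Z ⟨X, hX, Y, hY, rfl⟩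
    have hXs := contDiff_of_mem_layer hX
    have hYs := contDiff_of_mem_layer hY
    refine ⟨(hone X hX).lieBracket hw (ih Y hY) hXs hYs, ?_⟩
    exact ((hYs.fderiv_right (m := ∞) (by simp)).clm_apply hXs).sub
      ((hXs.fderiv_right (m := ∞) (by simp)).clm_apply hYs)

/-- Differentiating `θ` along right translations in a direction `z` is differentiating a translate
of `θ` along a left-invariant field. -/
theorem fderiv_mul_apply_eq {θ : (Fin n → ℝ) → ℝ} (hθ : Differentiable ℝ θ)
    (x a z : Fin n → ℝ) :
    fderiv ℝ θ (G.mul x a) (fderiv ℝ (G.mul x) a z) =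
      fderiv ℝ (fun y => θ (G.mul y a)) x
        (fderiv ℝ (G.mul x) 0 (fderiv ℝ (fun y => G.mul y (G.inv a)) a z)) := by
  have hl : HasDerivAt (fun s : ℝ => a + s • z) z 0 := by
    simpa using ((hasDerivAt_id (0 : ℝ)).smul_const z).const_add a
  have hc : HasDerivAt (fun s : ℝ => G.mul (a + s • z) (G.inv a))
      (fderiv ℝ (fun y => G.mul y (G.inv a)) a z) 0 := by
    have h1 : HasFDerivAt (fun y => G.mul y (G.inv a)) (fderiv ℝ (fun y => G.mul y (G.inv a)) a)
        (a + (0 : ℝ) • z) := by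
      rw [zero_smul, add_zero]
      exact (((G.contDiff_mul_right _).differentiable (by simp)).differentiableAt).hasFDerivAt
    exact h1.comp_hasDerivAt 0 hl
  have hd : DifferentiableAt ℝ (fun y => θ (G.mul y a)) x :=
    (hθ.comp ((G.contDiff_mul_right a).differentiable (by simp))).differentiableAt
  have h2 := hasDerivAt_comp_mul (G := G) hd hc (by simp [G.mul_inv])
  have h3 : HasDerivAt (fun s : ℝ => θ (G.mul x (a + s • z)))
      (fderiv ℝ θ (G.mul x a) (fderiv ℝ (G.mul x) a z)) 0 := by
    have h4 : HasFDerivAt (G.mul x) (fderiv ℝ (G.mul x) a) (a + (0 : ℝ) • z) := by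
      rw [zero_smul, add_zero]
      exact (((G.contDiff_mul_left x).differentiable (by simp)).differentiableAt).hasFDerivAt
    have h5 := h4.comp_hasDerivAt 0 hl
    have h6 : HasFDerivAt θ (fderiv ℝ θ (G.mul x a))
        ((G.mul x ∘ fun s : ℝ => a + s • z) 0) := by
      simp only [Function.comp_apply, zero_smul, add_zero]
      exact hθ.differentiableAt.hasFDerivAt
    exact h6.comp_hasDerivAt 0 h5
  refine h3.unique (h2.congr_of_eventuallyEq (Eventually.of_forall fun s => ?_))
  simp only [G.mul_assoc, G.inv_mul, G.mul_zero]

/-- Along `s ↦ s z` the integral has zero derivative: differentiating `θ (x ∘ s z)` amounts to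
applying one left-invariant field, independent of `x`, to the translate of `θ`, and `w` annihilates
every such field. -/
theorem integral_mul_comp_mul_eq {w : (Fin n → ℝ) → ℝ} (hw : Continuous w)
    (h : ∀ i : Fin n, DerivVanishes w (G.leftInvField i)) {θ : (Fin n → ℝ) → ℝ}
    (hθ : ContDiff ℝ ∞ θ) (hc : HasCompactSupport θ) (z : Fin n → ℝ) :
    ∫ x, w x * θ (G.mul x z) = ∫ x, w x * θ x := by
  have hvan : ∀ (b : Fin n → ℝ) (η : (Fin n → ℝ) → ℝ), ContDiff ℝ ∞ η → HasCompactSupport η →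
      ∫ x, w x * fderiv ℝ η x (fderiv ℝ (G.mul x) 0 b) = 0 := by
    intro b η hη hηc
    have e : ∀ x, w x * fderiv ℝ η x (fderiv ℝ (G.mul x) 0 b) =
        ∑ i, b i * (w x * fderiv ℝ η x (G.leftInvField i x)) := by
      intro x
      conv_lhs => rw [pi_eq_sum_univ' b]
      simp only [map_sum, map_smul, smul_eq_mul, Finset.mul_sum]
      refine Finset.sum_congr rfl fun i _ => ?_
      rw [leftInvField]
      ring
    simp_rw [e]
    rw [integral_finsetSum]
    · refine Finset.sum_eq_zero fun i _ => ?_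
      rw [integral_const_mul, h i η hη hηc, MulZeroClass.mul_zero]
    · exact fun i _ => (integrable_mul_fderiv_apply hw hη hηc
        (G.contDiff_leftInvField i)).const_mul _
  have hθd := hθ.differentiable (by simp)
  let F' : ℝ → (Fin n → ℝ) → ℝ := fun s x =>
    w x * fderiv ℝ θ (G.mul x (s • z)) (fderiv ℝ (G.mul x) (s • z) z)
  have hF'c : Continuous fun p : ℝ × (Fin n → ℝ) => F' p.1 p.2 := by
    have h1 : ContDiff ℝ ∞ (fun p : ℝ × (Fin n → ℝ) => fderiv ℝ (G.mul p.2) (p.1 • z)) := by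
      refine ContDiff.fderiv (m := ∞) (n := ∞) (f := fun (p : ℝ × (Fin n → ℝ)) y => G.mul p.2 y)
        (g := fun p => p.1 • z) ?_ (by fun_prop) (by simp)
      exact G.contDiff_mul.comp ((contDiff_snd.comp contDiff_fst).prodMk contDiff_snd)
    have h2 : Continuous fun p : ℝ × (Fin n → ℝ) => G.mul p.2 (p.1 • z) :=
      G.continuous_mul.comp (continuous_snd.prodMk (by fun_prop))
    exact (hw.comp continuous_snd).mul
      (((hθ.continuous_fderiv (by simp)).comp h2).clm_apply (h1.continuous.clm_apply continuous_const))
  have hθs : ∀ s : ℝ, ContDiff ℝ ∞ fun x => θ (G.mul x (s • z)) := fun s =>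
    hθ.comp (G.contDiff_mul_right _)
  have hθc : ∀ s : ℝ, HasCompactSupport fun x => θ (G.mul x (s • z)) := fun s =>
    hc.comp_homeomorph (G.mulRightHomeomorph _)
  have hder : ∀ s : ℝ, HasDerivAt (fun s : ℝ => ∫ x, w x * θ (G.mul x (s • z))) 0 s := by
    intro s
    -- This compact set contains the supports of all the `s'`-derivatives with `|s' - s| < 1`, which
    -- provides the dominating function.
    set K := (fun p : (Fin n → ℝ) × ℝ => G.mul p.1 (G.inv (p.2 • z))) ''
      (tsupport θ ×ˢ Metric.closedBall s 1) with hKdef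
    have hK : IsCompact K := by
      refine (IsCompact.prod hc (isCompact_closedBall s 1)).image ?_
      exact G.continuous_mul.comp (continuous_fst.prodMk
        (G.continuous_inv.comp (by fun_prop)))
    have hout : ∀ x, x ∉ K → ∀ s' ∈ Metric.ball s 1, F' s' x = 0 := by
      intro x hx s' hs'
      have : G.mul x (s' • z) ∉ tsupport θ := fun hmem =>
        hx ⟨(_, s'), ⟨hmem, Metric.ball_subset_closedBall hs'⟩, G.mul_inv_cancel_right x _⟩
      have h0 : fderiv ℝ θ (G.mul x (s' • z)) = 0 :=
        image_eq_zero_of_notMem_tsupport fun h' => this (tsupport_fderiv_subset ℝ h')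
      simp [F', h0]
    obtain ⟨M, hM⟩ := ((isCompact_closedBall s 1).prod hK).exists_bound_of_continuousOn
      hF'c.continuousOn
    have := hasDerivAt_integral_of_dominated_loc_of_deriv_le (μ := (volume : Measure (Fin n → ℝ)))
      (F := fun s x => w x * θ (G.mul x (s • z))) (F' := F') (x₀ := s)
      (s := Metric.ball s 1) (bound := K.indicator fun _ => M)
      (Metric.ball_mem_nhds s one_pos)
      (Eventually.of_forall fun s' => (hw.mul (hθs s').continuous).aestronglyMeasurable)
      ((hw.mul (hθs s).continuous).integrable_of_hasCompactSupport (hθc s).mul_left)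
      (hF'c.comp (continuous_const.prodMk continuous_id)).aestronglyMeasurable
      (Eventually.of_forall fun x s' hs' => by
        by_cases hx : x ∈ K
        · rw [Set.indicator_of_mem hx]
          exact hM (s', x) ⟨Metric.ball_subset_closedBall hs', hx⟩
        · rw [Set.indicator_of_notMem hx, hout x hx s' hs', norm_zero])
      ((integrable_indicator_iff hK.measurableSet).2 (integrableOn_const hK.measure_lt_top.ne))
      (Eventually.of_forall fun x s' _ => by
        have hl : HasDerivAt (fun s : ℝ => s • z) z s' := by
          simpa using (hasDerivAt_id s').smul_const z
        have h4 : HasFDerivAt (G.mul x) (fderiv ℝ (G.mul x) (s' • z)) (s' • z) :=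
          (((G.contDiff_mul_left x).differentiable (by simp)).differentiableAt).hasFDerivAt
        have h5 := h4.comp_hasDerivAt s' hl
        have h6 : HasFDerivAt θ (fderiv ℝ θ (G.mul x (s' • z)))
            ((G.mul x ∘ fun s : ℝ => s • z) s') := hθd.differentiableAt.hasFDerivAt
        exact (h6.comp_hasDerivAt s' h5).const_mul (w x))
    have h7 : ∫ x, F' s x = 0 := by
      have h8 := hvan (fderiv ℝ (fun y => G.mul y (G.inv (s • z))) (s • z) z) _ (hθs s) (hθc s)
      rw [← h8]
      congr 1; ext x
      simp only [F']
      rw [fderiv_mul_apply_eq hθd]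
    rw [← h7]
    exact this.2
  have hconst := is_const_of_deriv_eq_zero (fun s => (hder s).differentiableAt)
    (fun s => (hder s).deriv) 1 0
  simpa [G.mul_zero] using hconst

/-- Connectedness by horizontal curves, in weak form. -/
theorem eq_of_derivVanishes {G : CarnotGroup n} {w : (Fin n → ℝ) → ℝ} (hw : Continuous w)
    (h : ∀ j : G.HorizontalIndex, DerivVanishes w (G.leftInvField j.1)) (x : Fin n → ℝ) :
    w x = w 0 := by
  have hall : ∀ i, DerivVanishes w (G.leftInvField i) := fun i => by
    have hi := G.weight_pos i
    refine derivVanishes_of_mem_layer hw h (G.weight i - 1) _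
      (Submodule.subset_span ⟨i, by omega, rfl⟩)
  have hwc : Continuous fun y => w (G.mul y (G.inv x)) :=
    hw.comp (G.contDiff_mul_right _).continuous
  -- The functions `w (· ∘ x⁻¹)` and `w` have equal integrals against all tests, so by continuity
  -- they coincide; at the point `x` this reads `w 0 = w x`.
  have hae := ae_eq_of_integral_contDiff_smul_eq (μ := (volume : Measure (Fin n → ℝ)))
    hwc.locallyIntegrable hw.locallyIntegrable (fun θ hθ hc => by
      simp only [smul_eq_mul, mul_comm (θ _)]
      rw [← integral_mul_comp_mul_eq hw hall hθ hc x,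
        ← G.integral_comp_mul_right x (fun y => w (G.mul y (G.inv x)) * θ y)]
      simp only [G.mul_inv_cancel_right])
  have := congrFun ((hwc.ae_eq_iff_eq volume hw).1 hae) x
  simpa [G.mul_inv] using this.symm

end HomogeneousGroup

/-! ### One-variable cutoffs -/

theorem hasDerivAt_max_zero_pow (m : ℕ) (x : ℝ) :
    HasDerivAt (fun x : ℝ => max x 0 ^ (m + 2)) ((m + 2) * max x 0 ^ (m + 1)) x := by
  rcases lt_trichotomy x 0 with hx | rfl | hx
  · rw [max_eq_right hx.le, zero_pow (by omega), mul_zero]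
    refine (hasDerivAt_const x (0 : ℝ)).congr_of_eventuallyEq ?_
    filter_upwards [gt_mem_nhds hx] with y hy
    rw [max_eq_right hy.le, zero_pow (by omega)]
  · rw [max_self, zero_pow (by omega), mul_zero, hasDerivAt_iff_isLittleO]
    have h1 : (fun y : ℝ => max y 0) =O[𝓝 0] fun y : ℝ => y :=
      Asymptotics.IsBigO.of_bound 1 (Eventually.of_forall fun y => by
        rw [one_mul, Real.norm_eq_abs, Real.norm_eq_abs, abs_of_nonneg (le_max_right _ _)]
        exact max_le (le_abs_self y) (abs_nonneg y))
    have h2 : (fun y : ℝ => max y 0 ^ (m + 1)) =o[𝓝 0] fun _ : ℝ => (1 : ℝ) := by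
      rw [Asymptotics.isLittleO_one_iff]
      have : Continuous fun y : ℝ => max y 0 ^ (m + 1) := by fun_prop
      simpa using this.tendsto 0
    have := h1.mul_isLittleO h2
    simpa [pow_succ, mul_comm, mul_left_comm] using this
  · rw [max_eq_left hx.le]
    have h := hasDerivAt_pow (m + 2) x
    simp only [Nat.cast_add, Nat.cast_ofNat, show m + 2 - 1 = m + 1 by omega] at h
    refine h.congr_of_eventuallyEq ?_
    filter_upwards [lt_mem_nhds hx] with y hy
    rw [max_eq_left hy.le]

theorem contDiff_max_zero_pow (m : ℕ) : ContDiff ℝ 1 fun x : ℝ => max x 0 ^ (m + 2) := by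
  rw [contDiff_one_iff_deriv]
  refine ⟨fun x => (hasDerivAt_max_zero_pow m x).differentiableAt, ?_⟩
  have : deriv (fun x : ℝ => max x 0 ^ (m + 2)) = fun x => ((m : ℝ) + 2) * max x 0 ^ (m + 1) :=
    funext fun x => (hasDerivAt_max_zero_pow m x).deriv
  rw [this]
  fun_prop

/-- A `C¹` variant of `s ↦ s ^ k` that vanishes for `s ≤ ε`. -/
def cutPow (k ε s : ℝ) : ℝ := s ^ (k - 2) * max (s - ε) 0 ^ 2

section cutPow

variable {k ε s : ℝ}

theorem cutPow_eq_zero (hs : s ≤ ε) : cutPow k ε s = 0 := by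
  rw [cutPow, max_eq_right (by linarith)]; simp

theorem cutPow_pos (hε : 0 < ε) (hs : ε < s) : 0 < cutPow k ε s := by
  rw [cutPow, max_eq_left (by linarith)]
  have h1 : 0 < s := hε.trans hs
  have h2 : 0 < s - ε := by linarith
  positivity

theorem cutPow_nonneg (hε : 0 < ε) : 0 ≤ cutPow k ε s := by
  rcases le_or_gt s ε with h | h
  · rw [cutPow_eq_zero h]
  · exact (cutPow_pos hε h).le

theorem cutPow_le (hε : 0 < ε) (hs : 0 < s) : cutPow k ε s ≤ s ^ k := by
  have h1 : max (s - ε) 0 ≤ s := max_le (by linarith) hs.le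
  calc cutPow k ε s ≤ s ^ (k - 2) * s ^ 2 := by
        unfold cutPow
        gcongr
    _ = s ^ k := by
        rw [← Real.rpow_natCast s 2, ← Real.rpow_add hs]; norm_num

theorem contDiff_cutPow (hε : 0 < ε) : ContDiff ℝ 1 (cutPow k ε) := by
  refine contDiff_iff_contDiffAt.2 fun s => ?_
  rcases lt_or_ge s ε with h | h
  · refine (contDiffAt_const (c := (0 : ℝ))).congr_of_eventuallyEq ?_
    filter_upwards [gt_mem_nhds h] with y hy using cutPow_eq_zero hy.le
  · have hs : s ≠ 0 := (hε.trans_le h).ne'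
    exact (Real.contDiffAt_rpow_const_of_ne hs).mul
      (((contDiff_max_zero_pow 0).comp (contDiff_id.sub contDiff_const)).contDiffAt)

/-- The derivative inequality of the pure power `s^k` survives truncation, because `max (s - ε) 0 ≤
s`. It provides the favourable gradient term. -/
theorem le_deriv_cutPow (hε : 0 < ε) (hs : 0 < s) :
    k * cutPow k ε s / s ≤ deriv (cutPow k ε) s := by
  have h1 := Real.hasDerivAt_rpow_const (x := s) (p := k - 2) (Or.inl hs.ne')
  have h2 := (hasDerivAt_max_zero_pow 0 (s - ε)).comp_sub_const s ε
  have h3 := h1.mul h2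
  have h4 : deriv (cutPow k ε) s = (k - 2) * s ^ (k - 2 - 1) * max (s - ε) 0 ^ 2 +
      s ^ (k - 2) * (2 * max (s - ε) 0) := by
    have := h3.deriv
    norm_num at this
    exact this
  have h5 : s ^ (k - 2) = s ^ (k - 2 - 1) * s := by
    rw [← Real.rpow_add_one hs.ne']; ring_nf
  rw [h4, cutPow, h5]
  set e := max (s - ε) 0
  have he0 : 0 ≤ e := le_max_right _ _
  have he : e ≤ s := max_le (by linarith) hs.le
  have hp : 0 ≤ s ^ (k - 2 - 1) := by positivity
  have h6 : k * (s ^ (k - 2 - 1) * s * e ^ 2) / s = k * s ^ (k - 2 - 1) * e ^ 2 := by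
    field_simp
  rw [h6]
  have h7 : 0 ≤ s ^ (k - 2 - 1) * e * (s - e) := by
    have : 0 ≤ s - e := by linarith
    positivity
  nlinarith

end cutPow

/-- A `C¹` truncation from below of `log (ρ / ρ₀)`. -/
def logCut (ρ₀ ρ : ℝ) : ℝ := Real.log (max ρ ρ₀ / ρ₀) + ρ₀ / max ρ ρ₀ - 1

section logCut

variable {ρ₀ ρ : ℝ}

theorem logCut_eq_zero (h0 : 0 < ρ₀) (h : ρ ≤ ρ₀) : logCut ρ₀ ρ = 0 := by
  rw [logCut, max_eq_right h, div_self h0.ne', Real.log_one]; ring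

theorem le_logCut (h0 : 0 < ρ₀) (h : ρ₀ ≤ ρ) : Real.log (ρ / ρ₀) - 1 ≤ logCut ρ₀ ρ := by
  rw [logCut, max_eq_left h]
  have : 0 < ρ₀ / ρ := div_pos h0 (h0.trans_le h)
  linarith

/-- The correction `ρ₀ / ρ - 1` cancels the slope of the logarithm at `ρ₀`, so the two pieces join
in a `C¹` way, while the derivative stays at most `1 / ρ` beyond. -/
theorem hasDerivAt_logCut (h0 : 0 < ρ₀) (ρ : ℝ) :
    HasDerivAt (logCut ρ₀) (1 / max ρ ρ₀ - ρ₀ / max ρ ρ₀ ^ 2) ρ := by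
  have key : ∀ y, 0 < y → HasDerivAt (fun y => Real.log (y / ρ₀) + ρ₀ / y - 1)
      (1 / y - ρ₀ / y ^ 2) y := by
    intro y hy
    have h1 := ((hasDerivAt_id y).div_const ρ₀).log (by simp only [id]; positivity)
    have h2 := (hasDerivAt_inv hy.ne').const_mul ρ₀
    convert! (h1.add h2).sub_const 1 using 1
    · simp only [id]; field_simp; ring
  rcases lt_trichotomy ρ ρ₀ with h | rfl | h
  · rw [max_eq_right h.le]
    have e : 1 / ρ₀ - ρ₀ / ρ₀ ^ 2 = 0 := by field_simp; ring
    rw [e]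
    refine (hasDerivAt_const ρ (0 : ℝ)).congr_of_eventuallyEq ?_
    filter_upwards [gt_mem_nhds h] with y hy using logCut_eq_zero h0 hy.le
  · rw [max_self]
    have e : 1 / ρ - ρ / ρ ^ 2 = 0 := by field_simp; ring
    have h1 : HasDerivWithinAt (logCut ρ) 0 (Set.Iic ρ) ρ :=
      (hasDerivWithinAt_const ρ _ (0 : ℝ)).congr (fun y hy => logCut_eq_zero h0 hy)
        (logCut_eq_zero h0 le_rfl)
    have h2 : HasDerivWithinAt (logCut ρ) 0 (Set.Ici ρ) ρ := by
      have := (key ρ h0).hasDerivWithinAt (s := Set.Ici ρ)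
      rw [e] at this
      refine this.congr (fun y hy => ?_) ?_
      · rw [logCut, max_eq_left hy]
      · rw [logCut, max_self]
    rw [e]
    have := h1.union h2
    rwa [Set.Iic_union_Ici, hasDerivWithinAt_univ] at this
  · rw [max_eq_left h.le]
    refine (key ρ (h0.trans h)).congr_of_eventuallyEq ?_
    filter_upwards [lt_mem_nhds h] with y hy
    rw [logCut, max_eq_left hy.le]

theorem continuous_deriv_logCut_aux (h0 : 0 < ρ₀) :
    Continuous fun ρ : ℝ => 1 / max ρ ρ₀ - ρ₀ / max ρ ρ₀ ^ 2 := by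
  have h : ∀ ρ : ℝ, max ρ ρ₀ ≠ 0 := fun ρ => (h0.trans_le (le_max_right _ _)).ne'
  have h' : ∀ ρ : ℝ, max ρ ρ₀ ^ 2 ≠ 0 := fun ρ => pow_ne_zero _ (h ρ)
  fun_prop (disch := assumption)

theorem contDiff_logCut (h0 : 0 < ρ₀) : ContDiff ℝ 1 (logCut ρ₀) := by
  rw [contDiff_one_iff_deriv]
  refine ⟨fun ρ => (hasDerivAt_logCut h0 ρ).differentiableAt, ?_⟩
  rw [show deriv (logCut ρ₀) = _ from funext fun ρ => (hasDerivAt_logCut h0 ρ).deriv]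
  exact continuous_deriv_logCut_aux h0

theorem deriv_logCut_nonneg (h0 : 0 < ρ₀) (ρ : ℝ) : 0 ≤ deriv (logCut ρ₀) ρ := by
  rw [(hasDerivAt_logCut h0 ρ).deriv]
  have h1 : 0 < max ρ ρ₀ := h0.trans_le (le_max_right _ _)
  have h2 : ρ₀ ≤ max ρ ρ₀ := le_max_right _ _
  have : 1 / max ρ ρ₀ - ρ₀ / max ρ ρ₀ ^ 2 = (max ρ ρ₀ - ρ₀) / max ρ ρ₀ ^ 2 := by
    field_simp
  rw [this]
  exact div_nonneg (by linarith) (by positivity)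

theorem deriv_logCut_le (h0 : 0 < ρ₀) (h : ρ₀ ≤ ρ) : deriv (logCut ρ₀) ρ ≤ 1 / ρ := by
  rw [(hasDerivAt_logCut h0 ρ).deriv, max_eq_left h]
  have : 0 ≤ ρ₀ / ρ ^ 2 := by positivity
  linarith

theorem deriv_logCut_eq_zero (h0 : 0 < ρ₀) (h : ρ ≤ ρ₀) : deriv (logCut ρ₀) ρ = 0 := by
  rw [(hasDerivAt_logCut h0 ρ).deriv, max_eq_right h]
  field_simp; ring

theorem logCut_nonneg (h0 : 0 < ρ₀) (ρ : ℝ) : 0 ≤ logCut ρ₀ ρ := by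
  rcases le_or_gt ρ ρ₀ with h | h
  · rw [logCut_eq_zero h0 h]
  · rw [← logCut_eq_zero h0 le_rfl]
    exact monotone_of_deriv_nonneg ((contDiff_logCut h0).differentiable (by simp))
      (deriv_logCut_nonneg h0) h.le

end logCut

/-- A `C¹` radial weight: constant for `ρ ≤ ρ₀`, decaying like `ρ ^ (-b)`, and cut off
logarithmically at scale `L`. -/
def radialCut (ρ₀ b : ℝ) (N : ℕ) (L ρ : ℝ) : ℝ :=
  Real.exp (-b * logCut ρ₀ ρ) * max (1 - logCut ρ₀ ρ / L) 0 ^ N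

section radialCut

variable {ρ₀ b L ρ : ℝ} {m : ℕ}

theorem contDiff_radialCut (h0 : 0 < ρ₀) : ContDiff ℝ 1 (radialCut ρ₀ b (m + 2) L) := by
  have h := contDiff_logCut h0
  refine (Real.contDiff_exp.comp (contDiff_const.mul h)).mul ?_
  exact (contDiff_max_zero_pow m).comp (contDiff_const.sub (h.div_const L))

theorem radialCut_of_le (h0 : 0 < ρ₀) (h : ρ ≤ ρ₀) : radialCut ρ₀ b m L ρ = 1 := by
  rw [radialCut, logCut_eq_zero h0 h]; simp

theorem radialCut_nonneg : 0 ≤ radialCut ρ₀ b m L ρ := by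
  unfold radialCut
  have : 0 ≤ max (1 - logCut ρ₀ ρ / L) 0 := le_max_right _ _
  positivity

theorem deriv_radialCut (h0 : 0 < ρ₀) :
    deriv (radialCut ρ₀ b (m + 2) L) ρ = -(deriv (logCut ρ₀) ρ *
      (Real.exp (-b * logCut ρ₀ ρ) * (b * max (1 - logCut ρ₀ ρ / L) 0 ^ (m + 2) +
        (m + 2) / L * max (1 - logCut ρ₀ ρ / L) 0 ^ (m + 1)))) := by
  have h := ((contDiff_logCut h0).differentiable (by simp)).differentiableAt (x := ρ) |>.hasDerivAt
  have h1 := (h.const_mul (-b)).exp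
  have h2 := (hasDerivAt_max_zero_pow m (1 - logCut ρ₀ ρ / L)).comp ρ
    ((h.div_const L).const_sub 1)
  have := (h1.mul h2).deriv
  change deriv (radialCut ρ₀ b (m + 2) L) ρ = _ at this
  rw [this]
  simp only [Function.comp_apply]
  ring

/-- Monotonicity in `L` lets a bound obtained for large `L'` control the integral at a fixed `L`. -/
theorem radialCut_mono {L' : ℝ} (h0 : 0 < ρ₀) (hL : 0 < L) (hLL : L ≤ L') :
    radialCut ρ₀ b m L ρ ≤ radialCut ρ₀ b m L' ρ := by
  unfold radialCut
  have h1 := logCut_nonneg h0 ρ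
  have h2 : logCut ρ₀ ρ / L' ≤ logCut ρ₀ ρ / L := div_le_div_of_nonneg_left h1 hL hLL
  have h3 : max (1 - logCut ρ₀ ρ / L) 0 ≤ max (1 - logCut ρ₀ ρ / L') 0 :=
    max_le_max (by linarith) le_rfl
  have h4 : 0 ≤ max (1 - logCut ρ₀ ρ / L) 0 := le_max_right _ _
  gcongr

theorem radialCut_eq_zero (h0 : 0 < ρ₀) (hL : 0 < L) (h : ρ₀ * Real.exp (L + 1) ≤ ρ) :
    radialCut ρ₀ b (m + 1) L ρ = 0 := by
  have h1 : ρ₀ ≤ ρ := by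
    have : 1 ≤ Real.exp (L + 1) := Real.one_le_exp (by linarith)
    nlinarith
  have h2 := le_logCut h0 h1
  have h3 : L + 1 ≤ Real.log (ρ / ρ₀) := by
    rw [Real.le_log_iff_exp_le (by have := h0.trans_le h1; positivity), le_div_iff₀ h0]
    linarith
  have h4 : 1 ≤ logCut ρ₀ ρ / L := by rw [le_div_iff₀ hL]; linarith
  rw [radialCut, max_eq_right (by linarith)]; simp

theorem exp_logCut_le (h0 : 0 < ρ₀) (hb : 0 ≤ b) (h : ρ₀ ≤ ρ) :
    Real.exp (-b * logCut ρ₀ ρ) ≤ Real.exp b * ρ₀ ^ b * ρ ^ (-b) := by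
  have hρ := h0.trans_le h
  have h1 := le_logCut h0 h
  rw [Real.log_div hρ.ne' h0.ne'] at h1
  rw [Real.rpow_def_of_pos h0, Real.rpow_def_of_pos hρ, ← Real.exp_add, ← Real.exp_add,
    Real.exp_le_exp]
  nlinarith

end radialCut

/-! ### Convexity inequalities -/

theorem one_sub_mul_le_rpow_neg {q s : ℝ} (hq : 0 ≤ q) (hs : 0 < s) :
    1 - q * (s - 1) ≤ s ^ (-q) := by
  rw [Real.rpow_def_of_pos hs]
  have h1 := Real.add_one_le_exp (Real.log s * -q)
  have h2 := Real.log_le_sub_one_of_pos hs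
  nlinarith

/-- The tangent line at `T` to the convex function `τ ↦ K τ ^ (-q)`. -/
theorem tangent_le_mul_rpow_neg {q K T τ : ℝ} (hq : 0 ≤ q) (hK : 0 ≤ K) (hT : 0 < T)
    (hτ : 0 < τ) :
    K * T ^ (-q) * (1 + q) - q * (K * T ^ (-q)) / T * τ ≤ K * τ ^ (-q) := by
  have h1 := one_sub_mul_le_rpow_neg hq (div_pos hτ hT)
  rw [Real.div_rpow hτ.le hT.le, le_div_iff₀ (by positivity)] at h1
  calc _ = K * ((1 - q * (τ / T - 1)) * T ^ (-q)) := by field_simp; ring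
    _ ≤ _ := by gcongr

/-! ### Volume growth and integrability at infinity -/

namespace HomogeneousGroup.HomogeneousNorm

variable {n : ℕ} {G : HomogeneousGroup n} (r : G.HomogeneousNorm)

theorem volume_le_pow (j : ℕ) (ρ : ℝ) :
    volume {x | r x ≤ 2 ^ j * ρ} ≤
      ENNReal.ofReal ((2 ^ j) ^ G.homDim) * volume {x | r x ≤ ρ} := by
  have h2 : (0 : ℝ) < 2 ^ j := by positivity
  have hsub : {x | r x ≤ 2 ^ j * ρ} ⊆ dilationCLM G.weight (2 ^ j) '' {x | r x ≤ ρ} := by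
    intro x hx
    refine ⟨dilation G.weight (2 ^ j)⁻¹ x, ?_, ?_⟩
    · have hx' : r x ≤ 2 ^ j * ρ := hx
      change r _ ≤ ρ
      rw [r.map_dilation _ (by positivity), inv_mul_le_iff₀ h2]
      exact hx'
    · rw [dilationCLM_apply, dilation_dilation, mul_inv_cancel₀ h2.ne', dilation_one]
  refine (measure_mono hsub).trans ?_
  have hdet := det_dilationCLM G.weight (2 ^ j)
  rw [ContinuousLinearMap.det] at hdet
  rw [Measure.addHaar_image_continuousLinearMap, hdet, abs_of_pos (by positivity)]
  rfl

/-- On the dyadic shell `r ~ 2^j ρ₀` the volume grows like `2^(jQ)`, so its contribution is of order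
`2^(-jδ)` and the sum is geometric. -/
theorem integrableOn_rpow {ρ₀ δ : ℝ} (h0 : 0 < ρ₀) (hδ : 0 < δ) :
    IntegrableOn (fun x => r x ^ (-((G.homDim : ℝ) + δ))) {x | ρ₀ ≤ r x} volume := by
  set s : ℝ := (G.homDim : ℝ) + δ with hs
  have hs0 : 0 < s := by positivity
  have hmeas : Measurable fun x => r x ^ (-s) := r.continuous_toFun.measurable.pow_const _
  refine ⟨hmeas.aestronglyMeasurable, ?_⟩
  rw [hasFiniteIntegral_iff_ofReal (Eventually.of_forall fun x =>
    Real.rpow_nonneg (r.nonneg x) _)]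
  let S : ℕ → Set (Fin n → ℝ) := fun j => {x | 2 ^ j * ρ₀ ≤ r x ∧ r x ≤ 2 ^ j * (2 * ρ₀)}
  have hcover : {x | ρ₀ ≤ r x} ⊆ ⋃ j, S j := by
    intro x hx
    have hx' : ρ₀ ≤ r x := hx
    obtain ⟨j, hj1, hj2⟩ := exists_nat_pow_near ((one_le_div h0).2 hx') (one_lt_two)
    refine Set.mem_iUnion.2 ⟨j, ?_, ?_⟩
    · rwa [le_div_iff₀ h0] at hj1
    · rw [div_lt_iff₀ h0, pow_succ] at hj2
      linarith
  have hSm : ∀ j, MeasurableSet (S j) := fun j =>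
    (measurableSet_le measurable_const r.continuous_toFun.measurable).inter
      (measurableSet_le r.continuous_toFun.measurable measurable_const)
  set V := volume.real {x | r x ≤ 2 * ρ₀} with hV
  have hVfin : volume {x | r x ≤ 2 * ρ₀} ≠ ⊤ := (r.isCompact_le _).measure_lt_top.ne
  have hVe : volume {x | r x ≤ 2 * ρ₀} = ENNReal.ofReal V := by
    rw [hV, ofReal_measureReal hVfin]
  have hterm : ∀ j, ∫⁻ x in S j, ENNReal.ofReal (r x ^ (-s)) ≤
      ENNReal.ofReal (ρ₀ ^ (-s) * V * ((2 : ℝ) ^ (-δ)) ^ j) := by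
    intro j
    have h2 : (0 : ℝ) < 2 ^ j := by positivity
    calc ∫⁻ x in S j, ENNReal.ofReal (r x ^ (-s))
        ≤ ∫⁻ x in S j, ENNReal.ofReal ((2 ^ j * ρ₀) ^ (-s)) := by
          refine setLIntegral_mono measurable_const fun x hx => ENNReal.ofReal_le_ofReal ?_
          exact Real.rpow_le_rpow_of_nonpos (by positivity) hx.1 (by linarith)
      _ = ENNReal.ofReal ((2 ^ j * ρ₀) ^ (-s)) * volume (S j) := by
          rw [setLIntegral_const]
      _ ≤ ENNReal.ofReal ((2 ^ j * ρ₀) ^ (-s)) *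
          (ENNReal.ofReal ((2 ^ j) ^ G.homDim) * ENNReal.ofReal V) := by
          gcongr
          rw [← hVe]
          exact (measure_mono fun x hx => hx.2).trans (r.volume_le_pow j (2 * ρ₀))
      _ = ENNReal.ofReal (ρ₀ ^ (-s) * V * ((2 : ℝ) ^ (-δ)) ^ j) := by
          rw [← ENNReal.ofReal_mul (by positivity), ← ENNReal.ofReal_mul (by positivity)]
          congr 1
          rw [Real.mul_rpow h2.le h0.le, ← Real.rpow_natCast (2 ^ j) G.homDim]
          have : ((2 : ℝ) ^ (-δ)) ^ j = (2 ^ j : ℝ) ^ (-s) * (2 ^ j : ℝ) ^ (G.homDim : ℝ) := by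
            rw [← Real.rpow_add h2, hs, ← Real.rpow_natCast, ← Real.rpow_natCast,
              ← Real.rpow_mul (by norm_num), ← Real.rpow_mul (by norm_num)]
            congr 1; ring
          rw [this]; ring
  have hsum : Summable fun j : ℕ => ρ₀ ^ (-s) * V * ((2 : ℝ) ^ (-δ)) ^ j :=
    (summable_geometric_of_lt_one (by positivity)
      (Real.rpow_lt_one_of_one_lt_of_neg one_lt_two (by linarith))).mul_left _
  calc ∫⁻ x in {x | ρ₀ ≤ r x}, ENNReal.ofReal (r x ^ (-s))
      ≤ ∫⁻ x in ⋃ j, S j, ENNReal.ofReal (r x ^ (-s)) := lintegral_mono_set hcover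
    _ ≤ ∑' j, ∫⁻ x in S j, ENNReal.ofReal (r x ^ (-s)) := lintegral_iUnion_le _ _
    _ ≤ ∑' j : ℕ, ENNReal.ofReal (ρ₀ ^ (-s) * V * ((2 : ℝ) ^ (-δ)) ^ j) :=
        ENNReal.tsum_le_tsum hterm
    _ < ⊤ := hsum.tsum_ofReal_lt_top

end HomogeneousGroup.HomogeneousNorm

/-! ### Pointwise lower bound for flux plus reaction -/

/-- In the region where the bracket is negative, the integrand is controlled by a power of `ρ`. -/
theorem mul_pow_le_rpow {p σ α k d Cφ CE c Λ Φ E η τ t ρ s : ℝ} {m : ℕ}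
    (hp : 1 < p) (hpm : p ≤ m + 2) (hα : 0 < α) (hk : 0 < k) (hCφ : 0 ≤ Cφ) (hCE : 0 ≤ CE)
    (hρ : 0 < ρ) (hs : 0 < s) (ht : 0 < t) (hτ : τ = t * ρ ^ (1 - σ))
    (hsα : s ≤ α * ρ ^ σ) (hΛ : Λ ≤ s ^ k) (hΦ0 : 0 ≤ Φ)
    (hΦ : Φ ≤ Cφ * t ^ (p - 1)) (hE : E ≤ CE * ρ ^ (-(d + σ * k))) (hE0 : 0 ≤ E)
    (hη0 : 0 ≤ η) (hη1 : η ≤ 1) (hητ : η * τ ≤ c) :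
    Λ * Φ * E / ρ * η ^ (m + 1) ≤
      α ^ k * Cφ * CE * c ^ (p - 1) * ρ ^ (-(d + 1 - (σ - 1) * (p - 1))) := by
  have hτ0 : 0 < τ := by rw [hτ]; positivity
  have h1 : Λ ≤ α ^ k * ρ ^ (σ * k) := by
    refine hΛ.trans ((Real.rpow_le_rpow hs.le hsα hk.le).trans_eq ?_)
    rw [Real.mul_rpow hα.le (by positivity), ← Real.rpow_mul hρ.le]
  have h2 : t = τ * ρ ^ (σ - 1) := by
    rw [hτ, mul_assoc, ← Real.rpow_add hρ]; simp
  have h3 : Φ ≤ Cφ * (τ ^ (p - 1) * ρ ^ ((σ - 1) * (p - 1))) := by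
    refine hΦ.trans_eq ?_
    rw [h2, Real.mul_rpow hτ0.le (by positivity), ← Real.rpow_mul hρ.le]
  -- Since `m + 1 ≥ p - 1` and `η ≤ 1`, the surplus power of the cutoff pairs with `τ^(p-1)`; only
  -- the product `η τ` is bounded, not `τ`.
  have h4 : η ^ (m + 1) ≤ η ^ (p - 1) := by
    rw [← Real.rpow_natCast η (m + 1)]
    rcases hη0.eq_or_lt with rfl | hpos
    · rw [Real.zero_rpow (by positivity), Real.zero_rpow (by linarith)]
    · exact Real.rpow_le_rpow_of_exponent_ge hpos hη1 (by push_cast; linarith)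
  have h5 : τ ^ (p - 1) * η ^ (m + 1) ≤ c ^ (p - 1) := by
    calc _ ≤ τ ^ (p - 1) * η ^ (p - 1) := by gcongr
      _ = (η * τ) ^ (p - 1) := by rw [Real.mul_rpow hη0 hτ0.le, mul_comm]
      _ ≤ _ := Real.rpow_le_rpow (by positivity) hητ (by linarith)
  have h6 : ρ ^ (-(d + 1 - (σ - 1) * (p - 1))) =
      ρ ^ (σ * k) * ρ ^ ((σ - 1) * (p - 1)) * ρ ^ (-(d + σ * k)) / ρ := by
    rw [← Real.rpow_add hρ, ← Real.rpow_add hρ, ← Real.rpow_sub_one hρ.ne']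
    congr 1; ring
  calc Λ * Φ * E / ρ * η ^ (m + 1)
      ≤ (α ^ k * ρ ^ (σ * k)) * (Cφ * (τ ^ (p - 1) * ρ ^ ((σ - 1) * (p - 1)))) *
        (CE * ρ ^ (-(d + σ * k))) / ρ * η ^ (m + 1) := by gcongr
    _ = (α ^ k * Cφ * CE * (ρ ^ (σ * k) * ρ ^ ((σ - 1) * (p - 1)) * ρ ^ (-(d + σ * k)) / ρ)) *
        (τ ^ (p - 1) * η ^ (m + 1)) := by ring
    _ ≤ (α ^ k * Cφ * CE * (ρ ^ (σ * k) * ρ ^ ((σ - 1) * (p - 1)) * ρ ^ (-(d + σ * k)) / ρ)) *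
        c ^ (p - 1) := by gcongr
    _ = _ := by rw [h6]; ring

/-- Here `σ` is the critical exponent, as `hexp` records. In the scale-invariant variable `τ` the
reaction term becomes exactly `K τ^(-q)`, and the growth bound on `s` gives `ρ t / s ≥ τ / α`, which
reduces everything to the scalar inequality `hkey`. -/
theorem bracket_ge {μ q σ α k d c₁ K τ t ρ s : ℝ} (hexp : 1 - μ = q * (σ - 1))
    (hα : 0 < α) (hk : 0 < k) (hρ : 0 < ρ) (hs : 0 < s) (ht : 0 < t)
    (hτ : τ = t * ρ ^ (1 - σ)) (hsα : s ≤ α * ρ ^ σ)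
    (hkey : ∀ τ : ℝ, 0 < τ → c₁ * τ + (d + σ * k) ≤ k / α * τ + K * τ ^ (-q)) :
    c₁ * τ ≤ k * (ρ * t / s) - (d + σ * k) + K * (ρ ^ (1 - μ) * t ^ (-q)) := by
  have hτ0 : 0 < τ := by rw [hτ]; positivity
  have h1 : τ / α ≤ ρ * t / s := by
    rw [div_le_div_iff₀ hα hs]
    calc τ * s ≤ τ * (α * ρ ^ σ) := by gcongr
      _ = (t * α) * (ρ ^ (1 - σ) * ρ ^ σ) := by rw [hτ]; ring
      _ = ρ * t * α := by
        rw [← Real.rpow_add hρ]; simp; ring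
  have h2 : ρ ^ (1 - μ) * t ^ (-q) = τ ^ (-q) := by
    rw [hτ, Real.mul_rpow ht.le (by positivity), ← Real.rpow_mul hρ.le, hexp, mul_comm]
    congr 2; ring
  have h3 := hkey τ hτ0
  rw [h2]
  have h4 : k / α * τ ≤ k * (ρ * t / s) := by
    calc k / α * τ = k * (τ / α) := by ring
      _ ≤ _ := by gcongr
  linarith

/-- All terms share the factor `X η^(m+1)`. The scalar inequality absorbs the decay rate `b` of the
weight and leaves `c₁ η τ - (m + 2) / L`, in which only the cutoff derivative is harmful. The result
is an integrable error of order `1 / L`. -/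
theorem integrand_ge {p μ q σ α k d Cφ CE c₁ K₁ K₂ Λ Λ' Φ E η D L β w t ρ s : ℝ} {m : ℕ}
    (hp : 1 < p) (hpm : p ≤ m + 2) (hexp : 1 - μ = q * (σ - 1)) (hσ : 0 ≤ σ) (hd : 0 < d)
    (hα : 0 < α) (hk : 0 < k) (hc₁ : 0 < c₁) (hCφ : 0 ≤ Cφ) (hCE : 0 ≤ CE)
    (hkey : ∀ τ : ℝ, 0 < τ → c₁ * τ + (d + σ * k) ≤ k / α * τ + K₂ * τ ^ (-q))
    (hρ : 0 < ρ) (hs : 0 < s) (ht : 0 < t)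
    (hsα : s ≤ α * ρ ^ σ) (hΛ0 : 0 ≤ Λ) (hΛ : Λ ≤ s ^ k) (hΛ' : k * Λ / s ≤ Λ') (hΦ0 : 0 ≤ Φ)
    (hΦ : Φ ≤ Cφ * t ^ (p - 1)) (hE : E ≤ CE * ρ ^ (-(d + σ * k))) (hE0 : 0 ≤ E)
    (hη0 : 0 ≤ η) (hη1 : η ≤ 1) (hD0 : 0 ≤ D) (hD : D ≤ 1 / ρ) (hL : 1 ≤ L)
    (hβ : K₂ * ρ ^ (-μ) ≤ K₁ * β) (hw : |w| ≤ t) :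
    -((m + 2) * (α ^ k * Cφ * CE * ((m + 2) / c₁) ^ (p - 1)) / L *
        ρ ^ (-(d + 1 - (σ - 1) * (p - 1)))) ≤
      Φ / t * (E * η ^ (m + 2) * Λ' * t ^ 2 + Λ * (-(D * (E * ((d + σ * k) * η ^ (m + 2) +
        (m + 2) / L * η ^ (m + 1))))) * w) + K₁ * β * (Φ * t ^ (-q)) * (Λ * (E * η ^ (m + 2))) := by
  set b := d + σ * k with hb
  have hb0 : 0 < b := by positivity
  have hL0 : 0 < L := by linarith
  set X := Λ * Φ * E / ρ with hX
  have hX0 : 0 ≤ X := by positivity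
  set τ := t * ρ ^ (1 - σ) with hτ
  have hτ0 : 0 < τ := by positivity
  have hbr := bracket_ge hexp hα hk hρ hs ht hτ hsα hkey
  have e1 : X * η ^ (m + 1) * (η * (k * (ρ * t / s))) ≤ Φ / t * (E * η ^ (m + 2) * Λ' * t ^ 2) := by
    calc _ = Φ / t * (E * η ^ (m + 2) * (k * Λ / s) * t ^ 2) := by
          rw [hX]; field_simp; ring
      _ ≤ _ := by gcongr
  have e2 : -(X * η ^ (m + 1) * (b * η + (m + 2) / L)) ≤ Φ / t *
      (Λ * (-(D * (E * (b * η ^ (m + 2) + (m + 2) / L * η ^ (m + 1))))) * w) := by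
    have h1 : Φ / t * (Λ * (D * (E * (b * η ^ (m + 2) + (m + 2) / L * η ^ (m + 1)))) * w) ≤
        Φ / t * (Λ * (1 / ρ * (E * (b * η ^ (m + 2) + (m + 2) / L * η ^ (m + 1)))) * t) := by
      have hwt : w ≤ t := (le_abs_self w).trans hw
      calc _ ≤ Φ / t * (Λ * (D * (E * (b * η ^ (m + 2) + (m + 2) / L * η ^ (m + 1)))) * t) := by
            gcongr
        _ ≤ _ := by gcongr
    have h2 : Φ / t * (Λ * (1 / ρ * (E * (b * η ^ (m + 2) + (m + 2) / L * η ^ (m + 1)))) * t) =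
        X * η ^ (m + 1) * (b * η + (m + 2) / L) := by
      rw [hX]; field_simp; ring
    have h3 : Φ / t * (Λ * (-(D * (E * (b * η ^ (m + 2) + (m + 2) / L * η ^ (m + 1))))) * w) =
        -(Φ / t * (Λ * (D * (E * (b * η ^ (m + 2) + (m + 2) / L * η ^ (m + 1)))) * w)) := by ring
    rw [h3]
    linarith
  have e3 : X * η ^ (m + 1) * (η * (K₂ * (ρ ^ (1 - μ) * t ^ (-q)))) ≤
      K₁ * β * (Φ * t ^ (-q)) * (Λ * (E * η ^ (m + 2))) := by
    have h1 : ρ ^ (1 - μ) = ρ * ρ ^ (-μ) := by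
      rw [sub_eq_add_neg, Real.rpow_add hρ, Real.rpow_one]
    calc _ = K₂ * ρ ^ (-μ) * (Φ * t ^ (-q)) * (Λ * (E * η ^ (m + 2))) := by
          rw [h1, hX]; field_simp; ring
      _ ≤ _ := by gcongr
  have e4 : X * η ^ (m + 1) * (c₁ * (η * τ) - (m + 2) / L) ≤
      X * η ^ (m + 1) * (η * (k * (ρ * t / s))) + -(X * η ^ (m + 1) * (b * η + (m + 2) / L)) +
        X * η ^ (m + 1) * (η * (K₂ * (ρ ^ (1 - μ) * t ^ (-q)))) := by
    have h0 : 0 ≤ X * η ^ (m + 1) := by positivity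
    have h1 := mul_le_mul_of_nonneg_left hbr hη0
    have h2 := mul_le_mul_of_nonneg_left h1 h0
    linarith
  have e5 : -((m + 2) * (α ^ k * Cφ * CE * ((m + 2) / c₁) ^ (p - 1)) / L *
      ρ ^ (-(d + 1 - (σ - 1) * (p - 1)))) ≤ X * η ^ (m + 1) * (c₁ * (η * τ) - (m + 2) / L) := by
    -- Either the bracket is nonnegative, or `η τ ≤ (m + 2) / c₁` (using `L ≥ 1`) and the common
    -- factor is bounded by a power of `ρ`.
    rcases le_or_gt (((m : ℝ) + 2) / L) (c₁ * (η * τ)) with h | h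
    · have h1 : 0 ≤ X * η ^ (m + 1) * (c₁ * (η * τ) - (m + 2) / L) :=
        mul_nonneg (by positivity) (by linarith)
      have h2 : 0 ≤ (m + 2) * (α ^ k * Cφ * CE * ((m + 2) / c₁) ^ (p - 1)) / L *
        ρ ^ (-(d + 1 - (σ - 1) * (p - 1))) := by positivity
      linarith
    · have h3 : η * τ ≤ (m + 2) / c₁ := by
        rw [le_div_iff₀ hc₁]
        have : ((m : ℝ) + 2) / L ≤ m + 2 := div_le_self (by positivity) hL
        linarith
      have h4 := mul_pow_le_rpow hp hpm hα hk hCφ hCE hρ hs ht hτ hsα hΛ hΦ0 hΦ hE hE0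
        hη0 hη1 h3
      have h5 := mul_le_mul_of_nonneg_right h4 (by positivity : (0 : ℝ) ≤ (m + 2) / L)
      have h6 : 0 ≤ X * η ^ (m + 1) * (c₁ * (η * τ)) := by positivity
      have h7 : (m + 2) * (α ^ k * Cφ * CE * ((m + 2) / c₁) ^ (p - 1)) / L *
          ρ ^ (-(d + 1 - (σ - 1) * (p - 1))) = α ^ k * Cφ * CE * ((m + 2) / c₁) ^ (p - 1) *
          ρ ^ (-(d + 1 - (σ - 1) * (p - 1))) * ((m + 2) / L) := by ring
      rw [h7]
      linarith
  rw [mul_add]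
  linarith

theorem MeasureTheory.integrable_of_bounded_of_isCompact {n : ℕ} {f : (Fin n → ℝ) → ℝ}
    {S : Set (Fin n → ℝ)} (hS : IsCompact S) (hf : AEStronglyMeasurable f volume)
    (h0 : ∀ x, x ∉ S → f x = 0) {M : ℝ} (hM : ∀ᵐ x, x ∈ S → |f x| ≤ M) :
    Integrable f volume := by
  have h1 : IntegrableOn f S volume :=
    Measure.integrableOn_of_bounded hS.measure_lt_top.ne hf
      ((ae_restrict_iff' hS.measurableSet).2 hM)
  rwa [integrableOn_iff_integrable_of_support_subset] at h1
  intro x hx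
  by_contra h
  exact hx (h0 x h)

/-! ### The test functions -/

namespace HomogeneousGroup

variable {n : ℕ} {G : HomogeneousGroup n}

section radial

variable {r : G.HomogeneousNorm} {B : ℝ → ℝ} {ρ₀ c : ℝ}

theorem eventually_radial_const (hρ : 0 < ρ₀) (hc : ∀ ρ, ρ ≤ ρ₀ → B ρ = c) :
    (fun x => B (r x)) =ᶠ[𝓝 0] fun _ => c := by
  have := (r.continuous_toFun.tendsto 0).eventually (gt_mem_nhds (r.map_zero ▸ hρ))
  filter_upwards [this] with x hx using hc _ hx.le

theorem HomogeneousNorm.contDiffAt {x : Fin n → ℝ} (hx : x ≠ 0) : ContDiffAt ℝ ∞ r x :=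
  r.contDiffOn_toFun.contDiffAt (isOpen_compl_singleton.mem_nhds hx)

/-- The norm need not be differentiable at the origin; this does not matter because `B` is constant
for small radii. -/
theorem contDiff_radial (hB : ContDiff ℝ 1 B) (hρ : 0 < ρ₀) (hc : ∀ ρ, ρ ≤ ρ₀ → B ρ = c) :
    ContDiff ℝ 1 fun x => B (r x) := by
  refine contDiff_iff_contDiffAt.2 fun x => ?_
  rcases eq_or_ne x 0 with rfl | hx
  · exact contDiffAt_const.congr_of_eventuallyEq (eventually_radial_const hρ hc)
  · exact hB.contDiffAt.comp x ((HomogeneousNorm.contDiffAt hx).of_le (by exact_mod_cast le_top))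

theorem horizontalGradient_radial (hB : ContDiff ℝ 1 B) (hρ : 0 < ρ₀)
    (hc : ∀ ρ, ρ ≤ ρ₀ → B ρ = c) (x : Fin n → ℝ) :
    G.horizontalGradient (fun x => B (r x)) x = deriv B (r x) • G.horizontalGradient r x := by
  have key : fderiv ℝ (fun x => B (r x)) x = deriv B (r x) • fderiv ℝ r x := by
    rcases eq_or_ne x 0 with rfl | hx
    · have h1 : B =ᶠ[𝓝 (r 0)] fun _ => c := by
        filter_upwards [gt_mem_nhds (r.map_zero.symm ▸ hρ : r 0 < ρ₀)] with y hy using hc y hy.le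
      rw [(eventually_radial_const hρ hc).fderiv_eq, h1.deriv_eq]
      simp
    · have hB' := ((hB.differentiable (by simp)).differentiableAt (x := r x)).hasDerivAt
      have hr' := ((HomogeneousNorm.contDiffAt (r := r) hx).differentiableAt
        (by simp)).hasFDerivAt
      exact (hB'.comp_hasFDerivAt x hr').fderiv
  ext j
  simp [horizontalGradient, key]

end radial

variable {r : G.HomogeneousNorm} {v : (Fin n → ℝ) → ℝ} {k ε ρ₀ b L : ℝ} {m : ℕ}

/-- The test function `Λ(v) B(r)`. -/
def testFun (r : G.HomogeneousNorm) (v : (Fin n → ℝ) → ℝ) (k ε ρ₀ b : ℝ) (m : ℕ) (L : ℝ)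
    (x : Fin n → ℝ) : ℝ :=
  cutPow k ε (v x) * radialCut ρ₀ b (m + 2) L (r x)

/-- The weak horizontal gradient of `testFun`. -/
def testGrad (r : G.HomogeneousNorm) (v : (Fin n → ℝ) → ℝ)
    (g : (Fin n → ℝ) → EuclideanSpace ℝ G.HorizontalIndex) (k ε ρ₀ b : ℝ) (m : ℕ) (L : ℝ)
    (x : Fin n → ℝ) : EuclideanSpace ℝ G.HorizontalIndex :=
  radialCut ρ₀ b (m + 2) L (r x) • (deriv (cutPow k ε) (v x) • g x) +
    cutPow k ε (v x) • (deriv (radialCut ρ₀ b (m + 2) L) (r x) • G.horizontalGradient r x)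

theorem contDiff_radialCut_norm (hρ : 0 < ρ₀) :
    ContDiff ℝ 1 fun x => radialCut ρ₀ b (m + 2) L (r x) :=
  contDiff_radial (contDiff_radialCut hρ) hρ fun _ h => radialCut_of_le hρ h

theorem lipLoc_testFun (hε : 0 < ε) (hρ : 0 < ρ₀) (hv : r.LipLoc v) :
    r.LipLoc (testFun r v k ε ρ₀ b m L) :=
  (hv.comp (contDiff_cutPow hε)).mul (r.lipLoc_of_contDiff (contDiff_radialCut_norm hρ))

theorem isWeakGradient_testFun {g : (Fin n → ℝ) → EuclideanSpace ℝ G.HorizontalIndex}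
    (hε : 0 < ε) (hρ : 0 < ρ₀) (hv : r.LipLoc v) (hg : G.IsWeakGradient v g) :
    G.IsWeakGradient (testFun r v k ε ρ₀ b m L) (testGrad r v g k ε ρ₀ b m L) := by
  have h := (hg.comp hv (contDiff_cutPow (k := k) hε)).mul (hv.comp (contDiff_cutPow hε))
    (isWeakGradient_of_contDiff r (contDiff_radialCut_norm (r := r) (b := b) (m := m) (L := L) hρ))
    (r.lipLoc_of_contDiff (contDiff_radialCut_norm hρ))
  have e : G.horizontalGradient (fun x => radialCut ρ₀ b (m + 2) L (r x)) = fun x =>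
      deriv (radialCut ρ₀ b (m + 2) L) (r x) • G.horizontalGradient r x :=
    funext fun x => horizontalGradient_radial (contDiff_radialCut hρ) hρ
      (fun _ h => radialCut_of_le hρ h) x
  rw [e] at h
  exact h

theorem testFun_eq_zero (hρ : 0 < ρ₀) (hL : 0 < L) {x : Fin n → ℝ}
    (hx : x ∉ {x | r x ≤ ρ₀ * Real.exp (L + 1)}) : testFun r v k ε ρ₀ b m L x = 0 := by
  have hx' : ρ₀ * Real.exp (L + 1) < r x := not_le.1 hx
  rw [testFun, radialCut_eq_zero hρ hL hx'.le, MulZeroClass.mul_zero]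

theorem testGrad_eq_zero {g : (Fin n → ℝ) → EuclideanSpace ℝ G.HorizontalIndex}
    (hρ : 0 < ρ₀) (hL : 0 < L) {x : Fin n → ℝ}
    (hx : x ∉ {x | r x ≤ ρ₀ * Real.exp (L + 1)}) : testGrad r v g k ε ρ₀ b m L x = 0 := by
  have hx' : ρ₀ * Real.exp (L + 1) < r x := not_le.1 hx
  have h1 : radialCut ρ₀ b (m + 2) L =ᶠ[𝓝 (r x)] fun _ => 0 := by
    filter_upwards [lt_mem_nhds hx'] with y hy using radialCut_eq_zero hρ hL hy.le
  rw [testGrad, radialCut_eq_zero hρ hL hx'.le, h1.deriv_eq, deriv_const]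
  simp

/-- The threshold `ε` keeps the closed support inside `{v ≥ ε}`, hence inside the open set `{v >
0}`; the logarithmic cutoff makes it compact. -/
theorem lipCompact_testFun (hε : 0 < ε) (hρ : 0 < ρ₀) (hL : 0 < L) (hv : r.LipLoc v) :
    r.LipCompact (testFun r v k ε ρ₀ b m L) {x | 0 < v x} := by
  have hc : HasCompactSupport (testFun r v k ε ρ₀ b m L) :=
    HasCompactSupport.intro (r.isCompact_le (ρ₀ * Real.exp (L + 1)))
      fun x hx => testFun_eq_zero hρ hL hx
  refine ⟨(lipLoc_testFun hε hρ hv).lipOn_univ hc, hc, ?_⟩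
  have hcl : IsClosed {x | ε ≤ v x} := isClosed_le continuous_const hv.continuous
  have hsub : tsupport (testFun r v k ε ρ₀ b m L) ⊆ {x | ε ≤ v x} :=
    closure_minimal (fun x hx => by
      by_contra h
      have h' : v x < ε := not_le.1 h
      exact hx (by rw [testFun, cutPow_eq_zero h'.le, MulZeroClass.zero_mul])) hcl
  exact fun x hx => hε.trans_le (hsub hx)

theorem testFun_nonneg (hε : 0 < ε) (x : Fin n → ℝ) : 0 ≤ testFun r v k ε ρ₀ b m L x :=
  mul_nonneg (cutPow_nonneg hε) radialCut_nonneg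

theorem inner_testGrad (g : (Fin n → ℝ) → EuclideanSpace ℝ G.HorizontalIndex) (x : Fin n → ℝ) :
    inner ℝ (g x) (testGrad r v g k ε ρ₀ b m L x) =
      radialCut ρ₀ b (m + 2) L (r x) * deriv (cutPow k ε) (v x) * ‖g x‖ ^ 2 +
      cutPow k ε (v x) * deriv (radialCut ρ₀ b (m + 2) L) (r x) *
        inner ℝ (g x) (G.horizontalGradient r x) := by
  rw [testGrad, inner_add_right, real_inner_smul_right, real_inner_smul_right,
    real_inner_smul_right, real_inner_smul_right, real_inner_self_eq_norm_sq]
  ring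

end HomogeneousGroup

/-! ### Measurability and bounds for the nonlinearities -/

section WeaklyCoercive

variable {φ : ℝ → ℝ} {p : ℝ}

theorem WeaklyCoercive.nonneg (hφ : WeaklyCoercive φ p) {t : ℝ} (ht : 0 ≤ t) : 0 ≤ φ t := by
  rcases ht.eq_or_lt with rfl | h
  · exact hφ.map_zero.ge
  · exact (hφ.pos t h).le

theorem WeaklyCoercive.continuous_max (hφ : WeaklyCoercive φ p) :
    Continuous fun t => φ (max t 0) :=
  hφ.continuousOn.comp_continuous (by fun_prop) fun t => le_max_right t 0

theorem WeaklyCoercive.aestronglyMeasurable_comp_norm (hφ : WeaklyCoercive φ p) {E F : Type*}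
    [MeasurableSpace E] {ν : Measure E} [NormedAddCommGroup F] {g : E → F}
    (hg : AEStronglyMeasurable g ν) : AEStronglyMeasurable (fun x => φ ‖g x‖) ν := by
  have h := hφ.continuous_max.comp_aestronglyMeasurable hg.norm
  refine h.congr (Eventually.of_forall fun x => ?_)
  simp only [max_eq_left (norm_nonneg _)]

variable {q : ℝ} {l : ℝ → ℝ}

theorem WeaklyCoercive.aestronglyMeasurable_l_comp_norm (hφ : WeaklyCoercive φ p)
    (hl : ∀ t, 0 < t → l t = φ t * t ^ (-q)) {E F : Type*}
    [MeasurableSpace E] {ν : Measure E} [NormedAddCommGroup F] {g : E → F}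
    (hg : AEStronglyMeasurable g ν) : AEStronglyMeasurable (fun x => l ‖g x‖) ν := by
  -- No regularity of `l` is assumed at `0` or on negative numbers; on norms it agrees with this
  -- piecewise measurable function.
  have hm : Measurable fun t : ℝ => if t ∈ Set.Ioi (0 : ℝ) then φ (max t 0) * t ^ (-q) else l 0 :=
    Measurable.ite measurableSet_Ioi
      (hφ.continuous_max.measurable.mul (measurable_id.pow_const _)) measurable_const
  have h := (hm.comp_aemeasurable hg.norm.aemeasurable).aestronglyMeasurable
  refine h.congr (Eventually.of_forall fun x => ?_)
  simp only [Function.comp_apply, Set.mem_Ioi]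
  split_ifs with hx
  · rw [max_eq_left hx.le, hl _ hx]
  · rw [le_antisymm (not_lt.1 hx) (norm_nonneg _)]

theorem WeaklyCoercive.l_nonneg (hφ : WeaklyCoercive φ p)
    (hl : ∀ t, 0 < t → l t = φ t * t ^ (-q)) (hl0 : 0 ≤ l 0) {t : ℝ} (ht : 0 ≤ t) : 0 ≤ l t := by
  rcases ht.eq_or_lt with rfl | h
  · exact hl0
  · rw [hl t h]
    have := hφ.pos t h
    positivity

/-- For `t > 0`, `l t ≤ C t^(p - 1 - q)` with nonnegative exponent, so `l` does not blow up as `t →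
0⁺`. -/
theorem WeaklyCoercive.exists_l_bound (hφ : WeaklyCoercive φ p) (hqp : q ≤ p - 1)
    (hl : ∀ t, 0 < t → l t = φ t * t ^ (-q)) (hl0 : 0 ≤ l 0) (M : ℝ) :
    ∃ D : ℝ, ∀ t, 0 ≤ t → t ≤ M → l t ≤ D := by
  obtain ⟨C, hC, hb⟩ := hφ.bound
  refine ⟨l 0 + C * |M| ^ (p - 1 - q), fun t ht htM => ?_⟩
  rcases ht.eq_or_lt with rfl | h
  · have : 0 ≤ C * |M| ^ (p - 1 - q) := by positivity
    linarith
  · rw [hl t h]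
    calc φ t * t ^ (-q) ≤ C * t ^ (p - 1) * t ^ (-q) := by gcongr; exact hb t h
      _ = C * t ^ (p - 1 - q) := by
        rw [mul_assoc, ← Real.rpow_add h]; congr 2
      _ ≤ C * |M| ^ (p - 1 - q) := by
        have h1 : t ≤ |M| := htM.trans (le_abs_self M)
        have h2 : 0 ≤ p - 1 - q := by linarith
        gcongr
      _ ≤ _ := by linarith

end WeaklyCoercive

/-! ### The integral estimate and vanishing of the gradient -/

namespace HomogeneousGroup

variable {n : ℕ} {G : HomogeneousGroup n} {r : G.HomogeneousNorm} {v : (Fin n → ℝ) → ℝ}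
  {g : (Fin n → ℝ) → EuclideanSpace ℝ G.HorizontalIndex} {φ l : ℝ → ℝ}
  {p q μ σ α k d ε ρ₀ b L : ℝ} {m : ℕ}

theorem integrable_flux (hp : 1 < p) (hφ : WeaklyCoercive φ p) (hε : 0 < ε) (hρ : 0 < ρ₀)
    (hL : 0 < L) (hv : r.LipLoc v) (hg : G.IsWeakGradient v g) :
    Integrable fun x => φ ‖g x‖ / ‖g x‖ * inner ℝ (g x) (testGrad r v g k ε ρ₀ b m L x) := by
  have hS := r.isCompact_le (ρ₀ * Real.exp (L + 1))
  have hh := isWeakGradient_testFun (k := k) (b := b) (m := m) (L := L) hε hρ hv hg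
  obtain ⟨M, hM⟩ := hg.exists_ae_bound hv hS
  obtain ⟨N, hN⟩ := hh.exists_ae_bound (lipLoc_testFun hε hρ hv) hS
  obtain ⟨C, hC, hb⟩ := hφ.bound
  have hgm := hg.2.1.aestronglyMeasurable
  refine integrable_of_bounded_of_isCompact hS (M := C * |M| ^ (p - 1) * N)
    ((((hφ.aestronglyMeasurable_comp_norm hgm).aemeasurable.div
      hgm.norm.aemeasurable).aestronglyMeasurable).mul
      (hgm.inner hh.2.1.aestronglyMeasurable)) (fun x hx => ?_) ?_
  · rw [testGrad_eq_zero hρ hL hx, inner_zero_right, MulZeroClass.mul_zero]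
  · filter_upwards [hM, hN] with x hxM hxN hx
    have h1 := hxM hx
    have h2 := hxN hx
    have hN0 : 0 ≤ N := (norm_nonneg _).trans h2
    rcases (norm_nonneg (g x)).eq_or_lt with h0 | hpos
    · rw [← h0, div_zero, MulZeroClass.zero_mul, abs_zero]
      positivity
    · have h3 := hφ.pos _ hpos
      rw [abs_mul, abs_of_pos (by positivity)]
      calc φ ‖g x‖ / ‖g x‖ * |inner ℝ (g x) (testGrad r v g k ε ρ₀ b m L x)|
          ≤ φ ‖g x‖ / ‖g x‖ * (‖g x‖ * ‖testGrad r v g k ε ρ₀ b m L x‖) := by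
            gcongr; exact abs_real_inner_le_norm _ _
        _ = φ ‖g x‖ * ‖testGrad r v g k ε ρ₀ b m L x‖ := by field_simp
        _ ≤ C * ‖g x‖ ^ (p - 1) * ‖testGrad r v g k ε ρ₀ b m L x‖ := by
            gcongr; exact hb _ hpos
        _ ≤ C * |M| ^ (p - 1) * N := by
            have h4 : ‖g x‖ ≤ |M| := h1.trans (le_abs_self M)
            have h5 : 0 ≤ p - 1 := by linarith
            gcongr

theorem continuous_weight (μ : ℝ) : Continuous fun x => (1 + r x) ^ (-μ) := by
  refine (continuous_const.add r.continuous_toFun).rpow_const fun x => Or.inl ?_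
  exact (add_pos_of_pos_of_nonneg one_pos (r.nonneg x)).ne'

theorem integrable_reaction (hφ : WeaklyCoercive φ p) (hqp : q ≤ p - 1)
    (hl : ∀ t, 0 < t → l t = φ t * t ^ (-q)) (hl0 : 0 ≤ l 0) (hε : 0 < ε) (hρ : 0 < ρ₀)
    (hL : 0 < L) (hv : r.LipLoc v) (hg : G.IsWeakGradient v g) :
    Integrable fun x => (1 + r x) ^ (-μ) * l ‖g x‖ * testFun r v k ε ρ₀ b m L x := by
  have hS := r.isCompact_le (ρ₀ * Real.exp (L + 1))
  have hgm := hg.2.1.aestronglyMeasurable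
  have hψ := (lipLoc_testFun (k := k) (b := b) (m := m) (L := L) hε hρ hv).continuous
  obtain ⟨M, hM⟩ := hg.exists_ae_bound hv hS
  obtain ⟨D, hD⟩ := hφ.exists_l_bound hqp hl hl0 M
  obtain ⟨A, hA⟩ := hS.exists_bound_of_continuousOn
    ((continuous_weight (r := r) μ).mul hψ).continuousOn
  refine integrable_of_bounded_of_isCompact hS (M := A * D)
    (((continuous_weight μ).aestronglyMeasurable.mul
      (hφ.aestronglyMeasurable_l_comp_norm hl hgm)).mul hψ.aestronglyMeasurable)
      (fun x hx => ?_) ?_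
  · rw [testFun_eq_zero hρ hL hx, MulZeroClass.mul_zero]
  · filter_upwards [hM] with x hxM hx
    have h1 := hA x hx
    have h2 := hD _ (norm_nonneg _) (hxM hx)
    have h3 := hφ.l_nonneg hl hl0 (norm_nonneg (g x))
    calc |(1 + r x) ^ (-μ) * l ‖g x‖ * testFun r v k ε ρ₀ b m L x|
        = ‖(1 + r x) ^ (-μ) * testFun r v k ε ρ₀ b m L x‖ * l ‖g x‖ := by
          rw [mul_right_comm, abs_mul, abs_of_nonneg h3, Real.norm_eq_abs]
      _ ≤ A * D := by
          have : 0 ≤ A := (norm_nonneg _).trans h1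
          gcongr
          exact h1

theorem integrand_testFun_ge (hr : ∀ x, x ≠ 0 → ‖G.horizontalGradient r x‖ ≤ 1)
    (hp : 1 < p) (hpm : p ≤ m + 2) (hφ : WeaklyCoercive φ p)
    (hexp : 1 - μ = q * (σ - 1)) (hσ : 0 ≤ σ) (hd : 0 < d)
    (hα : 0 < α) (hk : 0 < k) {c₁ K₁ K₂ C : ℝ} (hc₁ : 0 < c₁)
    (hkey : ∀ τ : ℝ, 0 < τ → c₁ * τ + (d + σ * k) ≤ k / α * τ + K₂ * τ ^ (-q)) (hρ : 0 < ρ₀)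
    (hβ : ∀ ρ, ρ₀ ≤ ρ → K₂ * ρ ^ (-μ) ≤ K₁ * (1 + ρ) ^ (-μ)) (hK₁ : 0 ≤ K₁)
    (hC : 0 < C) (hφC : ∀ t, 0 < t → φ t ≤ C * t ^ (p - 1))
    (hvα : ∀ x, ρ₀ ≤ r x → v x ≤ α * r x ^ σ)
    (hl : ∀ t, 0 < t → l t = φ t * t ^ (-q)) (hl0 : 0 ≤ l 0) (hε : 0 < ε) (hL : 1 ≤ L)
    {x : Fin n → ℝ} (hx : 0 < v x) :
    -((m + 2) * (α ^ k * C * (Real.exp (d + σ * k) * ρ₀ ^ (d + σ * k)) *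
        ((m + 2) / c₁) ^ (p - 1)) / L *
        {x | ρ₀ ≤ r x}.indicator (fun x => r x ^ (-(d + 1 - (σ - 1) * (p - 1)))) x) ≤
      φ ‖g x‖ / ‖g x‖ * inner ℝ (g x) (testGrad r v g k ε ρ₀ (d + σ * k) m L x) +
        K₁ * ((1 + r x) ^ (-μ) * l ‖g x‖ * testFun r v k ε ρ₀ (d + σ * k) m L x) := by
  set b := d + σ * k with hb
  have hL0 : 0 < L := by linarith
  have hb0 : 0 < b := by positivity
  have hr0 := r.nonneg x
  have hneg : -((m + 2) * (α ^ k * C * (Real.exp b * ρ₀ ^ b) *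
        ((m + 2) / c₁) ^ (p - 1)) / L *
        {x | ρ₀ ≤ r x}.indicator (fun x => r x ^ (-(d + 1 - (σ - 1) * (p - 1)))) x) ≤ 0 := by
    have : 0 ≤ {x | ρ₀ ≤ r x}.indicator (fun x => r x ^ (-(d + 1 - (σ - 1) * (p - 1)))) x :=
      Set.indicator_nonneg (fun x _ => Real.rpow_nonneg (r.nonneg x) _) x
    rw [neg_nonpos]
    positivity
  have hreact : 0 ≤ K₁ * ((1 + r x) ^ (-μ) * l ‖g x‖ * testFun r v k ε ρ₀ b m L x) := by
    have h1 := testFun_nonneg (r := r) (v := v) (k := k) (ρ₀ := ρ₀) (b := b) (m := m) (L := L) hε x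
    have h2 := hφ.l_nonneg hl hl0 (norm_nonneg (g x))
    positivity
  rcases (norm_nonneg (g x)).eq_or_lt with h0 | ht
  -- At critical points the flux is zero by the convention `0 / 0 = 0`, and the reaction is
  -- nonnegative because `l 0 ≥ 0`.
  · refine hneg.trans ?_
    rw [← h0] at hreact ⊢
    rw [div_zero, MulZeroClass.zero_mul, zero_add]
    exact hreact
  have hΛ' := le_deriv_cutPow (k := k) hε hx
  have hΛ0 := cutPow_nonneg (k := k) (s := v x) hε
  rcases lt_or_ge (r x) ρ₀ with hlt | hge
  -- Inside radius `ρ₀` the weight is constant, so only the favourable term of the flux remains.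
  · refine hneg.trans (add_nonneg ?_ hreact)
    have hd0 : deriv (radialCut ρ₀ b (m + 2) L) (r x) = 0 := by
      rw [deriv_radialCut hρ, deriv_logCut_eq_zero hρ hlt.le]; simp
    rw [inner_testGrad, hd0]
    have h1 : 0 ≤ deriv (cutPow k ε) (v x) := le_trans (by positivity) hΛ'
    have h2 := hφ.pos _ ht
    have h3 := radialCut_nonneg (ρ₀ := ρ₀) (b := b) (L := L) (ρ := r x) (m := m + 2)
    simp only [MulZeroClass.mul_zero, MulZeroClass.zero_mul, add_zero]
    positivity
  · have hrpos : 0 < r x := hρ.trans_le hge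
    have hx0 : x ≠ 0 := (r.pos_iff x).1 hrpos
    have hw : |inner ℝ (g x) (G.horizontalGradient r x)| ≤ ‖g x‖ :=
      (abs_real_inner_le_norm _ _).trans (mul_le_of_le_one_right (norm_nonneg _) (hr x hx0))
    have hη1 : max (1 - logCut ρ₀ (r x) / L) 0 ≤ 1 := by
      have := div_nonneg (logCut_nonneg hρ (r x)) hL0.le
      exact max_le (by linarith) zero_le_one
    have key := integrand_ge (m := m) hp hpm hexp hσ hd hα hk hc₁ hC.le
      (by positivity : 0 ≤ Real.exp b * ρ₀ ^ b) hkey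
      hrpos hx ht (hvα x hge) hΛ0 (cutPow_le hε hx) hΛ' (hφ.pos _ ht).le (hφC _ ht)
      (exp_logCut_le hρ hb0.le hge) (Real.exp_pos _).le (le_max_right _ _) hη1
      (deriv_logCut_nonneg hρ (r x)) (deriv_logCut_le hρ hge) hL (hβ _ hge) hw
    rw [Set.indicator_of_mem (show x ∈ {x | ρ₀ ≤ r x} from hge)]
    refine key.trans_eq ?_
    rw [inner_testGrad, deriv_radialCut hρ, hl _ ht]
    simp only [testFun, radialCut]
    ring

/-- A nonnegative supersolution-type inequality at the critical growth rate forces the gradient to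
vanish. -/
theorem ae_gradient_eq_zero (hr : ∀ x, x ≠ 0 → ‖G.horizontalGradient r x‖ ≤ 1)
    (hp : 1 < p) (hφ : WeaklyCoercive φ p) (hqp : q ≤ p - 1)
    (hexp : 1 - μ = q * (σ - 1)) (hσ : 0 ≤ σ) (hd : 0 < d)
    (hdQ : (G.homDim : ℝ) < d + 1 - (σ - 1) * (p - 1))
    (hα : 0 < α) (hk : 0 < k) {c₁ K K₁ K₂ : ℝ} (hc₁ : 0 < c₁)
    (hkey : ∀ τ : ℝ, 0 < τ → c₁ * τ + (d + σ * k) ≤ k / α * τ + K₂ * τ ^ (-q)) (hρ : 0 < ρ₀)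
    (hβ : ∀ ρ, ρ₀ ≤ ρ → K₂ * ρ ^ (-μ) ≤ K₁ * (1 + ρ) ^ (-μ)) (hK₁ : 0 ≤ K₁) (hK : K₁ < K)
    (hvα : ∀ x, ρ₀ ≤ r x → v x ≤ α * r x ^ σ)
    (hl : ∀ t, 0 < t → l t = φ t * t ^ (-q)) (hl0 : 0 ≤ l 0)
    (hv : r.LipLoc v) (hg : G.IsWeakGradient v g)
    (hsol : ∀ ψ : (Fin n → ℝ) → ℝ, r.LipCompact ψ {x | 0 < v x} → (∀ x, 0 ≤ ψ x) →
      ∀ h, G.IsWeakGradient ψ h →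
        ∫ x in {x | 0 < v x}, φ ‖g x‖ / ‖g x‖ * inner ℝ (g x) (h x) ≤
          -∫ x in {x | 0 < v x}, K * (1 + r x) ^ (-μ) * l ‖g x‖ * ψ x) :
    ∀ᵐ x, 0 < v x → g x = 0 := by
  obtain ⟨C, hC, hφC⟩ := hφ.bound
  obtain ⟨m, hm⟩ := exists_nat_ge p
  have hpm : p ≤ (m : ℝ) + 2 := by linarith
  set Ω := {x | 0 < v x} with hΩ
  have hΩm : MeasurableSet Ω := measurableSet_lt measurable_const hv.continuous.measurable
  set b := d + σ * k with hb
  set A := (m + 2) * (α ^ k * C * (Real.exp b * ρ₀ ^ b) * ((m + 2) / c₁) ^ (p - 1)) with hA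
  set I : (Fin n → ℝ) → ℝ :=
    {x | ρ₀ ≤ r x}.indicator (fun x => r x ^ (-(d + 1 - (σ - 1) * (p - 1)))) with hI
  have hIint : Integrable I := by
    have h1 := r.integrableOn_rpow hρ (δ := d + 1 - (σ - 1) * (p - 1) - G.homDim) (by linarith)
    rw [add_sub_cancel] at h1
    exact (integrable_indicator_iff
      (measurableSet_le measurable_const r.continuous_toFun.measurable)).2 h1
  have hreact : ∀ {ε L : ℝ}, 0 < ε → 1 ≤ L → Integrable fun x =>
      (1 + r x) ^ (-μ) * l ‖g x‖ * testFun r v k ε ρ₀ b m L x := fun hε hL =>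
    integrable_reaction hφ hqp hl hl0 hε hρ (by linarith) hv hg
  -- The share `K₁` of the reaction already compensates the flux up to an error of order `1 / L`;
  -- the remaining share `K - K₁` is bounded by that error.
  have hle : ∀ {ε L : ℝ}, 0 < ε → 1 ≤ L →
      ∫ x in Ω, (1 + r x) ^ (-μ) * l ‖g x‖ * testFun r v k ε ρ₀ b m L x ≤
        (A * ∫ x in Ω, I x) / (K - K₁) / L := by
    intro ε L hε hL
    have hL0 : 0 < L := by linarith
    have i1 : IntegrableOn (fun x => φ ‖g x‖ / ‖g x‖ *
        inner ℝ (g x) (testGrad r v g k ε ρ₀ b m L x)) Ω :=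
      (integrable_flux hp hφ hε hρ hL0 hv hg).integrableOn
    have i2 : IntegrableOn (fun x =>
        (1 + r x) ^ (-μ) * l ‖g x‖ * testFun r v k ε ρ₀ b m L x) Ω := (hreact hε hL).integrableOn
    have h1 := hsol _ (lipCompact_testFun hε hρ hL0 hv) (testFun_nonneg hε) _
      (isWeakGradient_testFun (k := k) (b := b) (m := m) (L := L) hε hρ hv hg)
    have e1 : ∫ x in Ω, K * (1 + r x) ^ (-μ) * l ‖g x‖ * testFun r v k ε ρ₀ b m L x =
        K * ∫ x in Ω, (1 + r x) ^ (-μ) * l ‖g x‖ * testFun r v k ε ρ₀ b m L x := by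
      rw [← integral_const_mul]
      congr 1; ext x; ring
    rw [e1] at h1
    have h2 : ∫ x in Ω, -(A / L * I x) ≤
        ∫ x in Ω, (φ ‖g x‖ / ‖g x‖ * inner ℝ (g x) (testGrad r v g k ε ρ₀ b m L x) +
          K₁ * ((1 + r x) ^ (-μ) * l ‖g x‖ * testFun r v k ε ρ₀ b m L x)) := by
      refine setIntegral_mono_on (hIint.const_mul _).neg.integrableOn (i1.add (i2.const_mul K₁))
        hΩm fun x hx => ?_
      exact integrand_testFun_ge hr hp hpm hφ hexp hσ hd hα hk hc₁ hkey hρ hβ hK₁ hC hφC hvα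
        hl hl0 hε hL hx
    rw [integral_add i1 (i2.const_mul K₁), integral_neg, integral_const_mul,
      integral_const_mul] at h2
    rw [le_div_iff₀ hL0, le_div_iff₀ (by linarith)]
    have h3 : A / L * ∫ x in Ω, I x = (A * ∫ x in Ω, I x) / L := by ring
    rw [h3] at h2
    have h4 : (K - K₁) * ∫ x in Ω, (1 + r x) ^ (-μ) * l ‖g x‖ * testFun r v k ε ρ₀ b m L x ≤
        (A * ∫ x in Ω, I x) / L := by linarith
    rw [le_div_iff₀ hL0] at h4
    linarith
  have hnn : ∀ {ε L : ℝ}, 0 < ε → ∀ x,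
      0 ≤ (1 + r x) ^ (-μ) * l ‖g x‖ * testFun r v k ε ρ₀ b m L x := by
    intro ε L hε x
    have h1 := testFun_nonneg (r := r) (v := v) (k := k) (ρ₀ := ρ₀) (b := b) (m := m) (L := L) hε x
    have h2 := hφ.l_nonneg hl hl0 (norm_nonneg (g x))
    have h3 := r.nonneg x
    positivity
  have hzero : ∀ {ε L : ℝ}, 0 < ε → 1 ≤ L → ∀ᵐ x, x ∈ Ω →
      (1 + r x) ^ (-μ) * l ‖g x‖ * testFun r v k ε ρ₀ b m L x = 0 := by
    intro ε L hε hL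
    -- The integral at `L` is at most the one at any `L' ≥ L`, which is of order `1 / L'`; hence it
    -- vanishes for each fixed `L`.
    have hlim : Tendsto (fun L' : ℝ => (A * ∫ x in Ω, I x) / (K - K₁) / L') atTop (𝓝 0) :=
      tendsto_const_nhds.div_atTop tendsto_id
    have h1 : ∫ x in Ω, (1 + r x) ^ (-μ) * l ‖g x‖ * testFun r v k ε ρ₀ b m L x ≤ 0 := by
      refine ge_of_tendsto hlim ?_
      filter_upwards [eventually_ge_atTop L] with L' hL'
      refine le_trans ?_ (hle hε (hL.trans hL'))
      refine setIntegral_mono (hreact hε hL).integrableOn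
        (hreact hε (hL.trans hL')).integrableOn fun x => ?_
      have h2 := hφ.l_nonneg hl hl0 (norm_nonneg (g x))
      have h3 := r.nonneg x
      have h4 := cutPow_nonneg (k := k) (s := v x) hε
      have h5 := radialCut_mono (b := b) (m := m + 2) (ρ := r x) hρ (by linarith) hL'
      simp only [testFun]
      gcongr
    have h2 : ∫ x in Ω, (1 + r x) ^ (-μ) * l ‖g x‖ * testFun r v k ε ρ₀ b m L x = 0 :=
      le_antisymm h1 (integral_nonneg (hnn hε))
    have h3 := (integral_eq_zero_iff_of_nonneg (hnn hε) (hreact hε hL).integrableOn).1 h2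
    exact (ae_restrict_iff' hΩm).1 h3
  -- Countably many `ε` and `L` suffice, with one common null set: at each point of `Ω` some pair
  -- makes the test function positive.
  have hall : ∀ᵐ x, ∀ i j : ℕ, x ∈ Ω →
      (1 + r x) ^ (-μ) * l ‖g x‖ * testFun r v k (1 / ((i : ℝ) + 1)) ρ₀ b m ((j : ℝ) + 1) x = 0 :=
    ae_all_iff.2 fun i => ae_all_iff.2 fun j => hzero (by positivity) (by simp)
  filter_upwards [hall] with x hx hxΩ
  by_contra hgx
  have ht : 0 < ‖g x‖ := norm_pos_iff.2 hgx
  obtain ⟨i, hi⟩ := exists_nat_one_div_lt hxΩ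
  obtain ⟨j, hj⟩ := exists_nat_gt (logCut ρ₀ (r x))
  have h1 := hx i j hxΩ
  have h2 : 0 < l ‖g x‖ := by
    rw [hl _ ht]
    have := hφ.pos _ ht
    positivity
  have h3 := r.nonneg x
  have h4 : 0 < cutPow k (1 / ((i : ℝ) + 1)) (v x) := cutPow_pos (by positivity) hi
  have h5 : 0 < 1 - logCut ρ₀ (r x) / ((j : ℝ) + 1) := by
    rw [sub_pos, div_lt_one (by positivity)]
    linarith
  have h6 : 0 < radialCut ρ₀ b (m + 2) ((j : ℝ) + 1) (r x) := by
    rw [radialCut, max_eq_left h5.le]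
    positivity
  have h7 : 0 < (1 + r x) ^ (-μ) * l ‖g x‖ *
      testFun r v k (1 / ((i : ℝ) + 1)) ρ₀ b m ((j : ℝ) + 1) x := by
    rw [testFun]
    positivity
  exact h7.ne' h1

end HomogeneousGroup

/-! ### Choice of parameters and growth at infinity -/

/-- The parameters of the test function, for a positive critical exponent `s`. -/
theorem exists_testParams_of_pos {q s α d K : ℝ} (hq : 0 < q) (hα : 0 < α) (hd : 0 < d)
    (hs : 0 < s) (hK : (α * s) ^ q * d < K) :
    ∃ k c₁ K₂ : ℝ, 0 < k ∧ 0 < c₁ ∧ 0 < K₂ ∧ K₂ < K ∧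
      ∀ τ : ℝ, 0 < τ → c₁ * τ + (d + s * k) ≤ k / α * τ + K₂ * τ ^ (-q) := by
  have hT : 0 < α * s := by positivity
  obtain ⟨K₂, hK1, hK2⟩ := exists_between hK
  have hK0 : 0 < K₂ := lt_trans (by positivity) hK1
  set T := α * s with hTdef
  set A := K₂ * T ^ (-q) with hA
  have hA0 : 0 < A := by positivity
  have hAd : d < A := by
    rw [hA, Real.rpow_neg hT.le, ← div_eq_mul_inv, lt_div_iff₀ (by positivity)]
    linarith
  have hc : 0 < (A - d) / T := div_pos (by linarith) hT
  -- With this `k` one has `d + s k = (1 + q) A`, the constant term of the tangent at `T = α s`. The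
  -- slope `k / α` exceeds what the tangent requires by `(A - d) / T`, which is `c₁`.
  refine ⟨α * (q * A / T + (A - d) / T), (A - d) / T, K₂, by positivity, hc, hK0, hK2,
    fun τ hτ => ?_⟩
  have h1 := tangent_le_mul_rpow_neg hq.le hK0.le hT hτ
  rw [← hA] at h1
  have e1 : s * (α * (q * A / T + (A - d) / T)) = q * A + A - d := by
    rw [hTdef]; field_simp; ring
  have e2 : α * (q * A / T + (A - d) / T) / α * τ = q * A / T * τ + (A - d) / T * τ := by
    field_simp
  rw [e1, e2]
  linarith

/-- The parameters of the test function, for a zero critical exponent. -/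
theorem exists_testParams_zero {q α d K : ℝ} (hq : 0 < q) (hα : 0 < α) (hd : 0 < d)
    (hK : 0 < K) :
    ∃ k c₁ K₂ : ℝ, 0 < k ∧ 0 < c₁ ∧ 0 < K₂ ∧ K₂ < K ∧
      ∀ τ : ℝ, 0 < τ → c₁ * τ + (d + 0 * k) ≤ k / α * τ + K₂ * τ ^ (-q) := by
  -- For zero exponent `k` does not enter the decay rate. The contact point is chosen so that `(K /
  -- 2) T^(-q) = d`; the tangent then exceeds `d` at the origin, and any larger slope leaves room
  -- for `c₁ = 1`.
  set T := (K / 2 / d) ^ (1 / q) with hTdef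
  have hT : 0 < T := by positivity
  have hA : K / 2 * T ^ (-q) = d := by
    rw [hTdef, ← Real.rpow_mul (by positivity), show 1 / q * -q = -1 by field_simp,
      Real.rpow_neg_one]
    field_simp
  refine ⟨α * (q * d / T + 1), 1, K / 2, by positivity, one_pos, by positivity, by linarith,
    fun τ hτ => ?_⟩
  have h1 := tangent_le_mul_rpow_neg hq.le (by positivity : 0 ≤ K / 2) hT hτ
  rw [hA] at h1
  have e2 : α * (q * d / T + 1) / α * τ = q * d / T * τ + 1 * τ := by field_simp
  rw [e2]
  nlinarith

/-- The ratio of `(1 + ρ)^(-μ)` to `ρ^(-μ)` tends to `1` whatever the sign of `μ`, so the gap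
between `K₂` and `K₁` absorbs it. -/
theorem eventually_rpow_le_one_add_rpow (μ : ℝ) {K₁ K₂ : ℝ} (h : K₂ < K₁) :
    ∀ᶠ ρ : ℝ in atTop, K₂ * ρ ^ (-μ) ≤ K₁ * (1 + ρ) ^ (-μ) := by
  have h1 : Tendsto (fun ρ : ℝ => K₁ * (1 + ρ⁻¹) ^ (-μ)) atTop (𝓝 K₁) := by
    have h2 : Tendsto (fun ρ : ℝ => 1 + ρ⁻¹) atTop (𝓝 1) := by
      simpa using tendsto_inv_atTop_zero.const_add (1 : ℝ)
    have h3 := (h2.rpow_const (p := -μ) (Or.inl one_ne_zero)).const_mul K₁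
    simpa using h3
  filter_upwards [h1.eventually (lt_mem_nhds h), eventually_gt_atTop 0] with ρ hρ hρ0
  have e : (1 + ρ) ^ (-μ) = (1 + ρ⁻¹) ^ (-μ) * ρ ^ (-μ) := by
    rw [← Real.mul_rpow (by positivity) hρ0.le]
    congr 1
    field_simp; ring
  rw [e, ← mul_assoc]
  gcongr

theorem eventually_mul_rpow_add_le {a c α σ s : ℝ} (hσs : σ ≤ s) (hs : 0 < s)
    (h : σ = s → a < α) (hα : 0 < α) :
    ∀ᶠ ρ : ℝ in atTop, a * ρ ^ σ + c ≤ α * ρ ^ s := by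
  obtain ⟨a', ha', hlim⟩ : ∃ a', a' < α ∧
      Tendsto (fun ρ : ℝ => a * ρ ^ (σ - s)) atTop (𝓝 a') := by
    rcases hσs.eq_or_lt with rfl | hlt
    · exact ⟨a, h rfl, by simp⟩
    · refine ⟨0, hα, ?_⟩
      have := (tendsto_rpow_neg_atTop (sub_pos.2 hlt)).const_mul a
      simpa using this
  have h2 : Tendsto (fun ρ : ℝ => a * ρ ^ (σ - s) + c * ρ ^ (-s)) atTop (𝓝 a') := by
    simpa using hlim.add ((tendsto_rpow_neg_atTop hs).const_mul c)
  filter_upwards [h2.eventually (gt_mem_nhds ha'), eventually_gt_atTop 0] with ρ hρ hρ0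
  have e : a * ρ ^ σ + c = (a * ρ ^ (σ - s) + c * ρ ^ (-s)) * ρ ^ s := by
    rw [add_mul, mul_assoc, mul_assoc, ← Real.rpow_add hρ0, ← Real.rpow_add hρ0]
    simp
  rw [e]
  gcongr

/-! ### Liouville property and conclusion -/

namespace HomogeneousGroup

variable {n : ℕ}

theorem eventually_le_of_limsup {G : HomogeneousGroup n} {r : G.HomogeneousNorm}
    {u : (Fin n → ℝ) → ℝ} {σ : ℝ} {uhat : ℝ≥0}
    (huhat : limsup (fun x => ENNReal.ofReal (max (u x) 0 / r x ^ σ)) (comap r atTop) = uhat)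
    {a : ℝ} (ha : uhat < a) : ∀ᶠ x in comap r atTop, u x ≤ a * r x ^ σ := by
  have h0 : (uhat : ENNReal) < ENNReal.ofReal a := by
    rw [← ENNReal.ofReal_coe_nnreal]
    exact (ENNReal.ofReal_lt_ofReal_iff (lt_of_le_of_lt uhat.2 ha)).2 ha
  rw [← huhat] at h0
  filter_upwards [eventually_lt_of_limsup_lt h0, tendsto_comap.eventually
    (eventually_gt_atTop (0 : ℝ))] with x hx hr
  have hr' : 0 < r x ^ σ := Real.rpow_pos_of_pos hr σ
  have h1 := (ENNReal.ofReal_lt_ofReal_iff (lt_of_le_of_lt uhat.2 ha)).1 hx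
  rw [div_lt_iff₀ hr'] at h1
  exact (le_max_left _ _).trans h1.le

/-- A locally Lipschitz function whose weak gradient vanishes where it is positive, and which is
positive somewhere, is constant. -/
theorem exists_eq_const_of_ae_gradient_eq_zero {G : CarnotGroup n} {r : G.HomogeneousNorm}
    {v : (Fin n → ℝ) → ℝ} {g : (Fin n → ℝ) → EuclideanSpace ℝ G.HorizontalIndex}
    (hv : r.LipLoc v) (hg : G.IsWeakGradient v g) (h : ∀ᵐ x, 0 < v x → g x = 0)
    {y : Fin n → ℝ} (hy : 0 < v y) (x : Fin n → ℝ) : v x = v y := by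
  -- The square of the positive part is `C¹`, so the chain rule applies; its derivative vanishes on
  -- `{v ≤ 0}`, where nothing is known about `g`.
  have hΛ := contDiff_max_zero_pow 0
  have hw := hg.comp hv hΛ
  have hwc : Continuous fun x => max (v x) 0 ^ 2 := (hv.comp hΛ).continuous
  have hvan : ∀ j : G.HorizontalIndex,
      DerivVanishes (fun x => max (v x) 0 ^ 2) (G.leftInvField j.1) := by
    intro j θ hθ hc
    have h1 := hw.2.2 j θ hθ hc
    refine h1.trans ?_
    rw [neg_eq_zero]
    refine integral_eq_zero_of_ae ?_
    filter_upwards [h] with x hx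
    rcases le_or_gt (v x) 0 with h0 | h0
    · rw [(hasDerivAt_max_zero_pow 0 (v x)).deriv, max_eq_right h0]
      simp
    · rw [hx h0]; simp
  have h1 := eq_of_derivVanishes hwc hvan x
  have h2 := eq_of_derivVanishes hwc hvan y
  rw [← h2] at h1
  have h3 : max (v x) 0 = max (v y) 0 :=
    (pow_left_inj₀ (le_max_right _ _) (le_max_right _ _) two_ne_zero).1 h1
  rw [max_eq_left hy.le] at h3
  rcases max_choice (v x) 0 with h4 | h4
  · rwa [h4] at h3
  · rw [h4] at h3; exact absurd h3 hy.ne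

/-- The Liouville property at the critical growth rate `r ^ s`. -/
theorem const_of_isWeakSolutionOn {G : CarnotGroup n} {r : G.HomogeneousNorm}
    (hr : ∀ x, x ≠ 0 → ‖G.horizontalGradient r x‖ ≤ 1)
    {p : ℝ} (hp : 1 < p) {φ : ℝ → ℝ} (hφ : WeaklyCoercive φ p) {μ s q α d K γ : ℝ}
    (hq : 0 < q) (hqp : q ≤ p - 1) (hexp : 1 - μ = q * (s - 1)) (hs : 0 ≤ s) (hα : 0 < α)
    (hd : 0 < d) (hdQ : (G.homDim : ℝ) < d + 1 - (s - 1) * (p - 1)) (hK0 : 0 < K)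
    (hK : 0 < s → (α * s) ^ q * d < K) {u : (Fin n → ℝ) → ℝ}
    (hu : ∀ᶠ x in comap r atTop, u x - γ ≤ α * r x ^ s)
    {l : ℝ → ℝ} (hl : ∀ t : ℝ, 0 < t → l t = φ t * t ^ (-q)) (hl0 : 0 ≤ l 0)
    (hsol : r.IsWeakSolutionOn φ (fun x => K * (1 + r x) ^ (-μ)) l u {x | γ < u x})
    {y : Fin n → ℝ} (hy : γ < u y) (x : Fin n → ℝ) : u x = u y := by
  obtain ⟨k, c₁, K₂, hk, hc₁, hK₂, hKK, hkey⟩ : ∃ k c₁ K₂ : ℝ, 0 < k ∧ 0 < c₁ ∧ 0 < K₂ ∧ K₂ < K ∧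
      ∀ τ : ℝ, 0 < τ → c₁ * τ + (d + s * k) ≤ k / α * τ + K₂ * τ ^ (-q) := by
    rcases hs.eq_or_lt with rfl | hpos
    · exact exists_testParams_zero hq hα hd hK0
    · exact exists_testParams_of_pos hq hα hd hpos (hK hpos)
  -- The gap `K₂ < K₁` pays for replacing `r^(-μ)` by `(1 + r)^(-μ)`; the gap `K₁ < K` is what
  -- forces the gradient to vanish.
  obtain ⟨K₁, hK₁, hK₁K⟩ := exists_between hKK
  obtain ⟨ρ, hρ⟩ := eventually_atTop.1 (eventually_rpow_le_one_add_rpow μ hK₁)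
  obtain ⟨V, hV, hVu⟩ := mem_comap.1 hu
  obtain ⟨ρ', hρ'⟩ := mem_atTop_sets.1 hV
  obtain ⟨huL, g, hg, hsol⟩ := hsol
  have hsub : ContDiff ℝ 1 fun t : ℝ => t - γ := contDiff_id.sub contDiff_const
  have hv : r.LipLoc fun x => u x - γ := huL.comp hsub
  have hgv : G.IsWeakGradient (fun x => u x - γ) g := by
    have h1 := hg.comp huL hsub
    have h2 : deriv (fun t : ℝ => t - γ) = fun _ => 1 := by
      ext t; simp
    simpa [h2] using h1
  have hΩ : {x | γ < u x} = {x | 0 < u x - γ} := by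
    ext x; simp
  rw [hΩ] at hsol
  have hae := ae_gradient_eq_zero (ρ₀ := max (max ρ ρ') 1) hr hp hφ hqp hexp hs hd hdQ hα hk hc₁
    hkey (by positivity)
    (fun t ht => hρ t ((le_max_left _ _).trans ((le_max_left _ _).trans ht)))
    (hK₂.trans hK₁).le hK₁K
    (fun x hx => hVu (hρ' _ ((le_max_right _ _).trans ((le_max_left _ _).trans hx))))
    hl hl0 hv hgv hsol
  have := exists_eq_const_of_ae_gradient_eq_zero hv hgv hae (sub_pos.2 hy) x
  linarith

end HomogeneousGroup

theorem constantH_nonneg {Q : ℕ} {p χ μ σ : ℝ} (hσ0 : 0 ≤ σ)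
    (hσ : σ ≤ criticalExponent p χ μ) : 0 ≤ constantH Q p χ μ σ := by
  unfold constantH
  split_ifs with h
  · exact le_rfl
  · push Not at h
    have h1 : σ = criticalExponent p χ μ := le_antisymm hσ h.1
    have h2 : 0 < criticalExponent p χ μ := (h1 ▸ hσ0).lt_of_ne (h.2.1 h1).symm
    have h3 := h.2.2 h1 h2
    exact mul_nonneg (Real.rpow_nonneg hσ0 _) (by linarith)

end

theorem mainTheorem3 {n : ℕ} (G : CarnotGroup n) (hQ : 1 ≤ G.homDim)
    (r : G.HomogeneousNorm) (hr : ∀ x, x ≠ 0 → ‖G.horizontalGradient r x‖ ≤ 1)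
    (p : ℝ) (hp : 1 < p) (φ : ℝ → ℝ) (hφ : WeaklyCoercive φ p)
    (μ σ χ : ℝ) (hχ0 : 0 ≤ χ) (hχ : χ < p - 1) (hμ : μ ≤ p - χ)
    (hσ0 : 0 ≤ σ) (hσ : σ ≤ criticalExponent p χ μ)
    (u : (Fin n → ℝ) → ℝ) (hu : r.LipLoc u)
    (uhat : ℝ≥0)
    (huhat : limsup (fun x => ENNReal.ofReal (max (u x) 0 / r x ^ σ)) (comap r atTop) = uhat)
    (γ : ℝ) (hγ : {x | γ < u x}.Nonempty) (hnc : ¬ ∃ c : ℝ, ∀ x, u x = c)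
    (K : ℝ) (l : ℝ → ℝ) (hl : ∀ t : ℝ, 0 < t → l t = φ t / t ^ (p - 1 - χ)) (hl0 : 0 ≤ l 0)
    (hsol : r.IsWeakSolutionOn φ (fun x => K * (1 + r x) ^ (-μ)) l u {x | γ < u x}) :
    K ≤ constantH G.homDim p χ μ σ * (uhat : ℝ) ^ (p - χ - 1) := by
  by_contra! hcon
  obtain ⟨y, hy⟩ := hγ
  have hq : 0 < p - χ - 1 := by linarith
  have hH := constantH_nonneg (Q := G.homDim) hσ0 hσ
  have hK0 : 0 < K := lt_of_le_of_lt (by positivity) hcon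
  set s := criticalExponent p χ μ with hs
  set q := p - χ - 1 with hqdef
  have hqs : q * s = p - χ - μ := by
    rw [hs, criticalExponent, ← hqdef]; field_simp
  have hexp : 1 - μ = q * (s - 1) := by rw [mul_sub, hqs, hqdef]; ring
  have hl' : ∀ t : ℝ, 0 < t → l t = φ t * t ^ (-q) := fun t ht => by
    rw [hl t ht, Real.rpow_neg ht.le, div_eq_mul_inv, hqdef]
    congr 3; ring
  -- The threshold for `d` above which the error power is integrable at infinity.
  set m₀ := (p - 1) * (s - 1) + G.homDim - 1 with hm₀
  have hfin : ∀ α d : ℝ, 0 < α → 0 < d → m₀ < d → (0 < s → (α * s) ^ q * d < K) →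
      (∀ᶠ x in comap r atTop, u x - γ ≤ α * r x ^ s) → False := by
    intro α d hα hd hmd hK hue
    exact hnc ⟨u y, HomogeneousGroup.const_of_isWeakSolutionOn hr hp hφ hq
      (by linarith) hexp (hσ0.trans hσ) hα hd (by rw [hm₀] at hmd; linarith) hK0 hK hue hl' hl0
      hsol hy⟩
  have hgrowth : ∀ a α : ℝ, uhat < a → 0 < α → 0 < s → (σ = s → a < α) →
      ∀ᶠ x in comap r atTop, u x - γ ≤ α * r x ^ s := by
    intro a α ha hα hspos haα
    filter_upwards [HomogeneousGroup.eventually_le_of_limsup huhat ha,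
      tendsto_comap.eventually (eventually_mul_rpow_add_le (c := |γ|) hσ hspos haα hα)]
      with x hx1 hx2
    have := neg_abs_le γ
    linarith
  have hdpos : 0 < max m₀ 0 + 1 := by positivity
  have hdm : m₀ < max m₀ 0 + 1 := by linarith [le_max_left m₀ 0]
  rcases hσ.lt_or_eq with hlt | heq
  · have hspos : 0 < s := hσ0.trans_lt hlt
    -- Below critical growth any `α > 0` is eventually admissible; this one makes `(α s)^q d` equal
    -- to `K / 2`.
    have hE : ((K / (2 * (max m₀ 0 + 1))) ^ (1 / q) / s * s) ^ q * (max m₀ 0 + 1) < K := by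
      rw [div_mul_cancel₀ _ hspos.ne', ← Real.rpow_mul (by positivity),
        show 1 / q * q = 1 by field_simp, Real.rpow_one]
      have : K / (2 * (max m₀ 0 + 1)) * (max m₀ 0 + 1) = K / 2 := by field_simp
      linarith
    exact hfin _ _ (by positivity) hdpos hdm (fun _ => hE)
      (hgrowth (uhat + 1) _ (by linarith) (by positivity) hspos (fun h => absurd h hlt.ne))
  · rcases (hσ0.trans hσ).eq_or_lt with hs0 | hspos
    -- When `s = 0`, `u` is bounded above near infinity and any bound serves as `α`, since no
    -- condition links it to `K`.
    · refine hfin (uhat + 1 + |γ|) _ (by positivity) hdpos hdm (fun h => absurd hs0 h.ne) ?_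
      filter_upwards [HomogeneousGroup.eventually_le_of_limsup huhat
        (a := uhat + 1) (by linarith)] with x hx
      rw [heq, ← hs0, Real.rpow_zero, mul_one] at hx
      rw [← hs0, Real.rpow_zero, mul_one]
      have := neg_abs_le γ
      linarith
    -- At critical growth the cases of the constant combine into `s^q max(m₀, 0)`, and strict
    -- inequality leaves room to perturb.
    · have hKs : ((uhat : ℝ) * s) ^ q * max m₀ 0 < K := by
        unfold constantH at hcon
        rw [← hs] at hcon
        split_ifs at hcon with h
        · have hm : m₀ ≤ 0 := by
            rcases h with h | h | h
            · exact absurd heq h.ne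
            · exact absurd h.2 hspos.ne'
            · have := h.2.2
              rw [heq] at this
              rw [hm₀]; linarith
          rw [max_eq_right hm, mul_zero]
          exact hK0
        · push Not at h
          have h3 := h.2.2 heq hspos
          rw [heq] at h3 hcon
          have hm : 0 ≤ m₀ := by rw [hm₀]; linarith
          rw [max_eq_left hm, Real.mul_rpow uhat.coe_nonneg hspos.le]
          refine lt_of_eq_of_lt ?_ hcon
          rw [hm₀]
          ring
      -- By continuity at `e = 0`, the strict inequality persists with `α = û + 2 e` and `d = max m₀
      -- 0 + e`. The growth rate `û + e` lies strictly between `û` and `α`, which leaves room for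
      -- the constant `γ`.
      have hcont : Continuous fun e : ℝ => ((uhat + 2 * e) * s) ^ q * (max m₀ 0 + e) :=
        (Continuous.rpow_const (by fun_prop) fun _ => Or.inr hq.le).mul (by fun_prop)
      have hlim := (hcont.tendsto 0).eventually (gt_mem_nhds (by simpa using hKs))
      have hlim' : ∀ᶠ e in 𝓝[>] (0 : ℝ), ((uhat + 2 * e) * s) ^ q * (max m₀ 0 + e) < K :=
        hlim.filter_mono nhdsWithin_le_nhds
      obtain ⟨e, he, hepos⟩ := (hlim'.and self_mem_nhdsWithin).exists
      have hepos' : 0 < e := hepos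
      exact hfin (uhat + 2 * e) (max m₀ 0 + e) (by positivity) (by positivity)
        (by linarith [le_max_left m₀ 0]) (fun _ => he)
        (hgrowth (uhat + e) _ (by linarith) (by positivity) hspos (fun _ => by linarith))
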